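/- **Conventions.** A context-free grammar $G=(\mathcal N,\Sigma,\mathcal P,S)$ is in Chomsky normal form if every production is of the form $A\to BC$, $A\to x$ or $S\to\varepsilon$ (with $A,B,C\in\mathcal N$, $x\in\Sigma$); $|G|$ is the total number of symbols on the left- and right-hand sides of its productions. For a string $s=s_1\cdots s_n\in\Sigma^*$ and $1\le i\le j\le n$, a nonterminal $A$ *mc-derives* $s_i\cdots s_j$ with score $l$ if (1) $l$ is the minimum, over all terminal strings $z$ with $A\Rightarrow^* z$, of the number of single-symbol insertions that turn $s_i\cdots s_j$ into $z$ (no other edit is allowed; strings $z$ that cannot be reached by insertions do not count, and there is at least one that can), and (2) $S\Rightarrow^* s_1\cdots s_{i-1}\,A\,s_{j+1}\cdots s_n$. Algorithms are programs of a unit-cost random access machine (registers and arrays of integers, initially zero outside the input, operations $+,-,\times$, integer division, comparisons, indirect addressing) all of whose numbers are polynomially bounded in the parameters named below (that is, a word RAM with words of logarithmic length). *Language edit distance with insertions as the only edit can be computed in time $O(|G|\,n^{3-\delta})$ as an mc-derivation oracle* if there are an algorithm $P$, an algorithm $Q$ and constants $K,K',c$ such that for every grammar $G$ in Chomsky normal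 form with $\varepsilon\in\mathcal L(G)$ in which every nonterminal occurs in some derivation of a terminal string from $S$, and for every nonempty string $s$ of length $n$ over $\Sigma$: on input $(G,s)$, $P$ halts after at most $K\,|G|\,n^{3-\delta}$ steps, and from the memory it leaves, $Q$ answers any sequence of queries $(A,i,j)$ with $A\in\mathcal N$, $1\le i\le j\le n$, each in at most $K'$ steps, such that the answer is $l$ whenever $A$ mc-derives $s_i\cdots s_j$ with score $l$. Here all numbers are at most $(|G|+|\Sigma|+n+L+2)^c$ in absolute value, where $L$ is any number such that every nonterminal derives a terminal string of length at most $L$. **Theorem.** Let $\delta>0$. If language edit distance with insertions as the only edit can be computed in time $O(|G|\,n^{3-\delta})$ as an mc-derivation oracle, then all-pairs shortest paths on weighted digraphs can be solved in time $\tilde O(m^{3-\delta/3}\log W)$: there are an algorithm and constants $K,k,c$ such that for all $m\ge1$, $W\ge0$ and every digraph on $m$ vertices without negative cycles whose edges have integer weights of absolute value at most $W$, the algorithm halts after at most $K\,m^{3-\delta/3}\,\log(W+2)\,(\log(m+2))^k$ steps, using only numbers of absolute value at most $(m+W+2)^c$, and outputs for every pair $(u,v)$ of vertices whether $v$ is reachable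 from $u$ and, if it is, the minimum weight of a walk from $u$ to $v$. -/

import Mathlib

/-! ## Machine model: a random access machine with unit-cost instructions on bounded integers

Programs are structured programs over finitely many integer registers and finitely many integer
arrays (the ones whose names occur in the program). Every instruction and every test costs one
step. An execution is relative to a bound `B`: every number that it computes has absolute value
at most `B`. The problems below take `B` polynomial in the parameters of the input, so that the
machine is a word RAM with words of logarithmically many bits. -/

namespace RAM

/-- Memory: the registers `reg x` and the cells `arr a k` of the arrays `arr a`. -/
structure State where
  reg : ℕ → ℤ
  arr : ℕ → ℤ → ℤ

/-- The arithmetic operations. -/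
inductive Op
  | add
  | sub
  | mul
  | div

/-- The value of an arithmetic operation (`div` is integer division, with `a / 0 = 0`). -/
def Op.eval : Op → ℤ → ℤ → ℤ
  | .add, a, b => a + b
  | .sub, a, b => a - b
  | .mul, a, b => a * b
  | .div, a, b => a / b

/-- Programs. -/
inductive Prog
  /-- Do nothing. -/
  | skip
  /-- `reg x := k` -/
  | const (x : ℕ) (k : ℤ)
  /-- `reg x := reg y ∘ reg z` for an arithmetic operation `∘` -/
  | arith (o : Op) (x y z : ℕ)
  /-- `reg x := arr a (reg y)` -/
  | load (x a y : ℕ)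
  /-- `arr a (reg y) := reg x` -/
  | store (a y x : ℕ)
  /-- `p; q` -/
  | seq (p q : Prog)
  /-- `if reg x < reg y then p else q` -/
  | ite (x y : ℕ) (p q : Prog)
  /-- `while reg x < reg y do p` -/
  | loop (x y : ℕ) (p : Prog)

/-- Write a register. -/
def State.setReg (σ : State) (x : ℕ) (v : ℤ) : State :=
  { σ with reg := Function.update σ.reg x v }

/-- Write an array cell. -/
def State.setArr (σ : State) (a : ℕ) (k v : ℤ) : State :=
  { σ with arr := Function.update σ.arr a (Function.update (σ.arr a) k v) }

/-- `Exec B p σ σ' t`: started in memory `σ`, the program `p` halts after exactly `t` steps in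
memory `σ'`, and every number it computes on the way has absolute value at most `B`. -/
inductive Exec (B : ℕ) : Prog → State → State → ℕ → Prop
  | skip (σ : State) : Exec B .skip σ σ 1
  | const (σ : State) (x : ℕ) (k : ℤ) (hB : |k| ≤ B) :
      Exec B (.const x k) σ (σ.setReg x k) 1
  | arith (σ : State) (o : Op) (x y z : ℕ) (hB : |o.eval (σ.reg y) (σ.reg z)| ≤ B) :
      Exec B (.arith o x y z) σ (σ.setReg x (o.eval (σ.reg y) (σ.reg z))) 1
  | load (σ : State) (x a y : ℕ) :
      Exec B (.load x a y) σ (σ.setReg x (σ.arr a (σ.reg y))) 1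
  | store (σ : State) (a y x : ℕ) :
      Exec B (.store a y x) σ (σ.setArr a (σ.reg y) (σ.reg x)) 1
  | seq {p q : Prog} {σ σ₁ σ₂ : State} {t₁ t₂ : ℕ}
      (h₁ : Exec B p σ σ₁ t₁) (h₂ : Exec B q σ₁ σ₂ t₂) :
      Exec B (.seq p q) σ σ₂ (t₁ + t₂)
  | ite_true {x y : ℕ} {p q : Prog} {σ σ' : State} {t : ℕ}
      (hc : σ.reg x < σ.reg y) (h : Exec B p σ σ' t) :
      Exec B (.ite x y p q) σ σ' (t + 1)
  | ite_false {x y : ℕ} {p q : Prog} {σ σ' : State} {t : ℕ}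
      (hc : ¬ σ.reg x < σ.reg y) (h : Exec B q σ σ' t) :
      Exec B (.ite x y p q) σ σ' (t + 1)
  | loop_done {x y : ℕ} {p : Prog} {σ : State} (hc : ¬ σ.reg x < σ.reg y) :
      Exec B (.loop x y p) σ σ 1
  | loop_step {x y : ℕ} {p : Prog} {σ σ₁ σ₂ : State} {t₁ t₂ : ℕ}
      (hc : σ.reg x < σ.reg y) (h₁ : Exec B p σ σ₁ t₁) (h₂ : Exec B (.loop x y p) σ₁ σ₂ t₂) :
      Exec B (.loop x y p) σ σ₂ (t₁ + t₂ + 1)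

end RAM

/-! ## Language edit distance with insertions only, as an mc-derivation oracle -/

namespace LanEd

/-- A context-free grammar as an input: nonterminals `0, …, nt - 1`, terminals `0, …, tm - 1`, and
a list of the productions without repetitions. -/
structure Grammar where
  nt : ℕ
  tm : ℕ
  start : Fin nt
  rules : List (ContextFreeRule (Fin tm) (Fin nt))
  nodup : rules.Nodup

namespace Grammar

/-- The context-free grammar that is described. -/
def toCFG (G : Grammar) : ContextFreeGrammar (Fin G.tm) where
  NT := Fin G.nt
  initial := G.start
  rules := G.rules.toFinset

/-- Strings of terminals and nonterminals. -/
abbrev Form (G : Grammar) := List (Symbol (Fin G.tm) (Fin G.nt))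

/-- `G.Derives α β`: `β` can be derived from `α`, that is, `α ⇒* β`. -/
def Derives (G : Grammar) (α β : G.Form) : Prop := G.toCFG.Derives α β

/-- A terminal string as a sentential form. -/
def ofTerminals (G : Grammar) (z : List (Fin G.tm)) : G.Form := z.map Symbol.terminal

/-- `|G|`: the total number of symbols in the productions (left- and right-hand sides). -/
def size (G : Grammar) : ℕ := (G.rules.map fun r => 1 + r.output.length).sum

/-- Chomsky normal form: every production is of the form `A → B C`, `A → x` or `S → ε`. -/
def IsCNF (G : Grammar) : Prop :=
  ∀ r ∈ G.rules,
    (∃ B C : Fin G.nt, r.output = [Symbol.nonterminal B, Symbol.nonterminal C]) ∨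
    (∃ x : Fin G.tm, r.output = [Symbol.terminal x]) ∨
    (r.input = G.start ∧ r.output = [])

/-- Every nonterminal occurs in some derivation, from the start symbol, of a terminal string. -/
def AllReachable (G : Grammar) : Prop :=
  ∀ A : Fin G.nt, ∃ (α β : G.Form) (z : List (Fin G.tm)),
    G.Derives [Symbol.nonterminal G.start] (α ++ [Symbol.nonterminal A] ++ β) ∧
    G.Derives (α ++ [Symbol.nonterminal A] ++ β) (G.ofTerminals z)

/-- The grammars on which an algorithm has to work: in Chomsky normal form, with all nonterminals
reachable, and with the empty string in the language. -/
def Admissible (G : Grammar) : Prop :=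
  G.IsCNF ∧ G.AllReachable ∧ [] ∈ G.toCFG.language

end Grammar

/-- `Insertions l v z`: the string `z` arises from `v` by exactly `l` insertions of a symbol. -/
inductive Insertions {α : Type} : ℕ → List α → List α → Prop
  | refl (v : List α) : Insertions 0 v v
  | insert {l : ℕ} {v : List α} (x y : List α) (a : α) (h : Insertions l v (x ++ y)) :
      Insertions (l + 1) v (x ++ a :: y)

/-- The substring `s_i s_{i+1} ⋯ s_j` of `s = s_1 ⋯ s_n`. -/
def substr {α : Type} (s : List α) (i j : ℕ) : List α := (s.take j).drop (i - 1)

/-- `A` mc-derives (minimally and consistently derives) the substring `s_i ⋯ s_j` with score `l`: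
`l` is the least number of insertions that turn `s_i ⋯ s_j` into a terminal string derived
from `A`, and `S ⇒* s_1 ⋯ s_{i-1} A s_{j+1} ⋯ s_n`. -/
def MCDerives (G : Grammar) (s : List (Fin G.tm)) (A : Fin G.nt) (i j l : ℕ) : Prop :=
  IsLeast {l : ℕ | ∃ z : List (Fin G.tm),
    G.Derives [Symbol.nonterminal A] (G.ofTerminals z) ∧ Insertions l (substr s i j) z} l ∧
  G.Derives [Symbol.nonterminal G.start]
    (G.ofTerminals (s.take (i - 1)) ++ [Symbol.nonterminal A] ++ G.ofTerminals (s.drop j))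

/-- The code of a symbol in memory: `A + 1` for a nonterminal `A`, `-(x + 1)` for a
terminal `x`. -/
def symbolCode {tm nt : ℕ} : Symbol (Fin tm) (Fin nt) → ℤ
  | .nonterminal A => (A : ℤ) + 1
  | .terminal x => -((x : ℤ) + 1)

/-- The memory that holds the input `G`, `s`. Registers `0`, …, `4` hold the numbers of
nonterminals and terminals, the start symbol, the number of productions and the length of `s`.
For the `r`-th production (counted from `0`), array `0` holds the left-hand side in cell `r`, and
array `1` the codes of the at most two symbols of the right-hand side in the cells `2 r`
and `2 r + 1`, where `0` stands for a missing symbol. Array `2` holds the string `s`. All other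
registers and cells are `0`. -/
def inputState (G : Grammar) (s : List (Fin G.tm)) : RAM.State where
  reg x :=
    match x with
    | 0 => G.nt
    | 1 => G.tm
    | 2 => (G.start : ℕ)
    | 3 => G.rules.length
    | 4 => s.length
    | _ => 0
  arr a k :=
    if k < 0 then 0 else
    match a with
    | 0 => (G.rules[k.toNat]?).elim 0 fun r => ((r.input : ℕ) : ℤ)
    | 1 => (G.rules[k.toNat / 2]?).elim 0 fun r => (r.output[k.toNat % 2]?).elim 0 symbolCode
    | 2 => (s[k.toNat]?).elim 0 fun x => ((x : ℕ) : ℤ)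
    | _ => 0

/-- Put the query `(A, i, j)` into the registers `0`, `1`, `2`. -/
def ask (σ : RAM.State) (A i j : ℕ) : RAM.State :=
  ((σ.setReg 0 A).setReg 1 i).setReg 2 j

/-- `Served B Q k n σ₀ σ`: the memory `σ` is left after the query program `Q` has answered some
finite sequence of queries `(A, i, j)`, with `A < k` and `1 ≤ i ≤ j ≤ n`, the first of them from
memory `σ₀`. -/
inductive Served (B : ℕ) (Q : RAM.Prog) (k n : ℕ) (σ₀ : RAM.State) : RAM.State → Prop
  | start : Served B Q k n σ₀ σ₀
  | query {σ σ' : RAM.State} {A i j t : ℕ} (h : Served B Q k n σ₀ σ)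
      (hA : A < k) (hi : 1 ≤ i) (hij : i ≤ j) (hj : j ≤ n)
      (hQ : RAM.Exec B Q (ask σ A i j) σ' t) : Served B Q k n σ₀ σ'

/-- Language edit distance with insertions as the only edit can be computed in time
`O(f |G| n)`: there are a program `P`, which reads `G` and a nonempty string `s` of length `n`,
halts after at most `K * f |G| n` steps and so leaves an oracle in memory, and a program `Q`, which
then answers any sequence of queries `(A, i, j)` in at most `K'` steps each; the answer is
the score if `A` mc-derives `s_i ⋯ s_j`, and may be anything otherwise. All numbers are at most
polynomial in `|G|`, in the numbers of terminals, in `n`, and in any number `L` such that every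
nonterminal derives a terminal string of length at most `L` (all scores are polynomial in
these parameters). -/
def SolvableInO (f : ℕ → ℕ → ℝ) : Prop :=
  ∃ (P Q : RAM.Prog) (K : ℝ) (K' c : ℕ),
    ∀ (G : Grammar) (s : List (Fin G.tm)) (L : ℕ), G.Admissible → s ≠ [] →
      (∀ A : Fin G.nt, ∃ z : List (Fin G.tm),
        G.Derives [Symbol.nonterminal A] (G.ofTerminals z) ∧ z.length ≤ L) →
      ∃ (B : ℕ) (σ₀ : RAM.State) (T : ℕ),
        B = (G.size + G.tm + s.length + L + 2) ^ c ∧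
        RAM.Exec B P (inputState G s) σ₀ T ∧
        (T : ℝ) ≤ K * f G.size s.length ∧
        ∀ σ : RAM.State, Served B Q G.nt s.length σ₀ σ →
          ∀ (A : Fin G.nt) (i j : ℕ), 1 ≤ i → i ≤ j → j ≤ s.length →
            ∃ (σ' : RAM.State) (t : ℕ),
              RAM.Exec B Q (ask σ A i j) σ' t ∧ t ≤ K' ∧
              ∀ l : ℕ, MCDerives G s A i j l → σ'.reg 0 = l

end LanEd

/-! ## All-pairs shortest paths -/

namespace APSP

/-- An integer-weighted digraph on the vertices `0, …, m - 1`; `w u v = none` means that there is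
no edge from `u` to `v`. -/
abbrev WDigraph (m : ℕ) := Fin m → Fin m → Option ℤ

/-- `IsWalk w u v d`: there is a walk from `u` to `v` of total weight `d`. -/
inductive IsWalk {m : ℕ} (w : WDigraph m) : Fin m → Fin m → ℤ → Prop
  | nil (u : Fin m) : IsWalk w u u 0
  | cons {u v z : Fin m} {x d : ℤ} (he : w u v = some x) (h : IsWalk w v z d) :
      IsWalk w u z (x + d)

/-- There is no cycle of negative weight. -/
def NoNegativeCycle {m : ℕ} (w : WDigraph m) : Prop :=
  ∀ (u : Fin m) (d : ℤ), IsWalk w u u d → 0 ≤ d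

/-- The memory that holds the input: register `0` holds `m`; for every pair of vertices, cell
`u * m + v` of array `0` holds the weight of the edge from `u` to `v` (`0` if there is none), and
the same cell of array `1` holds `1` if the edge exists, and `0` otherwise. All other registers and
cells are `0`. -/
def inputState {m : ℕ} (w : WDigraph m) : RAM.State where
  reg x := if x = 0 then m else 0
  arr a k :=
    if h : 0 ≤ k ∧ k < (m : ℤ) * m then
      let e : Option ℤ := w
        ⟨k.toNat / m, Nat.div_lt_of_lt_mul (by zify; rw [Int.toNat_of_nonneg h.1]; exact h.2)⟩
        ⟨k.toNat % m, Nat.mod_lt _ (Nat.pos_of_ne_zero (by rintro rfl; simp at h; omega))⟩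
      match a with
      | 0 => e.getD 0
      | 1 => if e.isSome then 1 else 0
      | _ => 0
    else 0

/-- The memory `σ` holds all distances of `w`: for every pair of vertices, cell `u * m + v` of
array `1` holds `1` if `v` can be reached from `u` and `0` otherwise, and in the first case the
same cell of array `0` holds the least weight of a walk from `u` to `v`. -/
def IsOutput {m : ℕ} (w : WDigraph m) (σ : RAM.State) : Prop :=
  ∀ u v : Fin m,
    ((∃ d : ℤ, IsWalk w u v d) →
      σ.arr 1 ((u : ℤ) * m + v) = 1 ∧
      IsLeast {d : ℤ | IsWalk w u v d} (σ.arr 0 ((u : ℤ) * m + v))) ∧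
    ((¬ ∃ d : ℤ, IsWalk w u v d) → σ.arr 1 ((u : ℤ) * m + v) = 0)

/-- All-pairs shortest paths on digraphs with `m ≥ 1` vertices, integer edge weights of absolute
value at most `W` and no negative cycle can be solved in time `Õ(f m W)`, that is, in at most
`K * f m W * (log (m + 2)) ^ k` steps, on numbers that are at most polynomial in `m` and `W`. -/
def SolvableInSoftO (f : ℕ → ℕ → ℝ) : Prop :=
  ∃ (P : RAM.Prog) (K : ℝ) (k c : ℕ),
    ∀ (m W : ℕ) (w : WDigraph m), 1 ≤ m →
      (∀ (u v : Fin m) (x : ℤ), w u v = some x → |x| ≤ W) → NoNegativeCycle w →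
      ∃ (σ : RAM.State) (T : ℕ),
        RAM.Exec ((m + W + 2) ^ c) P (inputState w) σ T ∧
        (T : ℝ) ≤ K * f m W * Real.log (m + 2) ^ k ∧
        IsOutput w σ

end APSP

/-! ## A small imperative language and its compilation to the random access machine -/

/-! The reduction has two layers: repeated min-plus squaring for shortest paths, and an encoding of
one min-plus square as a single instance of language edit distance with insertions, whose oracle
answers give all entries of the square.

Encoding. Let the matrix have `q ^ 3` rows, with `q` about the cube root of the number `m` of
vertices, and nonnegative entries below `2 ^ len`. An index `i` is split into its quotient `i / q`,
with `q ^ 2` possible values, and its remainder `i % q`. Quotients are stored in nonterminals,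
remainders in positions of the word. The word consists of the `3 q + 3` distinct letters in
increasing order, and one further terminal, the mark, never occurs in it. For the entry `(i, j)` of
the square, the query asks for the nonterminal `prod` of the two quotients of `i` and `j`, on the
substring from letter `i % q` to letter `2 q + 3 + j % q`. The productions of `prod` guess the
quotient of the inner index `k` and split into two `factor` nonterminals. The first factor chooses
an entry `(i, k)` and ends in the letter `q + 1 + k % q`, the second chooses an entry `(k, j)` and
begins with the letter `q + 2 + k % q`. In a derived string whose letters are exactly the queried
ones, these two letters are adjacent, which forces both factors to use the same `k`.

Scores. A factor also produces marks, which have to be inserted: `2 ^ len - 1 + value` of them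
through the nonterminals `chain` and `power`, and `price = 4 * 2 ^ len` for each letter strictly
between its ends. The price exceeds every possible sum of two values, so a derived string with
superfluous letters is never better than one without. Hence the score is a known constant plus the
minimum over `k` of the two values (`exists_score_le` for the lower bound, `der_prod` for the upper
bound, `mcDerives` for the combination). The start symbol surrounds any `prod` by arbitrary letters,
which is the consistency condition (`context_derives`).

Time. The grammar has size `O(q ^ 6 * len)`, that is `O(m ^ 2 * len)`, and the word has length `O(m
^ (1 / 3))`. So an oracle with bound `|G| n ^ (3 - δ)` is built in time `O(m ^ (3 - δ / 3) * len)`,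
after which `O(m ^ 2)` queries take constant time each (`exists_affordable`).

Shortest paths. Missing edges get a large weight and the diagonal gets weight zero, so walks with
exactly `2 ^ R ≥ m` steps have the right least weights (`IsMinMatrix.distance`). These come from `R`
squarings. Before each one the entries are shifted to be nonnegative (`squareAll_runs`). The whole
algorithm is written in a small imperative language with a compiler of constant overhead
(`Exec.compile`). The given oracle programs are run inside its arrays (`simulate_exec`), with a
fresh zero memory for each squaring. -/

namespace Imp

/-- The program variables. -/
inductive Var
  | vtx | side | wmax | pw | rounds | len | big | ctr | rnd | count
  deriving DecidableEq

/-- The register that holds a variable. -/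
def Var.idx : Var → ℕ
  | .vtx => 0
  | .side => 1
  | .wmax => 2
  | .pw => 3
  | .rounds => 4
  | .len => 5
  | .big => 6
  | .ctr => 7
  | .rnd => 8
  | .count => 9

theorem Var.idx_lt (x : Var) : x.idx < 10 := by cases x <;> decide

theorem Var.idx_injective : Function.Injective Var.idx := by
  intro x y h
  cases x <;> cases y <;> first | rfl | exact absurd h (by decide)

/-- Memory: variables and arrays. -/
structure Mem where
  reg : Var → ℤ
  arr : ℕ → ℤ → ℤ

/-- Assign to a variable. -/
def Mem.set (σ : Mem) (x : Var) (v : ℤ) : Mem :=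
  { σ with reg := Function.update σ.reg x v }

/-- Write an array cell. -/
def Mem.setArr (σ : Mem) (a : ℕ) (k v : ℤ) : Mem :=
  { σ with arr := Function.update σ.arr a (Function.update (σ.arr a) k v) }

@[simp] theorem Mem.set_arr (σ : Mem) (x : Var) (v : ℤ) : (σ.set x v).arr = σ.arr := rfl

@[simp] theorem Mem.setArr_reg (σ : Mem) (a : ℕ) (k v : ℤ) : (σ.setArr a k v).reg = σ.reg := rfl

theorem Mem.set_reg (σ : Mem) (x y : Var) (v : ℤ) :
    (σ.set x v).reg y = if y = x then v else σ.reg y := by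
  simp [Mem.set, Function.update_apply]

theorem Mem.setArr_arr (σ : Mem) (a b : ℕ) (k l v : ℤ) :
    (σ.setArr a k v).arr b l = if b = a ∧ l = k then v else σ.arr b l := by
  by_cases h : b = a
  · subst h; by_cases h' : l = k <;> simp [Mem.setArr, h']
  · simp [Mem.setArr, h]

/-- Expressions; `ite a b c d` is `if a < b then c else d`. -/
inductive Expr
  | const (k : ℤ)
  | var (x : Var)
  | op (o : RAM.Op) (a b : Expr)
  | load (a : ℕ) (i : Expr)
  | ite (a b c d : Expr)

namespace Expr

/-- The value of an expression. -/
def eval (σ : Mem) : Expr → ℤ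
  | const k => k
  | var x => σ.reg x
  | op o a b => o.eval (a.eval σ) (b.eval σ)
  | load a i => σ.arr a (i.eval σ)
  | ite a b c d => if a.eval σ < b.eval σ then c.eval σ else d.eval σ

/-- The size of an expression; a constant counts with its absolute value. -/
def size : Expr → ℕ
  | const k => k.natAbs + 1
  | var _ => 1
  | op _ a b => a.size + b.size + 1
  | load _ i => i.size + 1
  | ite a b c d => a.size + b.size + c.size + d.size + 1

instance : Add Expr := ⟨op .add⟩
instance : Sub Expr := ⟨op .sub⟩
instance : Mul Expr := ⟨op .mul⟩
instance : Div Expr := ⟨op .div⟩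
instance : Mod Expr := ⟨fun a b => a - a / b * b⟩
instance : Coe Var Expr := ⟨var⟩
instance (n : ℕ) : OfNat Expr n := ⟨const n⟩

variable (σ : Mem) (a b : Expr)

@[simp] theorem eval_var (x : Var) : (var x).eval σ = σ.reg x := rfl
@[simp] theorem eval_const (k : ℤ) : (const k).eval σ = k := rfl
@[simp] theorem eval_zero : (0 : Expr).eval σ = 0 := rfl
@[simp] theorem eval_one : (1 : Expr).eval σ = 1 := rfl
@[simp] theorem eval_ofNat (n : ℕ) [n.AtLeastTwo] :
    (ofNat(n) : Expr).eval σ = ofNat(n) := rfl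
@[simp] theorem eval_load (i : ℕ) : (load i a).eval σ = σ.arr i (a.eval σ) := rfl
@[simp] theorem eval_ite (c d : Expr) : (ite a b c d).eval σ =
    if a.eval σ < b.eval σ then c.eval σ else d.eval σ := rfl
@[simp] theorem eval_add : (a + b).eval σ = a.eval σ + b.eval σ := rfl
@[simp] theorem eval_sub : (a - b).eval σ = a.eval σ - b.eval σ := rfl
@[simp] theorem eval_mul : (a * b).eval σ = a.eval σ * b.eval σ := rfl
@[simp] theorem eval_div : (a / b).eval σ = a.eval σ / b.eval σ := rfl
@[simp] theorem eval_mod : (a % b).eval σ = a.eval σ % b.eval σ := by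
  change a.eval σ - a.eval σ / b.eval σ * b.eval σ = _
  rw [Int.emod_def, mul_comm]

end Expr

/-- All variables and cells have absolute value at most `M`. -/
def Mem.Bdd (M : ℕ) (σ : Mem) : Prop := (∀ x, |σ.reg x| ≤ M) ∧ ∀ a k, |σ.arr a k| ≤ M

theorem Mem.Bdd.set {M : ℕ} {σ : Mem} (h : σ.Bdd M) (x : Var) {v : ℤ} (hv : |v| ≤ M) :
    (σ.set x v).Bdd M := by
  refine ⟨fun y => ?_, h.2⟩
  rw [Mem.set_reg]; split_ifs
  exacts [hv, h.1 y]

theorem Mem.Bdd.setArr {M : ℕ} {σ : Mem} (h : σ.Bdd M) (a : ℕ) (k : ℤ) {v : ℤ} (hv : |v| ≤ M) :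
    (σ.setArr a k v).Bdd M := by
  refine ⟨h.1, fun b l => ?_⟩
  rw [Mem.setArr_arr]; split_ifs
  exacts [hv, h.2 b l]

/-- Bounds multiply along operations, so the size of an expression serves as exponent of `M`.
Constants count with their absolute value because `|k| < 2 ^ (|k| + 1)`. As the exponent depends
only on the program, intermediate results stay polynomial. -/
theorem Expr.abs_eval_le {M : ℕ} (hM : 2 ≤ M) {σ : Mem} (h : σ.Bdd M) (e : Expr) :
    |e.eval σ| ≤ ((M ^ e.size : ℕ) : ℤ) := by
  have hM1 : (1 : ℤ) ≤ M := by exact_mod_cast (by omega : 1 ≤ M)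
  have hM2 : (2 : ℤ) ≤ M := by exact_mod_cast hM
  have mono : ∀ {i j : ℕ}, i ≤ j → (M : ℤ) ^ i ≤ (M : ℤ) ^ j := fun h => pow_le_pow_right₀ hM1 h
  have hpos : ∀ i : ℕ, (1 : ℤ) ≤ (M : ℤ) ^ i := fun i => one_le_pow₀ hM1
  induction e with
  | const k =>
    have h1 : k.natAbs < 2 ^ (k.natAbs + 1) := by
      exact (Nat.lt_two_pow_self).trans (Nat.pow_lt_pow_right (by norm_num) (by omega))
    have h2 : 2 ^ (k.natAbs + 1) ≤ M ^ (k.natAbs + 1) := Nat.pow_le_pow_left hM _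
    simp only [Expr.eval, Expr.size]
    rw [Int.abs_eq_natAbs]; exact_mod_cast (h1.le.trans h2)
  | var x => simpa [Expr.eval, Expr.size] using h.1 x
  | load a i _ =>
    push_cast
    refine (h.2 a _).trans ?_
    calc (M : ℤ) = (M : ℤ) ^ 1 := (pow_one _).symm
      _ ≤ _ := mono (by simp [Expr.size])
  | ite a b c d _ _ hc hd =>
    push_cast at *
    simp only [Expr.eval]
    split_ifs
    · exact hc.trans (mono (by simp only [Expr.size]; omega))
    · exact hd.trans (mono (by simp only [Expr.size]; omega))
  | op o a b ha hb =>
    push_cast at *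
    have hS : (M : ℤ) ^ (op o a b).size = (M : ℤ) ^ a.size * (M : ℤ) ^ b.size * M := by
      simp only [Expr.size, pow_add, pow_one]
    have h1 := hpos a.size
    have h2 := hpos b.size
    rw [hS]
    generalize (M : ℤ) ^ a.size = A at *
    generalize (M : ℤ) ^ b.size = C at *
    -- The additional unit in the size of an operation gives the factor `M ≥ 2`, which absorbs the
    -- constant in `A + C ≤ 2 A C` for `A, C ≥ 1`.
    have hAC : A * C * 2 ≤ A * C * M := by gcongr
    have hsum : A + C ≤ A * C * 2 := by nlinarith
    simp only [Expr.eval]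
    generalize a.eval σ = u at *
    generalize b.eval σ = v at *
    cases o with
    | add => exact (abs_add_le _ _).trans (by linarith)
    | sub => exact (abs_sub _ _).trans (by linarith)
    | mul =>
      simp only [RAM.Op.eval, abs_mul]
      calc |u| * |v| ≤ A * C := by gcongr
        _ ≤ A * C * 2 := by nlinarith
        _ ≤ _ := hAC
    | div =>
      simp only [RAM.Op.eval]
      exact (Int.abs_ediv_le_abs u v).trans (by nlinarith)

/-- A machine state represents a memory. -/
def Rep (σ : Mem) (τ : RAM.State) : Prop := (∀ x : Var, τ.reg x.idx = σ.reg x) ∧ τ.arr = σ.arr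

/-- Compute an expression into register `d`, using only registers from `d` on. -/
def Expr.compile : Expr → ℕ → RAM.Prog
  | const k, d => .const d k
  | var x, d => .seq (.const d 0) (.arith .add d x.idx d)
  | op o a b, d => .seq (a.compile d) (.seq (b.compile (d + 1)) (.arith o d d (d + 1)))
  | load a i, d => .seq (i.compile d) (.load d a d)
  | ite a b c e, d => .seq (a.compile d) (.seq (b.compile (d + 1))
      (.ite d (d + 1) (c.compile d) (e.compile d)))

theorem Rep.congr {σ : Mem} {τ τ' : RAM.State} {d : ℕ} (h : Rep σ τ) (hd : 10 ≤ d)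
    (hr : ∀ y < d, τ'.reg y = τ.reg y) (ha : τ'.arr = τ.arr) : Rep σ τ' :=
  ⟨fun x => (hr _ (x.idx_lt.trans_le hd)).trans (h.1 x), ha.trans h.2⟩

/-- Registers below `d` are never written, so the left operand survives in `d` while the right one
is computed into `d + 1`. Variables occupy the registers below 10. Reading a variable takes two
instructions, since the machine copies a register only by adding zero; hence the factor 2 in the
time. -/
theorem Expr.compile_exec {M S : ℕ} (hM : 2 ≤ M) {σ : Mem} (hσ : σ.Bdd M) (e : Expr)
    (he : e.size ≤ S) (d : ℕ) (hd : 10 ≤ d) (τ : RAM.State) (hτ : Rep σ τ) :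
    ∃ (τ' : RAM.State) (t : ℕ), RAM.Exec (M ^ S) (e.compile d) τ τ' t ∧ t ≤ 2 * e.size ∧
      (∀ y < d, τ'.reg y = τ.reg y) ∧ τ'.arr = τ.arr ∧ τ'.reg d = e.eval σ := by
  have hB : ∀ e' : Expr, e'.size ≤ S → |e'.eval σ| ≤ ((M ^ S : ℕ) : ℤ) := fun e' h' =>
    (e'.abs_eval_le hM hσ).trans (by exact_mod_cast Nat.pow_le_pow_right (by omega) h')
  have hB0 := hB e he
  induction e generalizing d τ with
  | const k =>
    refine ⟨_, _, .const _ _ _ hB0, by simp only [size]; omega, fun y hy => ?_, rfl, ?_⟩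
    · simp [RAM.State.setReg, hy.ne]
    · simp [RAM.State.setReg, eval]
  | var x =>
    have hx : x.idx ≠ d := (x.idx_lt.trans_le hd).ne
    refine ⟨_, _, .seq (.const _ _ _ (by simp)) (.arith _ _ _ _ _ ?_), by simp [size],
      fun y hy => ?_, rfl, ?_⟩
    · simpa [RAM.State.setReg, RAM.Op.eval, hx, hτ.1 x, eval] using hB0
    · simp [RAM.State.setReg, hy.ne]
    · simp [RAM.State.setReg, RAM.Op.eval, hx, hτ.1 x, eval]
  | op o a b iha ihb =>
    simp only [size] at he
    obtain ⟨τ₁, t₁, e₁, l₁, r₁, a₁, v₁⟩ := iha (by omega) d hd τ hτ (hB _ (by omega))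
    have hτ₁ := hτ.congr hd r₁ a₁
    obtain ⟨τ₂, t₂, e₂, l₂, r₂, a₂, v₂⟩ := ihb (by omega) (d + 1) (by omega) τ₁ hτ₁
      (hB _ (by omega))
    have hv : τ₂.reg d = a.eval σ := (r₂ d (by omega)).trans v₁
    refine ⟨_, _, .seq e₁ (.seq e₂ (.arith _ _ _ _ _ ?_)), by simp only [size]; omega,
      fun y hy => ?_, ?_, ?_⟩
    · rw [hv, v₂]; exact hB0
    · simp [RAM.State.setReg, hy.ne, r₂ y (by omega), r₁ y hy]
    · simp [RAM.State.setReg, a₂, a₁]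
    · simp [RAM.State.setReg, hv, v₂, eval]
  | load a i ih =>
    simp only [size] at he
    obtain ⟨τ₁, t₁, e₁, l₁, r₁, a₁, v₁⟩ := ih (by omega) d hd τ hτ (hB _ (by omega))
    refine ⟨_, _, .seq e₁ (.load _ _ _ _), by simp only [size]; omega, fun y hy => ?_, ?_, ?_⟩
    · simp [RAM.State.setReg, hy.ne, r₁ y hy]
    · simp [RAM.State.setReg, a₁]
    · simp [RAM.State.setReg, v₁, eval, a₁, hτ.2]
  | ite a b c e iha ihb ihc ihe =>
    simp only [size] at he
    obtain ⟨τ₁, t₁, e₁, l₁, r₁, a₁, v₁⟩ := iha (by omega) d hd τ hτ (hB _ (by omega))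
    have hτ₁ := hτ.congr hd r₁ a₁
    obtain ⟨τ₂, t₂, e₂, l₂, r₂, a₂, v₂⟩ := ihb (by omega) (d + 1) (by omega) τ₁ hτ₁
      (hB _ (by omega))
    have hτ₂ := hτ₁.congr (by omega) r₂ a₂
    have hv : τ₂.reg d = a.eval σ := (r₂ d (by omega)).trans v₁
    by_cases hc : a.eval σ < b.eval σ
    · obtain ⟨τ₃, t₃, e₃, l₃, r₃, a₃, v₃⟩ := ihc (by omega) d hd τ₂ hτ₂ (hB _ (by omega))
      refine ⟨_, _, .seq e₁ (.seq e₂ (.ite_true (by rwa [hv, v₂]) e₃)),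
        by simp only [size]; omega, fun y hy => ?_, ?_, ?_⟩
      · rw [r₃ y hy, r₂ y (by omega), r₁ y hy]
      · rw [a₃, a₂, a₁]
      · simp [v₃, eval, hc]
    · obtain ⟨τ₃, t₃, e₃, l₃, r₃, a₃, v₃⟩ := ihe (by omega) d hd τ₂ hτ₂ (hB _ (by omega))
      refine ⟨_, _, .seq e₁ (.seq e₂ (.ite_false (by rwa [hv, v₂]) e₃)),
        by simp only [size]; omega, fun y hy => ?_, ?_, ?_⟩
      · rw [r₃ y hy, r₂ y (by omega), r₁ y hy]
      · rw [a₃, a₂, a₁]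
      · simp [v₃, eval, hc]

/-- Statements; the tests are of the form `a < b`. -/
inductive Stmt
  | skip
  | assign (x : Var) (e : Expr)
  | store (a : ℕ) (i e : Expr)
  | seq (p q : Stmt)
  | ite (a b : Expr) (p q : Stmt)
  | loop (a b : Expr) (p : Stmt)

/-- A bound for the sizes of the expressions in a statement. -/
def Stmt.size : Stmt → ℕ
  | skip => 0
  | assign _ e => e.size
  | store _ i e => i.size + e.size
  | seq p q => p.size + q.size
  | ite a b p q => a.size + b.size + p.size + q.size
  | loop a b p => a.size + b.size + p.size

/-- Big-step semantics: every atomic statement and every test takes one step, and every value that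
is written has absolute value at most `M`. -/
inductive Exec (M : ℕ) : Stmt → Mem → Mem → ℕ → Prop
  | skip (σ : Mem) : Exec M .skip σ σ 1
  | assign (σ : Mem) (x : Var) (e : Expr) (h : |e.eval σ| ≤ M) :
      Exec M (.assign x e) σ (σ.set x (e.eval σ)) 1
  | store (σ : Mem) (a : ℕ) (i e : Expr) (h : |e.eval σ| ≤ M) :
      Exec M (.store a i e) σ (σ.setArr a (i.eval σ) (e.eval σ)) 1
  | seq {p q : Stmt} {σ σ₁ σ₂ : Mem} {t₁ t₂ : ℕ}
      (h₁ : Exec M p σ σ₁ t₁) (h₂ : Exec M q σ₁ σ₂ t₂) : Exec M (.seq p q) σ σ₂ (t₁ + t₂)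
  | ite_true {a b : Expr} {p q : Stmt} {σ σ' : Mem} {t : ℕ}
      (hc : a.eval σ < b.eval σ) (h : Exec M p σ σ' t) : Exec M (.ite a b p q) σ σ' (t + 1)
  | ite_false {a b : Expr} {p q : Stmt} {σ σ' : Mem} {t : ℕ}
      (hc : ¬ a.eval σ < b.eval σ) (h : Exec M q σ σ' t) : Exec M (.ite a b p q) σ σ' (t + 1)
  | loop_done {a b : Expr} {p : Stmt} {σ : Mem} (hc : ¬ a.eval σ < b.eval σ) :
      Exec M (.loop a b p) σ σ 1
  | loop_step {a b : Expr} {p : Stmt} {σ σ₁ σ₂ : Mem} {t₁ t₂ : ℕ} (hc : a.eval σ < b.eval σ)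
      (h₁ : Exec M p σ σ₁ t₁) (h₂ : Exec M (.loop a b p) σ₁ σ₂ t₂) :
      Exec M (.loop a b p) σ σ₂ (t₁ + t₂ + 1)

/-- Compile a statement. -/
def Stmt.compile : Stmt → RAM.Prog
  | skip => .skip
  | assign x e => .seq (e.compile 10) (.seq (.const 11 0) (.arith .add x.idx 10 11))
  | store a i e => .seq (i.compile 10) (.seq (e.compile 11) (.store a 10 11))
  | seq p q => .seq p.compile q.compile
  | ite a b p q => .seq (a.compile 10) (.seq (b.compile 11) (.ite 10 11 p.compile q.compile))
  | loop a b p => .seq (a.compile 10) (.seq (b.compile 11)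
      (.loop 10 11 (.seq p.compile (.seq (a.compile 10) (b.compile 11)))))

theorem Exec.bdd {M : ℕ} {p : Stmt} {σ σ' : Mem} {t : ℕ} (h : Exec M p σ σ' t)
    (hσ : σ.Bdd M) : σ'.Bdd M := by
  induction h with
  | skip | loop_done => exact hσ
  | assign σ x e h => exact hσ.set x h
  | store σ a i e h => exact hσ.setArr a _ h
  | seq _ _ ih₁ ih₂ | loop_step _ _ _ ih₁ ih₂ => exact ih₂ (ih₁ hσ)
  | ite_true _ _ ih | ite_false _ _ ih => exact ih hσ

theorem compile_test {M S : ℕ} (hM : 2 ≤ M) {σ : Mem} (hσ : σ.Bdd M) (a b : Expr)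
    (h : a.size + b.size ≤ S) (τ : RAM.State) (hτ : Rep σ τ) :
    ∃ (τ₁ τ₂ : RAM.State) (t₁ t₂ : ℕ), RAM.Exec (M ^ S) (a.compile 10) τ τ₁ t₁ ∧
      RAM.Exec (M ^ S) (b.compile 11) τ₁ τ₂ t₂ ∧ t₁ + t₂ ≤ 2 * S ∧ Rep σ τ₂ ∧
      τ₂.reg 10 = a.eval σ ∧ τ₂.reg 11 = b.eval σ := by
  obtain ⟨τ₁, t₁, e₁, l₁, r₁, a₁, v₁⟩ :=
    a.compile_exec (S := S) hM hσ (by omega) 10 le_rfl τ hτ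
  have hτ₁ := hτ.congr le_rfl r₁ a₁
  obtain ⟨τ₂, t₂, e₂, l₂, r₂, a₂, v₂⟩ :=
    b.compile_exec (S := S) hM hσ (by omega) 11 (by omega) τ₁ hτ₁
  exact ⟨τ₁, τ₂, t₁, t₂, e₁, e₂, by omega, hτ₁.congr (by omega) r₂ a₂,
    (r₂ 10 (by omega)).trans v₁, v₂⟩

/-- The compiled program simulates the statement, with constant overhead. -/
theorem Exec.compile {M S : ℕ} (hM : 2 ≤ M) {p : Stmt} {σ σ' : Mem} {t : ℕ}
    (h : Exec M p σ σ' t) (hS : p.size ≤ S) (hσ : σ.Bdd M) (τ : RAM.State) (hτ : Rep σ τ) :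
    ∃ (τ' : RAM.State) (t' : ℕ), RAM.Exec (M ^ (S + 1)) p.compile τ τ' t' ∧
      t' ≤ (2 * S + 5) * t ∧ Rep σ' τ' := by
  have hMS : M ≤ M ^ (S + 1) := Nat.le_self_pow (by omega) _
  induction h generalizing τ with
  | skip => exact ⟨_, _, .skip _, by omega, hτ⟩
  | assign σ x e h =>
    simp only [Stmt.size] at hS
    obtain ⟨τ₁, t₁, e₁, l₁, r₁, a₁, v₁⟩ :=
      e.compile_exec (S := S + 1) hM hσ (by omega) 10 le_rfl τ hτ
    refine ⟨_, _, .seq e₁ (.seq (.const _ _ _ (by simp)) (.arith _ _ _ _ _ ?_)), by omega,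
      fun y => ?_, ?_⟩
    · simp only [RAM.State.setReg, RAM.Op.eval, Function.update_self]
      rw [Function.update_of_ne (by norm_num), v₁, add_zero]
      exact h.trans (by exact_mod_cast hMS)
    · simp only [RAM.State.setReg, RAM.Op.eval, Function.update_self]
      rw [Mem.set_reg]
      by_cases hy : y = x
      · subst hy; simp [v₁]
      · rw [Function.update_of_ne (Var.idx_injective.ne hy), if_neg hy,
          Function.update_of_ne (by have := y.idx_lt; omega), r₁ _ y.idx_lt, hτ.1]
    · simp [RAM.State.setReg, a₁, hτ.2]
  | store σ a i e h =>
    simp only [Stmt.size] at hS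
    obtain ⟨τ₁, τ₂, t₁, t₂, e₁, e₂, l, hr, v₁, v₂⟩ :=
      compile_test hM hσ i e (S := S + 1) (by omega) τ hτ
    refine ⟨_, _, .seq e₁ (.seq e₂ (.store _ _ _ _)), by omega, fun y => ?_, ?_⟩
    · simp [RAM.State.setArr, hr.1]
    · simp [RAM.State.setArr, Mem.setArr, hr.2, v₁, v₂]
  | seq h₁ h₂ ih₁ ih₂ =>
    simp only [Stmt.size] at hS
    obtain ⟨τ₁, t₁, e₁, l₁, r₁⟩ := ih₁ (by omega) hσ τ hτ
    obtain ⟨τ₂, t₂, e₂, l₂, r₂⟩ := ih₂ (by omega) (h₁.bdd hσ) τ₁ r₁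
    exact ⟨τ₂, _, .seq e₁ e₂, by nlinarith, r₂⟩
  | @ite_true a b _ _ _ _ _ hc h ih =>
    simp only [Stmt.size] at hS
    obtain ⟨τ₁, τ₂, t₁, t₂, e₁, e₂, l, hr, v₁, v₂⟩ :=
      compile_test hM hσ a b (S := S + 1) (by omega) τ hτ
    obtain ⟨τ₃, t₃, e₃, l₃, r₃⟩ := ih (by omega) hσ τ₂ hr
    exact ⟨τ₃, _, .seq e₁ (.seq e₂ (.ite_true (by rwa [v₁, v₂]) e₃)), by nlinarith, r₃⟩
  | @ite_false a b _ _ _ _ _ hc h ih =>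
    simp only [Stmt.size] at hS
    obtain ⟨τ₁, τ₂, t₁, t₂, e₁, e₂, l, hr, v₁, v₂⟩ :=
      compile_test hM hσ a b (S := S + 1) (by omega) τ hτ
    obtain ⟨τ₃, t₃, e₃, l₃, r₃⟩ := ih (by omega) hσ τ₂ hr
    exact ⟨τ₃, _, .seq e₁ (.seq e₂ (.ite_false (by rwa [v₁, v₂]) e₃)), by nlinarith, r₃⟩
  | @loop_done a b _ _ hc =>
    simp only [Stmt.size] at hS
    obtain ⟨τ₁, τ₂, t₁, t₂, e₁, e₂, l, hr, v₁, v₂⟩ :=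
      compile_test hM hσ a b (S := S + 1) (by omega) τ hτ
    exact ⟨τ₂, _, .seq e₁ (.seq e₂ (.loop_done (by rwa [v₁, v₂]))), by omega, hr⟩
  | @loop_step a b _ _ _ _ _ _ hc h₁ h₂ ih₁ ih₂ =>
    have hS' := hS
    simp only [Stmt.size] at hS
    obtain ⟨τ₁, τ₂, t₁, t₂, e₁, e₂, l, hr, v₁, v₂⟩ :=
      compile_test hM hσ a b (S := S + 1) (by omega) τ hτ
    obtain ⟨τ₃, t₃, e₃, l₃, r₃⟩ := ih₁ (by omega) hσ τ₂ hr
    obtain ⟨τ₄, t₄, e₄, l₄, r₄⟩ := ih₂ hS' (h₁.bdd hσ) τ₃ r₃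
    -- The compiled loop evaluates its test once in front and then again at the end of each round.
    -- The run for the remaining iterations starts with evaluating the test; this piece is moved to
    -- the end of the present round.
    cases e₄ with
    | seq f₁ f =>
      cases f with
      | seq f₂ f₃ =>
        refine ⟨τ₄, _, .seq e₁ (.seq e₂ (.loop_step (by rwa [v₁, v₂])
          (.seq e₃ (.seq f₁ f₂)) f₃)), by nlinarith, r₄⟩

/-- Started in `σ`, the statement halts after at most `T` steps in a memory that satisfies `Q`. -/
def Runs (M : ℕ) (p : Stmt) (σ : Mem) (T : ℕ) (Q : Mem → Prop) : Prop :=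
  ∃ (σ' : Mem) (t : ℕ), Exec M p σ σ' t ∧ t ≤ T ∧ Q σ'

namespace Runs

variable {M : ℕ} {p p' : Stmt} {σ : Mem} {T T' : ℕ} {Q Q' : Mem → Prop}

theorem mono (h : Runs M p σ T Q) (hT : T ≤ T') (hQ : ∀ σ', Q σ' → Q' σ') : Runs M p σ T' Q' := by
  obtain ⟨σ', t, e, ht, q⟩ := h
  exact ⟨σ', t, e, ht.trans hT, hQ _ q⟩

theorem assign {x : Var} {e : Expr} (h : |e.eval σ| ≤ M) (hQ : Q (σ.set x (e.eval σ))) :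
    Runs M (.assign x e) σ 1 Q := ⟨_, _, .assign _ _ _ h, le_rfl, hQ⟩

theorem store {a : ℕ} {i e : Expr} (h : |e.eval σ| ≤ M)
    (hQ : Q (σ.setArr a (i.eval σ) (e.eval σ))) : Runs M (.store a i e) σ 1 Q :=
  ⟨_, _, .store _ _ _ _ h, le_rfl, hQ⟩

theorem seq (h : Runs M p σ T fun σ' => Runs M p' σ' T' Q) : Runs M (.seq p p') σ (T + T') Q := by
  obtain ⟨σ₁, t₁, e₁, h₁, σ₂, t₂, e₂, h₂, q⟩ := h
  exact ⟨σ₂, _, .seq e₁ e₂, by omega, q⟩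

/-- A loop with a counter `i` that bounds the number of iterations by `n`. -/
theorem loop {a b : Expr} (n : ℕ) (I : ℕ → Mem → Prop)
    (hbody : ∀ i σ, I i σ → a.eval σ < b.eval σ → i < n ∧ Runs M p σ T (I (i + 1)))
    (i : ℕ) (hi : i ≤ n) (h : I i σ) :
    Runs M (.loop a b p) σ ((n - i) * (T + 1) + 1)
      fun σ' => ∃ j ≤ n, I j σ' ∧ ¬ a.eval σ' < b.eval σ' := by
  obtain ⟨k, hk⟩ : ∃ k, k = n - i := ⟨_, rfl⟩
  induction k generalizing i σ with
  | zero =>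
    have hc : ¬ a.eval σ < b.eval σ := fun hc => by have := (hbody i σ h hc).1; omega
    exact ⟨σ, 1, .loop_done hc, by omega, i, hi, h, hc⟩
  | succ k ih =>
    by_cases hc : a.eval σ < b.eval σ
    · obtain ⟨_, σ₁, t₁, e₁, l₁, h₁⟩ := hbody i σ h hc
      obtain ⟨σ₂, t₂, e₂, l₂, h₂⟩ := ih (i + 1) (by omega) h₁ (by omega)
      refine ⟨σ₂, _, .loop_step hc e₁ e₂, ?_, h₂⟩
      have : n - i = (n - (i + 1)) + 1 := by omega
      rw [this, add_mul]; omega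
    · exact ⟨σ, 1, .loop_done hc, by omega, i, hi, h, hc⟩

end Runs

/-- `for x := 0 to n - 1 do p` -/
def Stmt.for (x : Var) (n : Expr) (p : Stmt) : Stmt :=
  .seq (.assign x 0) (.loop x n (.seq p (.assign x (x + 1))))

/-- Each round costs its body, the increment and the test; the initial assignment and the last,
failing test give the final `+ 2`. The invariant is required after the increment, so it can fix the
value of the counter. -/
theorem Runs.for {M : ℕ} {p : Stmt} {σ : Mem} {T : ℕ} {x : Var} {e : Expr} (n : ℕ)
    (I : ℕ → Mem → Prop) (hx : ∀ i σ, I i σ → σ.reg x = i) (hn : ∀ i σ, I i σ → e.eval σ = n)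
    (hM : n ≤ M) (h0 : I 0 (σ.set x 0))
    (hbody : ∀ i < n, ∀ σ, I i σ →
      Runs M p σ T fun σ' => σ'.reg x = i ∧ I (i + 1) (σ'.set x ((i + 1 : ℕ) : ℤ))) :
    Runs M (.for x e p) σ (n * (T + 2) + 2) (I n) := by
  have key := Runs.loop (M := M) (p := .seq p (.assign x (x + 1))) (T := T + 1) (a := x) (b := e)
    n (fun i σ => I i σ ∧ i ≤ n) ?_ 0 (Nat.zero_le _) ⟨h0, Nat.zero_le _⟩
  · have h1 : Runs M (.for x e p) σ (1 + ((n - 0) * (T + 1 + 1) + 1)) (I n) := by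
      refine Runs.seq (Runs.assign (by simp) ?_)
      refine key.mono le_rfl ?_
      rintro σ' ⟨j, hj, ⟨hI, -⟩, hc⟩
      simp only [Expr.eval_var, hx j _ hI, hn j _ hI] at hc
      obtain rfl : j = n := by omega
      exact hI
    exact h1.mono (by rw [Nat.sub_zero, show T + 1 + 1 = T + 2 from rfl]; omega) fun _ h => h
  · rintro i σ ⟨hI, -⟩ hc
    simp only [Expr.eval_var, hx i _ hI, hn i _ hI] at hc
    have hi : i < n := by omega
    refine ⟨hi, Runs.seq ((hbody i hi σ hI).mono le_rfl ?_)⟩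
    rintro σ' ⟨h1, h2⟩
    have hv : (x + 1 : Expr).eval σ' = ((i + 1 : ℕ) : ℤ) := by simp [h1]
    refine Runs.assign ?_ ?_
    · rw [hv, Nat.abs_cast]; exact_mod_cast (by omega : i + 1 ≤ M)
    · rw [hv]; exact ⟨h2, hi⟩

end Imp

/-! ## Running a machine program inside of the arrays

The registers of the simulated machine are kept in array `4`, its arrays `a` in the arrays `5 + a`.
Cell `k` is kept at address `k * rounds + rnd`, so that different values of `rnd` give disjoint
memories. -/

namespace Imp

/-- The address of a cell of the simulated machine. -/
def Expr.addr (e : Expr) : Expr := e * Var.rounds + Var.rnd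

/-- A register of the simulated machine. -/
def Expr.simReg (x : ℕ) : Expr := .load 4 (Expr.const x).addr

/-- Write a register of the simulated machine. -/
def Stmt.simSetReg (x : ℕ) (e : Expr) : Stmt := .store 4 (Expr.const x).addr e

/-- Write a cell of an array of the simulated machine. -/
def Stmt.simSetArr (a : ℕ) (i e : Expr) : Stmt := .store (5 + a) i.addr e

/-- The simulation of a machine program. -/
def simulate : RAM.Prog → Stmt
  | .skip => .skip
  | .const x k => .simSetReg x (.const k)
  | .arith o x y z => .simSetReg x (.op o (.simReg y) (.simReg z))
  | .load x a y => .simSetReg x (.load (5 + a) (Expr.simReg y).addr)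
  | .store a y x => .simSetArr a (.simReg y) (.simReg x)
  | .seq p q => .seq (simulate p) (simulate q)
  | .ite x y p q => .ite (.simReg x) (.simReg y) (simulate p) (simulate q)
  | .loop x y p => .loop (.simReg x) (.simReg y) (simulate p)

/-- The state of the simulated machine. -/
def Mem.view (σ : Mem) : RAM.State where
  reg x := σ.arr 4 (x * σ.reg .rounds + σ.reg .rnd)
  arr a k := σ.arr (5 + a) (k * σ.reg .rounds + σ.reg .rnd)

/-- The memory `σ'` differs from `σ` only in the simulated machine. -/
structure SimFrame (σ σ' : Mem) : Prop where
  reg : σ'.reg = σ.reg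
  arr : ∀ a < 4, σ'.arr a = σ.arr a
  cell : ∀ (a : ℕ) (k : ℤ), k % σ.reg .rounds ≠ σ.reg .rnd → σ'.arr a k = σ.arr a k

theorem SimFrame.refl (σ : Mem) : SimFrame σ σ := ⟨rfl, fun _ _ => rfl, fun _ _ _ => rfl⟩

theorem SimFrame.trans {σ σ' σ'' : Mem} (h : SimFrame σ σ') (h' : SimFrame σ' σ'') :
    SimFrame σ σ'' :=
  ⟨h'.reg.trans h.reg, fun a ha => (h'.arr a ha).trans (h.arr a ha), fun a k hk =>
    (h'.cell a k (by rwa [h.reg])).trans (h.cell a k hk)⟩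

/-- The current memory of the simulated machine exists. -/
def Mem.SimOK (σ : Mem) : Prop := 0 ≤ σ.reg .rnd ∧ σ.reg .rnd < σ.reg .rounds

theorem SimFrame.simOK {σ σ' : Mem} (h : SimFrame σ σ') (hσ : σ.SimOK) : σ'.SimOK := by
  unfold Mem.SimOK; rw [h.reg]; exact hσ

theorem Mem.SimOK.addr_inj {σ : Mem} (h : σ.SimOK) {k l : ℤ} :
    k * σ.reg .rounds + σ.reg .rnd = l * σ.reg .rounds + σ.reg .rnd ↔ k = l := by
  have : σ.reg .rounds ≠ 0 := by have := h.1; have := h.2; omega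
  simp [this]

/-- The simulated addresses are exactly those congruent to `rnd` modulo `rounds`, so the memories of
the other rounds lie in other residue classes. -/
theorem Mem.SimOK.frame {σ : Mem} (h : σ.SimOK) (a : ℕ) (ha : 4 ≤ a) (k v : ℤ) :
    SimFrame σ (σ.setArr a (k * σ.reg .rounds + σ.reg .rnd) v) := by
  refine ⟨rfl, fun b hb => ?_, fun b l hl => ?_⟩
  · ext l; rw [Mem.setArr_arr, if_neg (by omega)]
  · rw [Mem.setArr_arr, if_neg]
    rintro ⟨-, rfl⟩
    apply hl
    rw [add_comm, Int.add_mul_emod_self_right, Int.emod_eq_of_lt h.1 h.2]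

theorem Mem.SimOK.view_setReg {σ : Mem} (h : σ.SimOK) (x : ℕ) (v : ℤ) :
    (σ.setArr 4 (x * σ.reg .rounds + σ.reg .rnd) v).view = σ.view.setReg x v := by
  simp only [Mem.view, RAM.State.setReg, Mem.setArr_arr, Mem.setArr_reg, RAM.State.mk.injEq]
  constructor
  · ext y; simp [Function.update_apply, h.addr_inj]
  · ext b k; rw [if_neg (by omega)]

theorem Mem.SimOK.view_setArr {σ : Mem} (h : σ.SimOK) (a : ℕ) (i v : ℤ) :
    (σ.setArr (5 + a) (i * σ.reg .rounds + σ.reg .rnd) v).view = σ.view.setArr a i v := by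
  simp only [Mem.view, RAM.State.setArr, Mem.setArr_arr, Mem.setArr_reg, RAM.State.mk.injEq]
  constructor
  · ext y; rw [if_neg (by omega)]
  · ext b k
    by_cases hb : b = a
    · subst hb; simp [Function.update_apply, h.addr_inj]
    · simp [hb]

theorem Runs.simSetReg {M : ℕ} {σ : Mem} (h : σ.SimOK) (x : ℕ) {e : Expr} {Q : Mem → Prop}
    (he : |e.eval σ| ≤ M)
    (hQ : ∀ σ', SimFrame σ σ' → σ'.view = σ.view.setReg x (e.eval σ) → Q σ') :
    Runs M (.simSetReg x e) σ 1 Q :=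
  Runs.store he (hQ _ (h.frame 4 le_rfl _ _) (h.view_setReg x _))

theorem Runs.simSetArr {M : ℕ} {σ : Mem} (h : σ.SimOK) (a : ℕ) {i e : Expr} {Q : Mem → Prop}
    (he : |e.eval σ| ≤ M)
    (hQ : ∀ σ', SimFrame σ σ' → σ'.view = σ.view.setArr a (i.eval σ) (e.eval σ) → Q σ') :
    Runs M (.simSetArr a i e) σ 1 Q :=
  Runs.store he (hQ _ (h.frame (5 + a) (by omega) _ _) (h.view_setArr a _ _))

@[simp] theorem Expr.eval_simReg (σ : Mem) (x : ℕ) : (Expr.simReg x).eval σ = σ.view.reg x := rfl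

@[simp] theorem Expr.eval_addr (σ : Mem) (e : Expr) :
    e.addr.eval σ = e.eval σ * σ.reg .rounds + σ.reg .rnd := rfl

/-- Each machine instruction becomes one statement with a nested expression, so the number of steps
does not change. Computed numbers are bounded by `B`; numbers that are loaded or stored are already
in memory and are bounded by `M`. -/
theorem simulate_exec {B M : ℕ} (hBM : B ≤ M) {p : RAM.Prog} {ν ν' : RAM.State} {t : ℕ}
    (h : RAM.Exec B p ν ν' t) (σ : Mem) (hσ : σ.Bdd M) (hs : σ.SimOK) (hν : σ.view = ν) :
    ∃ σ', Exec M (simulate p) σ σ' t ∧ SimFrame σ σ' ∧ σ'.view = ν' := by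
  have hBM' : (B : ℤ) ≤ M := by exact_mod_cast hBM
  induction h generalizing σ with
  | skip => exact ⟨_, .skip _, .refl _, hν⟩
  | const ν x k hB =>
    subst hν
    exact ⟨_, .store _ _ _ _ (hB.trans hBM'), hs.frame 4 le_rfl _ _, hs.view_setReg x _⟩
  | arith ν o x y z hB =>
    subst hν
    exact ⟨_, .store _ _ _ _ (hB.trans hBM'), hs.frame 4 le_rfl _ _, hs.view_setReg x _⟩
  | load ν x a y =>
    subst hν
    exact ⟨_, .store _ _ _ _ (hσ.2 _ _), hs.frame 4 le_rfl _ _, hs.view_setReg x _⟩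
  | store ν a y x =>
    subst hν
    exact ⟨_, .store _ _ _ _ (hσ.2 _ _), hs.frame (5 + a) (by omega) _ _, hs.view_setArr a _ _⟩
  | seq _ _ ih₁ ih₂ =>
    obtain ⟨σ₁, e₁, f₁, v₁⟩ := ih₁ σ hσ hs hν
    obtain ⟨σ₂, e₂, f₂, v₂⟩ := ih₂ σ₁ (e₁.bdd hσ) (f₁.simOK hs) v₁
    exact ⟨σ₂, .seq e₁ e₂, f₁.trans f₂, v₂⟩
  | ite_true hc _ ih =>
    obtain ⟨σ₁, e₁, f₁, v₁⟩ := ih σ hσ hs hν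
    subst hν
    exact ⟨σ₁, .ite_true hc e₁, f₁, v₁⟩
  | ite_false hc _ ih =>
    obtain ⟨σ₁, e₁, f₁, v₁⟩ := ih σ hσ hs hν
    subst hν
    exact ⟨σ₁, .ite_false hc e₁, f₁, v₁⟩
  | loop_done hc =>
    subst hν
    exact ⟨_, .loop_done hc, .refl _, rfl⟩
  | loop_step hc _ _ ih₁ ih₂ =>
    obtain ⟨σ₁, e₁, f₁, v₁⟩ := ih₁ σ hσ hs hν
    obtain ⟨σ₂, e₂, f₂, v₂⟩ := ih₂ σ₁ (e₁.bdd hσ) (f₁.simOK hs) v₁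
    subst hν
    exact ⟨σ₂, .loop_step hc e₁ e₂, f₁.trans f₂, v₂⟩

end Imp

/-! ## Grammars for min-plus products -/

namespace LanEd

/-- `Sat Φ γ z`: the string `z` is obtained from `γ` by replacing every nonterminal `A` by a string
that satisfies `Φ A`. -/
def Sat {T N : Type} (Φ : N → List T → Prop) : List (Symbol T N) → List T → Prop
  | [], z => z = []
  | .terminal a :: γ, z => ∃ z', z = a :: z' ∧ Sat Φ γ z'
  | .nonterminal A :: γ, z => ∃ z₁ z₂, z = z₁ ++ z₂ ∧ Φ A z₁ ∧ Sat Φ γ z₂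

theorem Sat.append_iff {T N : Type} {Φ : N → List T → Prop} (γ γ' : List (Symbol T N))
    (z : List T) : Sat Φ (γ ++ γ') z ↔ ∃ z₁ z₂, z = z₁ ++ z₂ ∧ Sat Φ γ z₁ ∧ Sat Φ γ' z₂ := by
  induction γ generalizing z with
  | nil => simp [Sat]
  | cons s γ ih =>
    cases s with
    | terminal a =>
      simp only [List.cons_append, Sat, ih]
      constructor
      · rintro ⟨z', rfl, z₁, z₂, rfl, h₁, h₂⟩
        exact ⟨a :: z₁, z₂, rfl, ⟨z₁, rfl, h₁⟩, h₂⟩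
      · rintro ⟨_, z₂, rfl, ⟨z₁, rfl, h₁⟩, h₂⟩
        exact ⟨z₁ ++ z₂, rfl, z₁, z₂, rfl, h₁, h₂⟩
    | nonterminal A =>
      simp only [List.cons_append, Sat, ih]
      constructor
      · rintro ⟨y, _, rfl, hA, z₁, z₂, rfl, h₁, h₂⟩
        exact ⟨y ++ z₁, z₂, by simp, ⟨y, z₁, rfl, hA, h₁⟩, h₂⟩
      · rintro ⟨_, z₂, rfl, ⟨y, z₁, rfl, hA, h₁⟩, h₂⟩
        exact ⟨y, z₁ ++ z₂, by simp, hA, z₁, z₂, rfl, h₁, h₂⟩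

theorem Sat.singleton_iff {T N : Type} {Φ : N → List T → Prop} (A : N) (z : List T) :
    Sat Φ [.nonterminal A] z ↔ Φ A z := by simp [Sat]

theorem Sat.map {T N T' N' : Type} {Φ : N → List T → Prop} {Φ' : N' → List T' → Prop}
    (f : T → T') (g : N → N') (h : ∀ A z, Φ A z → Φ' (g A) (z.map f))
    (γ : List (Symbol T N)) (z : List T) (hz : Sat Φ γ z) :
    Sat Φ' (γ.map fun | .terminal a => .terminal (f a) | .nonterminal A => .nonterminal (g A))
      (z.map f) := by
  induction γ generalizing z with
  | nil => simp_all [Sat]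
  | cons s γ ih =>
    cases s with
    | terminal a =>
      obtain ⟨z', rfl, hz⟩ := hz
      exact ⟨z'.map f, by simp, ih _ hz⟩
    | nonterminal A =>
      obtain ⟨y, z', rfl, hA, hz⟩ := hz
      exact ⟨y.map f, z'.map f, by simp, h _ _ hA, ih _ hz⟩

namespace Grammar

variable {G : Grammar}

theorem sat_ofTerminals (Φ : Fin G.nt → List (Fin G.tm) → Prop) (z : List (Fin G.tm)) :
    Sat Φ (G.ofTerminals z) z := by
  induction z with
  | nil => rfl
  | cons a z ih => exact ⟨z, rfl, ih⟩

theorem produces_iff {α β : G.Form} : G.toCFG.Produces α β ↔ ∃ r ∈ G.rules, ∃ p s : G.Form,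
    α = p ++ [.nonterminal r.input] ++ s ∧ β = p ++ r.output ++ s := by
  constructor
  · rintro ⟨r, hr, hw⟩
    obtain ⟨p, s, h₁, h₂⟩ := hw.exists_parts
    exact ⟨r, List.mem_toFinset.1 hr, p, s, h₁, h₂⟩
  · rintro ⟨r, hr, p, s, rfl, rfl⟩
    exact ⟨r, (List.mem_toFinset (l := G.rules)).2 hr, r.rewrites_of_exists_parts p s⟩

/-- A property of derived strings that is preserved by all productions. -/
theorem Derives.sound {Φ : Fin G.nt → List (Fin G.tm) → Prop}
    (h : ∀ r ∈ G.rules, ∀ z, Sat Φ r.output z → Φ r.input z) {A : Fin G.nt}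
    {z : List (Fin G.tm)} (hz : G.Derives [.nonterminal A] (G.ofTerminals z)) : Φ A z := by
  have key : ∀ α β : G.Form, G.Derives α β → Sat Φ β z → Sat Φ α z := by
    intro α β hd
    induction hd using Relation.ReflTransGen.head_induction_on with
    | refl => exact id
    | head hp _ ih =>
      intro hβ
      have hs := ih hβ
      obtain ⟨r, hr, p, s, rfl, rfl⟩ := produces_iff.1 hp
      rw [Sat.append_iff] at hs ⊢
      obtain ⟨z₁, z₂, rfl, h₁, h₂⟩ := hs
      refine ⟨z₁, z₂, rfl, ?_, h₂⟩
      rw [Sat.append_iff] at h₁ ⊢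
      obtain ⟨y₁, y₂, rfl, h₁, h₃⟩ := h₁
      exact ⟨y₁, y₂, rfl, h₁, (Sat.singleton_iff _ _).2 (h r hr _ h₃)⟩
  exact (Sat.singleton_iff _ _).1 (key _ _ hz (sat_ofTerminals Φ z))

theorem Derives.refl (α : G.Form) : G.Derives α α := ContextFreeGrammar.Derives.refl _

theorem Derives.trans {α β γ : G.Form} (h : G.Derives α β) (h' : G.Derives β γ) :
    G.Derives α γ := ContextFreeGrammar.Derives.trans h h'

theorem Derives.append {α α' β β' : G.Form} (h : G.Derives α α') (h' : G.Derives β β') :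
    G.Derives (α ++ β) (α' ++ β') :=
  (ContextFreeGrammar.Derives.append_right h β).trans
    (ContextFreeGrammar.Derives.append_left h' α')

theorem Derives.of_rule {r : ContextFreeRule (Fin G.tm) (Fin G.nt)} (hr : r ∈ G.rules) :
    G.Derives [.nonterminal r.input] r.output :=
  ContextFreeGrammar.Produces.single (produces_iff.2 ⟨r, hr, [], [], rfl, by simp⟩)

theorem ofTerminals_append (z₁ z₂ : List (Fin G.tm)) :
    G.ofTerminals (z₁ ++ z₂) = G.ofTerminals z₁ ++ G.ofTerminals z₂ := List.map_append

/-- If all nonterminals derive terminal strings, then so does every sentential form. -/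
theorem exists_derives (h : ∀ A : Fin G.nt, ∃ z, G.Derives [.nonterminal A] (G.ofTerminals z))
    (γ : G.Form) : ∃ z, G.Derives γ (G.ofTerminals z) := by
  induction γ with
  | nil => exact ⟨[], .refl _⟩
  | cons s γ ih =>
    obtain ⟨z, hz⟩ := ih
    cases s with
    | terminal a => exact ⟨a :: z, Derives.append (.refl [.terminal a]) hz⟩
    | nonterminal A =>
      obtain ⟨y, hy⟩ := h A
      exact ⟨y ++ z, by rw [ofTerminals_append]; exact Derives.append hy hz⟩

end Grammar

theorem Insertions.sublist {α : Type} {l : ℕ} {v z : List α} (h : Insertions l v z) :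
    v.Sublist z := by
  induction h with
  | refl => exact .refl _
  | insert x y a _ ih => exact ih.trans (List.Sublist.append_left (List.sublist_cons_self a y) x)

theorem Insertions.length {α : Type} {l : ℕ} {v z : List α} (h : Insertions l v z) :
    z.length = v.length + l := by
  induction h with
  | refl => rfl
  | insert x y a _ ih => simp only [List.length_append, List.length_cons] at ih ⊢; omega

theorem Insertions.cons {α : Type} {l : ℕ} {v z : List α} (a : α) (h : Insertions l v z) :
    Insertions l (a :: v) (a :: z) := by
  induction h with
  | refl => exact .refl _
  | insert x y b _ ih => exact Insertions.insert (a :: x) y b ih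

/-- Together with `Insertions.sublist` and `Insertions.length` this reduces insertions to sublists,
with the number of insertions equal to the difference of the lengths. -/
theorem Insertions.of_sublist {α : Type} {v z : List α} (h : v.Sublist z) :
    Insertions (z.length - v.length) v z := by
  induction h with
  | slnil => exact .refl _
  | cons a h ih =>
    have := h.length_le
    rw [List.length_cons, Nat.succ_sub this]
    exact Insertions.insert [] _ a ih
  | cons_cons a h ih => simpa using ih.cons a

end LanEd

/-! ### The grammar of a min-plus square -/

namespace LanEd

/-- The nonterminals of the grammar for a min-plus product. -/
inductive MPSymbol
  | start
  | mid
  | letter (p : ℕ)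
  | power (t : ℕ)
  | prod (c : ℕ)
  | factor (a : ℕ)
  | chain (h : ℕ)

/-- The data of a min-plus square: a matrix of size `side ^ 3` with entries less than `2 ^ len`. -/
structure MinPlus where
  side : ℕ
  len : ℕ
  val : ℕ → ℕ → ℕ
  side_pos : 0 < side
  val_lt : ∀ i j, val i j < 2 ^ len

namespace MinPlus

open MPSymbol

variable (P : MinPlus)

/-- The number of rows. -/
def dim : ℕ := P.side * P.side * P.side
/-- The number of letters, and the code of the symbol that is not a letter. -/
def letters : ℕ := 3 * P.side + 3
/-- The square of the side. -/
def side2 : ℕ := P.side * P.side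
/-- The number of the nonterminals for the entries of the product. -/
def prods : ℕ := P.side2 * P.side2
/-- The number of entries. -/
def dim2 : ℕ := P.dim * P.dim
/-- The number of entries of the two factors. -/
def entries : ℕ := 2 * P.dim2

/-- The factor to which an entry belongs. -/
def fac (e : ℕ) : ℕ := e / P.dim2
/-- The row of an entry. -/
def row (e : ℕ) : ℕ := e % P.dim2 / P.dim
/-- The column of an entry. -/
def col (e : ℕ) : ℕ := e % P.dim2 % P.dim
/-- The value of an entry. -/
def value (e : ℕ) : ℕ := P.val (P.row e) (P.col e)
/-- The first letter in the strings for an entry. -/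
def first (e : ℕ) : ℕ := P.fac e * (P.side + 2) + P.row e % P.side
/-- The last letter in the strings for an entry. -/
def last (e : ℕ) : ℕ := P.fac e * (P.side + 2) + (P.side + 1) + P.col e % P.side
/-- The factor nonterminal of an entry. -/
def block (e : ℕ) : ℕ := P.fac e * P.prods + P.row e / P.side * P.side2 + P.col e / P.side

/-- The nonterminals that occur. -/
def Valid : MPSymbol → Prop
  | .start => True
  | .mid => True
  | letter p => p < P.letters
  | power t => t < P.len + 3
  | prod c => c < P.prods
  | factor a => a < 2 * P.prods
  | chain h => h < P.entries * (P.len + 1)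

/-- The numbers of the nonterminals. -/
def code : MPSymbol → ℕ
  | .start => 0
  | .mid => 1
  | letter p => 2 + p
  | power t => 2 + P.letters + t
  | prod c => 2 + P.letters + (P.len + 3) + c
  | factor a => 2 + P.letters + (P.len + 3) + P.prods + a
  | chain h => 2 + P.letters + (P.len + 3) + 3 * P.prods + h

/-- The number of nonterminals. -/
def nonterminals : ℕ :=
  2 + P.letters + (P.len + 3) + 3 * P.prods + P.entries * (P.len + 1)

/-- The nonterminal with a given number. -/
def decode (k : ℕ) : MPSymbol :=
  if k = 0 then .start
  else if k = 1 then .mid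
  else if k < 2 + P.letters then letter (k - 2)
  else if k < 2 + P.letters + (P.len + 3) then power (k - (2 + P.letters))
  else if k < 2 + P.letters + (P.len + 3) + P.prods then
    prod (k - (2 + P.letters + (P.len + 3)))
  else if k < 2 + P.letters + (P.len + 3) + 3 * P.prods then
    factor (k - (2 + P.letters + (P.len + 3) + P.prods))
  else chain (k - (2 + P.letters + (P.len + 3) + 3 * P.prods))

theorem nonterminals_pos : 0 < P.nonterminals := by unfold nonterminals; omega

variable {P}

theorem code_lt {v : MPSymbol} (h : P.Valid v) : P.code v < P.nonterminals := by
  unfold nonterminals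
  cases v <;> simp only [Valid, code] at * <;> omega

theorem decode_code {v : MPSymbol} (h : P.Valid v) : P.decode (P.code v) = v := by
  obtain ⟨k, hk⟩ : ∃ k, k = P.code v := ⟨_, rfl⟩
  rw [← hk]
  unfold decode
  cases v <;> simp only [Valid, code] at h hk <;> split_ifs <;>
    first
    | rfl
    | (exfalso; omega)
    | (simp only [letter.injEq, power.injEq, prod.injEq, factor.injEq, chain.injEq]; omega)

theorem valid_decode {k : ℕ} (h : k < P.nonterminals) : P.Valid (P.decode k) := by
  unfold nonterminals at h
  unfold decode
  split_ifs <;> simp only [Valid] <;> omega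

theorem code_decode (k : ℕ) : P.code (P.decode k) = k := by
  unfold decode
  split_ifs <;> simp only [code] <;> omega

variable (P)

/-- Right-hand sides of productions. -/
abbrev RHS := List (Symbol ℕ MPSymbol)

/-- The productions, in families: the number of productions of the family, and the `x`-th one. -/
def families : List (ℕ × (ℕ → MPSymbol × RHS)) :=
  [(1, fun _ => (.start, [])),
   (1, fun _ => (.mid, [.nonterminal .mid, .nonterminal .mid])),
   (1, fun _ => (power 0, [.terminal P.letters])),
   (P.letters, fun p => (letter p, [.terminal p])),
   (P.letters, fun p => (.start, [.nonterminal (letter p), .nonterminal .start])),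
   (P.letters, fun p => (.mid, [.nonterminal (letter p), .nonterminal (power (P.len + 2))])),
   (P.len + 2, fun t => (power (t + 1), [.nonterminal (power t), .nonterminal (power t)])),
   (P.prods, fun c => (.start, [.nonterminal (prod c), .nonterminal .start])),
   -- The remainder of `x` encodes the quotients of row and column, and `x / prods` is the quotient
   -- of the inner index, shared by both factors.
   (P.prods * P.side2, fun x => (prod (x % P.prods),
      [.nonterminal (factor (x % P.prods / P.side2 * P.side2 + x / P.prods)),
       .nonterminal (factor (P.prods + x / P.prods * P.side2 + x % P.prods % P.side2))])),
   (P.entries, fun e => (factor (P.block e),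
      [.nonterminal (chain (P.entries * P.len + e)), .nonterminal (letter (P.last e))])),
   (P.entries, fun e => (chain e, [.nonterminal (letter (P.first e)), .nonterminal .mid])),
   -- Here `h = entries * t + e` is level `t` of entry `e`, and the step to level `t + 1` appends `2
   -- ^ t` or `2 ^ (t + 1)` marks, according to bit `t` of the value. A zero bit has to produce
   -- marks as well, because in Chomsky normal form `power` cannot derive the empty string.
   (P.entries * P.len, fun h => (chain (h + P.entries), [.nonterminal (chain h), .nonterminal
      (power (h / P.entries + P.value (h % P.entries) / 2 ^ (h / P.entries) % 2))]))]

/-- The list of the productions. -/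
def productions : List (MPSymbol × RHS) :=
  P.families.flatMap fun f => (List.range f.1).map f.2

/-- Different families differ in the constructors that occur, and within a family the index can be
read off from the production. -/
theorem productions_nodup : P.productions.Nodup := by
  unfold productions
  rw [List.nodup_flatMap]
  constructor
  · simp only [families, List.forall_mem_cons]
    have key : ∀ (k : ℕ) (f : ℕ → MPSymbol × RHS), (∀ x y, f x = f y → x = y) →
        ((List.range k).map f).Nodup := fun k f hf => List.nodup_range.map (fun x y => hf x y)
    refine ⟨by simp, by simp, by simp, key _ _ ?_, key _ _ ?_, key _ _ ?_, key _ _ ?_, key _ _ ?_,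
      key _ _ ?_, key _ _ ?_, key _ _ ?_, key _ _ ?_, by simp⟩ <;>
      intro x y h <;>
      simp only [Prod.mk.injEq, letter.injEq, power.injEq, prod.injEq, factor.injEq, chain.injEq,
        List.cons.injEq, Symbol.nonterminal.injEq, Symbol.terminal.injEq, and_true, true_and] at h
    all_goals try omega
    -- Only the family for `prod` remains: the left-hand side determines `x % prods`, and then the
    -- first factor determines `x / prods`.
    obtain ⟨h₁, h₂, -⟩ := h
    rw [h₁] at h₂
    rw [← Nat.div_add_mod x P.prods, ← Nat.div_add_mod y P.prods, h₁, Nat.add_left_cancel h₂]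
  · have key : ∀ (k l : ℕ) (f g : ℕ → MPSymbol × RHS), (∀ x y, f x ≠ g y) →
        List.Disjoint ((List.range k).map f) ((List.range l).map g) := by
      intro k l f g h r h₁ h₂
      obtain ⟨x, -, rfl⟩ := List.mem_map.1 h₁
      obtain ⟨y, -, hy⟩ := List.mem_map.1 h₂
      exact h x y hy.symm
    have key' : P.families.Pairwise fun f g => ∀ x y, f.2 x ≠ g.2 y := by
      simp [families]
    exact key'.imp fun h => key _ _ _ _ h

theorem mem_productions {r : MPSymbol × RHS} : r ∈ P.productions ↔
    ∃ f ∈ P.families, ∃ x < f.1, f.2 x = r := by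
  simp [productions]

end MinPlus
end LanEd

/-! ### Well-formedness, and necessary conditions on derived strings -/

namespace LanEd

namespace MinPlus

open MPSymbol

variable (P : MinPlus)

theorem side2_pos : 0 < P.side2 := Nat.mul_pos P.side_pos P.side_pos

theorem dim_pos : 0 < P.dim := Nat.mul_pos P.side2_pos P.side_pos

theorem dim2_pos : 0 < P.dim2 := Nat.mul_pos P.dim_pos P.dim_pos

theorem prods_pos : 0 < P.prods := Nat.mul_pos P.side2_pos P.side2_pos

theorem entries_pos : 0 < P.entries := Nat.mul_pos two_pos P.dim2_pos

theorem pair_lt {a b c d : ℕ} (h : a < b) (h' : c < d) : a * d + c < b * d := by nlinarith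

variable {P} {e : ℕ}

theorem fac_lt (h : e < P.entries) : P.fac e < 2 := Nat.div_lt_of_lt_mul (by rwa [mul_comm])

theorem row_lt (e : ℕ) : P.row e < P.dim := Nat.div_lt_of_lt_mul (Nat.mod_lt _ P.dim2_pos)

theorem col_lt (e : ℕ) : P.col e < P.dim := Nat.mod_lt _ P.dim_pos

theorem div_side_lt {i : ℕ} (h : i < P.dim) : i / P.side < P.side2 :=
  Nat.div_lt_of_lt_mul (by rwa [mul_comm])

theorem prod_lt {i j : ℕ} (hi : i < P.dim) (hj : j < P.dim) :
    i / P.side * P.side2 + j / P.side < P.prods := pair_lt (div_side_lt hi) (div_side_lt hj)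

theorem block_lt (h : e < P.entries) : P.block e < 2 * P.prods := by
  have := prod_lt (row_lt (P := P) e) (col_lt (P := P) e)
  have := fac_lt h
  have := pair_lt this (prod_lt (row_lt (P := P) e) (col_lt (P := P) e))
  unfold block; omega

theorem first_lt (h : e < P.entries) : P.first e < P.letters := by
  have h1 := fac_lt h
  have h2 := Nat.mod_lt (P.row e) P.side_pos
  unfold first letters
  interval_cases P.fac e <;> omega

theorem last_lt (h : e < P.entries) : P.last e < P.letters := by
  have h1 := fac_lt h
  have h2 := Nat.mod_lt (P.col e) P.side_pos
  unfold last letters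
  interval_cases P.fac e <;> omega

/-- The entry with a given factor, row and column. -/
theorem exists_entry {f i j : ℕ} (hf : f < 2) (hi : i < P.dim) (hj : j < P.dim) :
    ∃ e < P.entries, P.fac e = f ∧ P.row e = i ∧ P.col e = j := by
  have h : i * P.dim + j < P.dim2 := pair_lt hi hj
  refine ⟨f * P.dim2 + (i * P.dim + j), pair_lt hf h, ?_, ?_, ?_⟩
  · rw [fac, mul_comm, Nat.mul_add_div P.dim2_pos, Nat.div_eq_of_lt h, add_zero]
  · rw [row, mul_comm, Nat.mul_add_mod, Nat.mod_eq_of_lt h, mul_comm, Nat.mul_add_div P.dim_pos,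
      Nat.div_eq_of_lt hj, add_zero]
  · rw [col, mul_comm, Nat.mul_add_mod, Nat.mod_eq_of_lt h, mul_comm, Nat.mul_add_mod,
      Nat.mod_eq_of_lt hj]

/-- The symbols that occur. -/
def ValidSymbol (P : MinPlus) : Symbol ℕ MPSymbol → Prop
  | .terminal a => a ≤ P.letters
  | .nonterminal v => P.Valid v

theorem productions_valid {r : MPSymbol × RHS} (hr : r ∈ P.productions) :
    P.Valid r.1 ∧ ∀ s ∈ r.2, P.ValidSymbol s := by
  obtain ⟨f, hf, x, hx, rfl⟩ := P.mem_productions.1 hr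
  simp only [families, List.mem_cons, List.not_mem_nil, or_false] at hf
  rcases hf with rfl | rfl | rfl | rfl | rfl | rfl | rfl | rfl | rfl | rfl | rfl | rfl <;>
    simp only [Valid, ValidSymbol, List.forall_mem_cons, List.not_mem_nil, false_imp_iff,
      implies_true, and_true, true_and] at hx ⊢
  -- The families that need bounds on indices are those for `prod`, `factor`, the lowest `chain`
  -- level and the higher `chain` levels, in this order.
  case inr.inr.inr.inr.inr.inr.inr.inr.inl =>
    have h1 : x % P.prods < P.prods := Nat.mod_lt _ P.prods_pos
    have h2 : x / P.prods < P.side2 := Nat.div_lt_of_lt_mul hx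
    have h3 : x % P.prods / P.side2 < P.side2 := Nat.div_lt_of_lt_mul h1
    have h4 : x % P.prods % P.side2 < P.side2 := Nat.mod_lt _ P.side2_pos
    have h5 : _ < P.prods := pair_lt h3 h2
    have h6 : _ < P.prods := pair_lt h2 h4
    omega
  case inr.inr.inr.inr.inr.inr.inr.inr.inr.inl =>
    have := block_lt hx
    have := last_lt hx
    rw [mul_add]; omega
  case inr.inr.inr.inr.inr.inr.inr.inr.inr.inr.inl =>
    have := first_lt hx
    rw [mul_add]; have := P.entries * P.len; omega
  case inr.inr.inr.inr.inr.inr.inr.inr.inr.inr.inr =>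
    have h1 : x / P.entries < P.len := Nat.div_lt_of_lt_mul hx
    rw [mul_add]; omega
  all_goals try omega

/-- A symbol with numbered nonterminals. -/
def symbolFin (P : MinPlus) :
    Symbol ℕ MPSymbol → Symbol (Fin (P.letters + 1)) (Fin P.nonterminals)
  | .terminal a => .terminal (Fin.ofNat _ a)
  | .nonterminal v => .nonterminal ⟨P.code v % _, Nat.mod_lt _ P.nonterminals_pos⟩

/-- The inverse of `symbolFin`. -/
def symbolNat (P : MinPlus) :
    Symbol (Fin (P.letters + 1)) (Fin P.nonterminals) → Symbol ℕ MPSymbol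
  | .terminal a => .terminal a
  | .nonterminal v => .nonterminal (P.decode v)

theorem symbolNat_symbolFin {s : Symbol ℕ MPSymbol} (h : P.ValidSymbol s) :
    P.symbolNat (P.symbolFin s) = s := by
  cases s with
  | terminal a =>
    simp only [symbolFin, symbolNat, Fin.val_ofNat]
    rw [Nat.mod_eq_of_lt (Nat.lt_succ_of_le h)]
  | nonterminal v =>
    simp only [symbolFin, symbolNat]
    rw [Nat.mod_eq_of_lt (code_lt h), decode_code h]

/-- A production with numbered nonterminals. -/
def toRule (P : MinPlus) (r : MPSymbol × RHS) :
    ContextFreeRule (Fin (P.letters + 1)) (Fin P.nonterminals) where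
  input := ⟨P.code r.1 % _, Nat.mod_lt _ P.nonterminals_pos⟩
  output := r.2.map P.symbolFin

/-- The inverse of `toRule`. -/
def ofRule (P : MinPlus) (r : ContextFreeRule (Fin (P.letters + 1)) (Fin P.nonterminals)) :
    MPSymbol × RHS := (P.decode r.input, r.output.map P.symbolNat)

theorem ofRule_toRule {r : MPSymbol × RHS} (hr : r ∈ P.productions) :
    P.ofRule (P.toRule r) = r := by
  obtain ⟨h₁, h₂⟩ := productions_valid hr
  unfold ofRule toRule
  ext1
  · simp only; rw [Nat.mod_eq_of_lt (code_lt h₁), decode_code h₁]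
  · simp only [List.map_map]
    conv_rhs => rw [← List.map_id r.2]
    exact List.map_congr_left fun s hs => symbolNat_symbolFin (h₂ s hs)

variable (P) in
/-- The grammar. -/
def grammar : Grammar where
  nt := P.nonterminals
  tm := P.letters + 1
  start := ⟨0, P.nonterminals_pos⟩
  rules := P.productions.map P.toRule
  nodup := by
    apply List.Nodup.of_map P.ofRule
    rw [List.map_map]
    have : P.productions.map (P.ofRule ∘ P.toRule) = P.productions := by
      conv_rhs => rw [← List.map_id P.productions]
      exact List.map_congr_left fun r hr => ofRule_toRule hr
    rw [this]
    exact P.productions_nodup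

variable (P) in
/-- A symbol as a symbol of the grammar. -/
def symbolG (s : Symbol ℕ MPSymbol) : Symbol (Fin P.grammar.tm) (Fin P.grammar.nt) :=
  P.symbolFin s

variable (P) in
/-- A symbol as a terminal of the grammar. -/
def letterG (a : ℕ) : Fin P.grammar.tm := Fin.ofNat (P.letters + 1) a

theorem letterG_val {a : ℕ} (h : a ≤ P.letters) : (P.letterG a : ℕ) = a :=
  Nat.mod_eq_of_lt (Nat.lt_succ_of_le h)

variable (P) in
/-- The letters in a string. -/
def proj (z : List ℕ) : List ℕ := z.filter (· ≠ P.letters)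

variable (P) in
/-- The number of symbols in a string that are not letters. -/
def cost (z : List ℕ) : ℕ := z.count P.letters

@[simp] theorem proj_append (y z : List ℕ) : P.proj (y ++ z) = P.proj y ++ P.proj z :=
  List.filter_append _ _

@[simp] theorem cost_append (y z : List ℕ) : P.cost (y ++ z) = P.cost y + P.cost z :=
  List.count_append

theorem proj_letter {p : ℕ} (h : p < P.letters) : P.proj [p] = [p] := by
  simp [proj, h.ne]

theorem cost_letter {p : ℕ} (h : p < P.letters) : P.cost [p] = 0 := by
  simp [cost, h.ne]

@[simp] theorem proj_mark : P.proj [P.letters] = [] := by simp [proj]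

@[simp] theorem cost_mark : P.cost [P.letters] = 1 := by simp [cost]

/-- Every symbol is a letter or a mark. If the letters of a derived string are exactly those of the
queried substring, then its cost is the number of insertions. -/
theorem length_eq (z : List ℕ) : z.length = (P.proj z).length + P.cost z := by
  induction z with
  | nil => rfl
  | cons a z ih =>
    rw [← List.singleton_append, proj_append, cost_append, List.length_append, List.length_append,
      ih]
    by_cases h : a = P.letters
    · subst h; simp; omega
    · have h1 : P.proj [a] = [a] := by simp [proj, h]
      have h2 : P.cost [a] = 0 := by simp [cost, h]
      rw [h1, h2]; simp; omega

variable (P)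

/-- The price of a letter. -/
def price : ℕ := 2 ^ (P.len + 2)

/-- The factor property: the strings that are derived from `factor a`. -/
def FactorSpec (a : ℕ) (z : List ℕ) : Prop :=
  ∃ e < P.entries, ∃ u, P.block e = a ∧ P.proj z = P.first e :: (u ++ [P.last e]) ∧
    P.price * u.length + (2 ^ P.len - 1 + P.value e) ≤ P.cost z

/-- A property of the derived strings. -/
def Spec : MPSymbol → List ℕ → Prop
  | .start, _ => True
  | .mid, z => P.price * (P.proj z).length ≤ P.cost z
  | letter p, z => z = [p]
  | power t, z => P.proj z = [] ∧ 2 ^ t ≤ P.cost z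
  | chain h, z => ∃ u, P.proj z = P.first (h % P.entries) :: u ∧
      P.price * u.length + (2 ^ (h / P.entries) - 1 +
        P.value (h % P.entries) % 2 ^ (h / P.entries)) ≤ P.cost z
  | factor a, z => P.FactorSpec a z
  | prod c, z => ∃ k z₁ z₂, z = z₁ ++ z₂ ∧ P.FactorSpec (c / P.side2 * P.side2 + k) z₁ ∧
      P.FactorSpec (P.prods + k * P.side2 + c % P.side2) z₂ ∧ k < P.side2

variable {P}

theorem value_lt (e : ℕ) : P.value e < 2 ^ P.len := P.val_lt _ _

/-- By `Nat.mod_pow_succ`, bit `t` adds `2 ^ t` to `v % 2 ^ t` if it is set, and the offset `2 ^ t -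
1` grows by `2 ^ t` in any case. Over all `len` levels the marks add up to `2 ^ len - 1 + v`. -/
theorem chain_step (v t : ℕ) :
    2 ^ (t + 1) - 1 + v % 2 ^ (t + 1) = 2 ^ t - 1 + v % 2 ^ t + 2 ^ (t + v / 2 ^ t % 2) := by
  have h1 : 1 ≤ 2 ^ t := Nat.one_le_two_pow
  rw [Nat.mod_pow_succ, pow_add, pow_add, pow_one]
  rcases Nat.mod_two_eq_zero_or_one (v / 2 ^ t) with h | h <;> rw [h] <;> omega

/-- This is the induction step for the lower bound on scores, so for the costs inequalities suffice.
Nothing is needed for `start`, which occurs on the right-hand sides of its own productions only. -/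
theorem spec_sound {r : MPSymbol × RHS} (hr : r ∈ P.productions) (z : List ℕ)
    (hz : Sat P.Spec r.2 z) : P.Spec r.1 z := by
  obtain ⟨f, hf, x, hx, rfl⟩ := P.mem_productions.1 hr
  simp only [families, List.mem_cons, List.not_mem_nil, or_false] at hf
  rcases hf with rfl | rfl | rfl | rfl | rfl | rfl | rfl | rfl | rfl | rfl | rfl | rfl
  · trivial
  · obtain ⟨z₁, _, rfl, h₁, z₂, _, rfl, h₂, rfl⟩ := hz
    simp only [Spec, proj_append, cost_append, List.length_append, mul_add, List.append_nil] at *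
    omega
  · obtain ⟨_, rfl, rfl⟩ := hz
    simp [Spec]
  · obtain ⟨_, rfl, rfl⟩ := hz
    rfl
  · trivial
  · obtain ⟨z₁, _, rfl, h₁, z₂, _, rfl, h₂, rfl⟩ := hz
    simp only [Spec] at h₁ h₂ hx ⊢
    subst h₁
    simp only [proj_append, cost_append, List.append_nil, h₂.1, proj_letter hx, cost_letter hx,
      List.length_singleton, price]
    omega
  · obtain ⟨z₁, _, rfl, h₁, z₂, _, rfl, h₂, rfl⟩ := hz
    simp only [Spec, proj_append, cost_append, List.append_nil] at *
    refine ⟨by simp [h₁.1, h₂.1], by rw [pow_succ]; omega⟩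
  · trivial
  · obtain ⟨z₁, _, rfl, h₁, z₂, _, rfl, h₂, rfl⟩ := hz
    exact ⟨_, z₁, z₂, by simp, h₁, h₂, Nat.div_lt_of_lt_mul hx⟩
  · obtain ⟨z₁, _, rfl, ⟨u, h₁, h₁'⟩, z₂, _, rfl, h₂, rfl⟩ := hz
    simp only [Spec] at h₂ hx
    subst h₂
    -- The chain index `entries * len + x` is the top level of entry `x`, where reduction modulo `2
    -- ^ len` no longer changes the value.
    rw [Nat.mul_add_mod, Nat.mod_eq_of_lt hx] at h₁ h₁'
    rw [Nat.mul_add_div P.entries_pos, Nat.div_eq_of_lt hx, add_zero,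
      Nat.mod_eq_of_lt (value_lt x)] at h₁'
    refine ⟨x, hx, u, rfl, ?_, ?_⟩
    · simp [h₁, proj_letter (last_lt hx)]
    · simpa [cost_letter (last_lt hx)] using h₁'
  · obtain ⟨z₁, _, rfl, h₁, z₂, _, rfl, h₂, rfl⟩ := hz
    simp only [Spec] at h₁ h₂ hx ⊢
    subst h₁
    refine ⟨P.proj z₂, ?_, ?_⟩
    · rw [proj_append, proj_letter (first_lt hx), List.append_nil, Nat.mod_eq_of_lt hx]
      rfl
    · rw [cost_append, cost_letter (first_lt hx), List.append_nil, Nat.div_eq_of_lt hx, pow_zero,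
        Nat.mod_one]
      omega
  · obtain ⟨z₁, _, rfl, ⟨u, h₁, h₁'⟩, z₂, _, rfl, ⟨h₂, h₂'⟩, rfl⟩ := hz
    refine ⟨u, ?_, ?_⟩
    · simp [h₁, h₂]
    · rw [Nat.add_mod_right, Nat.add_div_right _ P.entries_pos, chain_step]
      simp only [cost_append, List.append_nil]
      omega

theorem spec_of_derives {A : Fin P.grammar.nt} {z : List (Fin P.grammar.tm)}
    (h : P.grammar.Derives [.nonterminal A] (P.grammar.ofTerminals z)) :
    P.Spec (P.decode A) (z.map Fin.val) := by
  refine Grammar.Derives.sound (G := P.grammar)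
    (Φ := fun A z => P.Spec (P.decode A) (z.map Fin.val)) ?_ h
  intro r hr z hz
  obtain ⟨r, hr', rfl⟩ := List.mem_map.1 hr
  have h1 := Sat.map (Φ' := P.Spec) Fin.val (fun A : Fin P.nonterminals => P.decode A)
    (fun A z h => h) _ _ hz
  have h2 := ofRule_toRule hr'
  have h3 : (P.decode (P.toRule r).input, (P.toRule r).output.map P.symbolNat) = r := h2
  have h4 := spec_sound hr' (z.map Fin.val)
  rw [← h3] at h4
  refine h4 (Eq.mp (congrArg (Sat P.Spec · _) (List.map_congr_left fun s _ => ?_)) h1)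
  cases s <;> rfl

end MinPlus
end LanEd

/-! ### Lower and upper bounds for the score of an entry -/

namespace LanEd

namespace MinPlus

open MPSymbol

variable {P : MinPlus}

theorem pair_inj {a a' c c' d : ℕ} (hc : c < d) (hc' : c' < d) (h : a * d + c = a' * d + c') :
    a = a' ∧ c = c' := by
  have hd : 0 < d := by omega
  have h1 := congrArg (· / d) h
  have h2 := congrArg (· % d) h
  simp only [mul_comm _ d, Nat.mul_add_div hd, Nat.mul_add_mod, Nat.div_eq_of_lt hc,
    Nat.div_eq_of_lt hc', Nat.mod_eq_of_lt hc, Nat.mod_eq_of_lt hc'] at h1 h2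
  exact ⟨by omega, h2⟩

theorem eq_of_div_mod {a b d : ℕ} (h : a / d = b / d) (h' : a % d = b % d) : a = b := by
  rw [← Nat.div_add_mod a d, ← Nat.div_add_mod b d, h, h']

variable (P) in
/-- The number of letters in the substring for an entry of the product. -/
def width (i j : ℕ) : ℕ := 2 * P.side + 4 + j % P.side - i % P.side

variable (P) in
/-- The score for an entry of the product, if the optimum is `d`. -/
def score (i j d : ℕ) : ℕ := P.price * (P.width i j - 4) + 2 * (2 ^ P.len - 1) + d

theorem five_le_width (i j : ℕ) : 5 ≤ P.width i j := by
  have := Nat.mod_lt i P.side_pos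
  unfold width; omega

theorem prod_div {i j : ℕ} (hj : j < P.dim) :
    (i / P.side * P.side2 + j / P.side) / P.side2 = i / P.side ∧
    (i / P.side * P.side2 + j / P.side) % P.side2 = j / P.side := by
  rw [mul_comm, Nat.mul_add_div P.side2_pos, Nat.mul_add_mod,
    Nat.div_eq_of_lt (div_side_lt hj), Nat.mod_eq_of_lt (div_side_lt hj), add_zero]
  exact ⟨rfl, rfl⟩

theorem price_eq (P : MinPlus) : P.price = 4 * 2 ^ P.len := by
  rw [price, pow_add]; ring

/-- The letters of `z` contain the queried interval. If there are no others, then the ends of the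
two factors are forced and the string encodes a genuine inner index `k`. Otherwise at least one more
letter has been paid for, which is more expensive than any choice of `k`. -/
theorem exists_score_le {i j : ℕ} (hi : i < P.dim) (hj : j < P.dim) {z : List ℕ}
    (hz : P.Spec (prod (i / P.side * P.side2 + j / P.side)) z)
    (hs : (List.range' (i % P.side) (P.width i j)).Sublist z) :
    ∃ k < P.dim, P.score i j (P.val i k + P.val k j) + P.width i j ≤ z.length := by
  obtain ⟨k, z₁, z₂, rfl, ⟨e₀, he₀, u₀, hb₀, hp₀, hc₀⟩, ⟨e₁, he₁, u₁, hb₁, hp₁, hc₁⟩, hk⟩ := hz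
  rw [(prod_div hj).1] at hb₀
  rw [(prod_div hj).2] at hb₁
  have hi' := Nat.mod_lt i P.side_pos
  have hj' := Nat.mod_lt j P.side_pos
  have hw : P.width i j = 2 * P.side + 4 + j % P.side - i % P.side := rfl
  have hsub : (List.range' (i % P.side) (P.width i j)).Sublist (P.proj (z₁ ++ z₂)) := by
    have := hs.filter (· ≠ P.letters)
    rwa [List.filter_eq_self.2] at this
    intro a ha
    rw [List.mem_range'_1] at ha
    have : P.letters = 3 * P.side + 3 := rfl
    simp only [decide_eq_true_eq]; omega
  have hproj : P.proj (z₁ ++ z₂) =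
      (P.first e₀ :: (u₀ ++ [P.last e₀])) ++ (P.first e₁ :: (u₁ ++ [P.last e₁])) := by
    rw [proj_append, hp₀, hp₁]
  have hlen : (P.proj (z₁ ++ z₂)).length = u₀.length + u₁.length + 4 := by
    rw [hproj]; simp; omega
  have hle := hsub.length_le
  rw [List.length_range', hlen] at hle
  rw [length_eq, hlen, cost_append]
  -- The four end letters of the factors are free; the price is paid for the letters of `u₀` and
  -- `u₁`.
  rcases hle.eq_or_lt with heq | hlt
  · have hH := hsub.eq_of_length (by rw [List.length_range', hlen, heq])
    rw [hproj] at hH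
    have get : ∀ x < P.width i j,
        ((P.first e₀ :: (u₀ ++ [P.last e₀])) ++ (P.first e₁ :: (u₁ ++ [P.last e₁])))[x]? =
          some (i % P.side + x) := by
      intro x hx
      rw [← hH, List.getElem?_range' hx]; simp
    -- These are the positions of the first and last letters of the two factors; the two in the
    -- middle are adjacent.
    have g₀ := get 0 (by omega)
    have g₁ := get (u₀.length + 1) (by omega)
    have g₂ := get (u₀.length + 2) (by omega)
    have g₃ := get (u₀.length + 2 + (u₁.length + 1)) (by omega)
    have hl : (P.first e₀ :: (u₀ ++ [P.last e₀])).length = u₀.length + 2 := by simp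
    rw [List.getElem?_append_left (by omega)] at g₀ g₁
    rw [List.getElem?_append_right (by omega), hl] at g₂ g₃
    rw [Nat.add_sub_cancel_left] at g₃
    simp only [List.getElem?_cons_zero, List.getElem?_cons_succ, Option.some.injEq,
      List.getElem?_concat_length, Nat.sub_self] at g₀ g₁ g₂ g₃
    unfold block at hb₀ hb₁
    have b₀ := prod_lt (row_lt (P := P) e₀) (col_lt (P := P) e₀)
    have b₁ := prod_lt (row_lt (P := P) e₁) (col_lt (P := P) e₁)
    have c₀ : i / P.side * P.side2 + k < P.prods := pair_lt (div_side_lt hi) hk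
    have c₁ : k * P.side2 + j / P.side < P.prods := pair_lt hk (div_side_lt hj)
    -- The blocks are read as numbers in mixed radix: base `prods` separates the factor, base
    -- `side2` the quotients of row and column.
    obtain ⟨f₀, r₀⟩ := pair_inj (a := P.fac e₀) (a' := 0) b₀ c₀ (by omega)
    obtain ⟨f₁, r₁⟩ := pair_inj (a := P.fac e₁) (a' := 1) b₁ c₁ (by omega)
    obtain ⟨r₀, s₀⟩ := pair_inj (div_side_lt (col_lt e₀)) hk r₀
    obtain ⟨r₁, s₁⟩ := pair_inj (div_side_lt (col_lt e₁)) (div_side_lt hj) r₁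
    simp only [first, last] at g₀ g₁ g₂ g₃
    rw [f₀] at g₀ g₁
    rw [f₁] at g₂ g₃
    have m₀ : P.row e₀ = i := eq_of_div_mod r₀ (by omega)
    have m₁ : P.col e₁ = j := eq_of_div_mod s₁ (by omega)
    -- Both quotients are `k`; the remainders agree because the letters `side + 1 + col % side` and
    -- `side + 2 + row % side` are neighbours in the word.
    have m₂ : P.row e₁ = P.col e₀ := eq_of_div_mod (r₁.trans s₀.symm) (by omega)
    refine ⟨P.col e₀, col_lt _, ?_⟩
    have v₀ : P.value e₀ = P.val i (P.col e₀) := by rw [value, m₀]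
    have v₁ : P.value e₁ = P.val (P.col e₀) j := by rw [value, m₁, m₂]
    rw [← v₀, ← v₁, score, show P.width i j - 4 = u₀.length + u₁.length by omega, mul_add]
    omega
  -- Any witness will do: one extra price `4 * 2 ^ len` exceeds the sum of two values, each less
  -- than `2 ^ len`.
  · refine ⟨0, P.dim_pos, ?_⟩
    have h5 := P.five_le_width i j
    have h1 : P.price * (P.width i j - 4 + 1) ≤ P.price * (u₀.length + u₁.length) :=
      Nat.mul_le_mul_left _ (by omega)
    have h2 := P.val_lt i 0
    have h3 := P.val_lt 0 j
    have h4 := P.price_eq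
    rw [score]
    rw [mul_add, mul_add] at h1
    omega

variable (P) in
/-- The nonterminal of the grammar. -/
def nonterm (v : MPSymbol) : Fin P.grammar.nt := ⟨P.code v % _, Nat.mod_lt _ P.nonterminals_pos⟩

theorem nonterm_val {v : MPSymbol} (h : P.Valid v) : (P.nonterm v : ℕ) = P.code v :=
  Nat.mod_eq_of_lt (code_lt h)

theorem exists_nonterm (A : Fin P.grammar.nt) : ∃ v, P.Valid v ∧ P.nonterm v = A := by
  refine ⟨P.decode A, valid_decode A.2, Fin.ext ?_⟩
  rw [nonterm_val (valid_decode A.2), code_decode]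

theorem mem_of_index (k : ℕ) (hk : k < 12) (x : ℕ) (hx : x < (P.families[k]'hk).1) :
    (P.families[k]'hk).2 x ∈ P.productions :=
  P.mem_productions.2 ⟨_, List.getElem_mem _, x, hx, rfl⟩

theorem rule_derives {v : MPSymbol} {γ : RHS} (h : (v, γ) ∈ P.productions) :
    P.grammar.Derives [.nonterminal (P.nonterm v)] (γ.map P.symbolG) :=
  Grammar.Derives.of_rule (G := P.grammar) (r := P.toRule (v, γ)) (List.mem_map_of_mem h)

variable (P) in
/-- A terminal string with given letters and costs is derived. -/
def Der (v : MPSymbol) (u : List ℕ) (c : ℕ) : Prop :=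
  ∃ z : List (Fin P.grammar.tm), P.grammar.Derives [.nonterminal (P.nonterm v)]
    (P.grammar.ofTerminals z) ∧ P.proj (z.map Fin.val) = u ∧ P.cost (z.map Fin.val) = c

theorem Der.pair {v a b : MPSymbol} {u u' : List ℕ} {c c' : ℕ}
    (h : (v, [.nonterminal a, .nonterminal b]) ∈ P.productions) (ha : P.Der a u c)
    (hb : P.Der b u' c') : P.Der v (u ++ u') (c + c') := by
  obtain ⟨z, hz, rfl, rfl⟩ := ha
  obtain ⟨z', hz', rfl, rfl⟩ := hb
  refine ⟨z ++ z', (rule_derives h).trans ?_, by simp, by simp⟩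
  rw [Grammar.ofTerminals_append]
  exact Grammar.Derives.append hz hz'

theorem Der.terminal {v : MPSymbol} {a : ℕ} (h : (v, [.terminal a]) ∈ P.productions)
    (ha : a ≤ P.letters) : P.Der v (P.proj [a]) (P.cost [a]) := by
  have : [a] = [P.letterG a].map Fin.val := by
    rw [List.map_singleton, letterG_val ha]
  rw [this]
  exact ⟨[P.letterG a], rule_derives h, rfl, rfl⟩

theorem der_letter {p : ℕ} (h : p < P.letters) : P.Der (letter p) [p] 0 := by
  have := Der.terminal (mem_of_index (P := P) 3 (by norm_num) p h) h.le
  rwa [proj_letter h, cost_letter h] at this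

theorem der_power {t : ℕ} (h : t < P.len + 3) : P.Der (power t) [] (2 ^ t) := by
  induction t with
  | zero =>
    have := Der.terminal (mem_of_index (P := P) 2 (by norm_num) 0 Nat.one_pos) le_rfl
    rwa [proj_mark, cost_mark] at this
  | succ t ih =>
    have ih := ih (by omega)
    have := Der.pair (mem_of_index (P := P) 6 (by norm_num) t
      (show t < P.len + 2 by omega)) ih ih
    rwa [List.append_nil, ← two_mul, ← pow_succ'] at this

/-- Each letter is followed by the `price` marks of `power (len + 2)`. The induction starts at one
letter, as `mid` derives no string without letters. -/
theorem der_mid {u : List ℕ} (hu : u ≠ []) (h : ∀ p ∈ u, p < P.letters) :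
    P.Der .mid u (P.price * u.length) := by
  induction u with
  | nil => exact absurd rfl hu
  | cons p u ih =>
    have h1 : P.Der .mid [p] P.price := by
      have := Der.pair (mem_of_index (P := P) 5 (by norm_num) p (h p (by simp)))
        (der_letter (h p (by simp))) (der_power (by omega))
      simpa [price] using this
    by_cases hu' : u = []
    · subst hu'; simpa using h1
    · have := Der.pair (mem_of_index (P := P) 1 (by norm_num) 0 Nat.one_pos) h1
        (ih hu' fun q hq => h q (by simp [hq]))
      rw [List.length_cons, mul_add, mul_one, add_comm]
      exact this

theorem der_chain {e t : ℕ} (he : e < P.entries) (ht : t ≤ P.len) {u : List ℕ} (hu : u ≠ [])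
    (h : ∀ p ∈ u, p < P.letters) : P.Der (chain (P.entries * t + e)) (P.first e :: u)
      (P.price * u.length + (2 ^ t - 1 + P.value e % 2 ^ t)) := by
  induction t with
  | zero =>
    have := Der.pair (mem_of_index (P := P) 10 (by norm_num) e he) (der_letter (first_lt he))
      (der_mid hu h)
    simpa [Nat.mod_one] using this
  | succ t ih =>
    have hx : P.entries * t + e < P.entries * P.len := by
      have : P.entries * (t + 1) ≤ P.entries * P.len := Nat.mul_le_mul_left _ ht
      rw [mul_add] at this; omega
    have hm := mem_of_index (P := P) 11 (by norm_num) (P.entries * t + e) hx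
    simp only [families, List.getElem_cons_succ, List.getElem_cons_zero] at hm
    rw [Nat.mul_add_mod, Nat.mod_eq_of_lt he, Nat.mul_add_div P.entries_pos, Nat.div_eq_of_lt he,
      add_zero] at hm
    have hbit : P.value e / 2 ^ t % 2 < 2 := Nat.mod_lt _ two_pos
    have := Der.pair hm (ih (by omega)) (der_power (by omega))
    rw [List.append_nil, add_assoc (P.price * u.length), ← chain_step] at this
    rwa [mul_add, mul_one, add_right_comm]

theorem der_factor {e : ℕ} (he : e < P.entries) {u : List ℕ} (hu : u ≠ [])
    (h : ∀ p ∈ u, p < P.letters) : P.Der (factor (P.block e)) (P.first e :: (u ++ [P.last e]))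
      (P.price * u.length + (2 ^ P.len - 1 + P.value e)) := by
  have := Der.pair (mem_of_index (P := P) 9 (by norm_num) e he) (der_chain he le_rfl hu h)
    (der_letter (last_lt he))
  rwa [add_zero, Nat.mod_eq_of_lt (value_lt e)] at this

theorem prod_mem {c k : ℕ} (hc : c < P.prods) (hk : k < P.side2) :
    (prod c, [.nonterminal (factor (c / P.side2 * P.side2 + k)),
      .nonterminal (factor (P.prods + k * P.side2 + c % P.side2))]) ∈ P.productions := by
  have hx : P.prods * k + c < P.prods * P.side2 := by
    have := pair_lt hk hc
    rw [mul_comm, mul_comm P.prods]; exact this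
  have := mem_of_index (P := P) 8 (by norm_num) (P.prods * k + c) hx
  simp only [families, List.getElem_cons_succ, List.getElem_cons_zero] at this
  rwa [Nat.mul_add_mod, Nat.mod_eq_of_lt hc, Nat.mul_add_div P.prods_pos, Nat.div_eq_of_lt hc,
    add_zero] at this

theorem range'_eq_ends {a b : ℕ} (h : a < b) :
    List.range' a (b - a + 1) = a :: (List.range' (a + 1) (b - a - 1) ++ [b]) := by
  obtain ⟨d, rfl⟩ := Nat.exists_eq_add_of_lt h
  rw [show a + d + 1 - a + 1 = d + 1 + 1 by omega, show a + d + 1 - a - 1 = d by omega,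
    List.range'_succ, List.range'_concat]
  congr 3; omega

/-- The entries `(i, k)` of the first factor and `(k, j)` of the second one give strings whose
letters are two consecutive intervals, meeting at the remainder of `k`; their union is the queried
interval. -/
theorem der_prod {i j k : ℕ} (hi : i < P.dim) (hj : j < P.dim) (hk : k < P.dim) :
    P.Der (prod (i / P.side * P.side2 + j / P.side)) (List.range' (i % P.side) (P.width i j))
      (P.score i j (P.val i k + P.val k j)) := by
  obtain ⟨e₀, he₀, f₀, r₀, c₀⟩ := exists_entry two_pos hi hk
  obtain ⟨e₁, he₁, f₁, r₁, c₁⟩ := exists_entry one_lt_two hk hj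
  have hi' := Nat.mod_lt i P.side_pos
  have hj' := Nat.mod_lt j P.side_pos
  have hk' := Nat.mod_lt k P.side_pos
  have hn : P.letters = 3 * P.side + 3 := rfl
  -- The offset `side + 1` between the first and the last letters of a factor leaves at least one
  -- letter strictly between them, so `mid` can be used.
  have key : ∀ a b : ℕ, a + 2 ≤ b → b < P.letters → List.range' (a + 1) (b - a - 1) ≠ [] ∧
      ∀ p ∈ List.range' (a + 1) (b - a - 1), p < P.letters := by
    intro a b h hb
    refine ⟨?_, fun p hp => ?_⟩
    · rw [Ne, List.range'_eq_nil_iff]; omega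
    · rw [List.mem_range'_1] at hp; omega
  have hF₀ : P.first e₀ = i % P.side := by rw [first, f₀, r₀]; omega
  have hL₀ : P.last e₀ = P.side + 1 + k % P.side := by rw [last, f₀, c₀]; omega
  have hF₁ : P.first e₁ = P.side + 2 + k % P.side := by rw [first, f₁, r₁]; omega
  have hL₁ : P.last e₁ = 2 * P.side + 3 + j % P.side := by rw [last, f₁, c₁]; omega
  obtain ⟨n₀, l₀⟩ := key (P.first e₀) (P.last e₀) (by omega) (last_lt he₀)
  obtain ⟨n₁, l₁⟩ := key (P.first e₁) (P.last e₁) (by omega) (last_lt he₁)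
  have d₀ := der_factor he₀ n₀ l₀
  have d₁ := der_factor he₁ n₁ l₁
  rw [← range'_eq_ends (by omega), block, f₀, r₀, c₀, zero_mul, zero_add] at d₀
  rw [← range'_eq_ends (by omega), block, f₁, r₁, c₁, one_mul] at d₁
  have hm := prod_mem (P := P) (prod_lt hi hj) (div_side_lt hk)
  rw [(prod_div hj).1, (prod_div hj).2] at hm
  have := Der.pair hm d₀ d₁
  rw [show P.first e₁ = P.first e₀ + (P.last e₀ - P.first e₀ + 1) by omega,
    List.range'_append_1] at this
  convert this using 1
  · rw [← hF₀]; congr 1; unfold width; omega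
  · rw [score, List.length_range', List.length_range']
    have v₀ : P.value e₀ = P.val i k := by rw [value, r₀, c₀]
    have v₁ : P.value e₁ = P.val k j := by rw [value, r₁, c₁]
    rw [v₀, v₁]
    have hw : P.width i j - 4 = (P.last e₀ - P.first e₀ - 1) + (P.last e₁ -
      (P.first e₀ + (P.last e₀ - P.first e₀ + 1)) - 1) := by unfold width; omega
    rw [hw, mul_add]
    omega

end MinPlus
end LanEd

/-! ### Admissibility of the grammar and the mc-derived scores -/

namespace LanEd

namespace MinPlus

open MPSymbol

variable {P : MinPlus}

/-- The entry whose row and column have remainder zero lies in the block. Thus every `factor`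
nonterminal has a production. -/
theorem exists_block_eq {a : ℕ} (h : a < 2 * P.prods) : ∃ e < P.entries, P.block e = a := by
  have h1 : a % P.prods < P.prods := Nat.mod_lt _ P.prods_pos
  have h2 : a % P.prods / P.side2 < P.side2 := Nat.div_lt_of_lt_mul h1
  have h3 : a % P.prods % P.side2 < P.side2 := Nat.mod_lt _ P.side2_pos
  have key : ∀ b < P.side2, b * P.side < P.dim := fun b hb => Nat.mul_lt_mul_of_pos_right hb
    P.side_pos
  obtain ⟨e, he, f, r, c⟩ := exists_entry (P := P) (f := a / P.prods)
    (Nat.div_lt_of_lt_mul (by rwa [mul_comm])) (key _ h2) (key _ h3)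
  refine ⟨e, he, ?_⟩
  rw [block, f, r, c, Nat.mul_div_cancel _ P.side_pos, Nat.mul_div_cancel _ P.side_pos, add_assoc,
    mul_comm _ P.side2, Nat.div_add_mod, mul_comm, Nat.div_add_mod]

theorem letters_pos (P : MinPlus) : 0 < P.letters := by unfold letters; omega

/-- A single middle letter suffices in every factor. The bound, with a generous constant, is the
parameter `L` of the oracle; it is of the order `2 ^ len`, which keeps the numbers of the oracle
polynomial. -/
theorem exists_der {v : MPSymbol} (hv : P.Valid v) :
    ∃ u c, P.Der v u c ∧ u.length + c ≤ 16 * P.price := by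
  have hp := P.price_eq
  have h1 : 1 ≤ 2 ^ P.len := Nat.one_le_two_pow
  have h0 : ∀ p ∈ [0], p < P.letters := by simpa using P.letters_pos
  have hfac : ∀ a < 2 * P.prods, ∃ u c, P.Der (factor a) u c ∧ u.length + c ≤ 8 * P.price := by
    intro a ha
    obtain ⟨e, he, rfl⟩ := exists_block_eq ha
    refine ⟨_, _, der_factor he (List.cons_ne_nil 0 []) h0, ?_⟩
    have := value_lt (P := P) e
    simp only [List.length_cons, List.length_append, List.length_nil]; omega
  cases v with
  | start =>
    exact ⟨[], 0, ⟨[], rule_derives (mem_of_index (P := P) 0 (by norm_num) 0 Nat.one_pos), rfl, rfl⟩,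
      by simp⟩
  | mid => exact ⟨_, _, der_mid (List.cons_ne_nil 0 []) h0, by simp; omega⟩
  | letter p => exact ⟨_, _, der_letter hv, by simp; omega⟩
  | power t =>
    refine ⟨_, _, der_power hv, ?_⟩
    have : 2 ^ t ≤ 2 ^ (P.len + 2) := Nat.pow_le_pow_right two_pos (Nat.lt_succ_iff.1 hv)
    rw [← price] at this
    simp only [List.length_nil]; omega
  | factor a =>
    obtain ⟨u, c, h, hl⟩ := hfac a hv
    exact ⟨u, c, h, by omega⟩
  | chain h =>
    have ht : h / P.entries ≤ P.len :=
      Nat.lt_succ_iff.1 (Nat.div_lt_of_lt_mul hv)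
    have := der_chain (Nat.mod_lt h P.entries_pos) ht (List.cons_ne_nil 0 []) h0
    rw [Nat.div_add_mod] at this
    refine ⟨_, _, this, ?_⟩
    have h2 : 2 ^ (h / P.entries) ≤ 2 ^ P.len := Nat.pow_le_pow_right two_pos ht
    have h3 : P.value (h % P.entries) % 2 ^ (h / P.entries) < 2 ^ (h / P.entries) :=
      Nat.mod_lt _ (by positivity)
    simp only [List.length_cons, List.length_nil]; omega
  | prod c =>
    have hm := prod_mem (P := P) (c := c) (k := 0) hv P.side2_pos
    obtain ⟨h₁, h₂⟩ := (productions_valid hm).2 _ (List.mem_cons_self ..),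
      (productions_valid hm).2 _ (List.mem_cons_of_mem _ (List.mem_cons_self ..))
    obtain ⟨u, x, hd, hl⟩ := hfac _ h₁
    obtain ⟨u', x', hd', hl'⟩ := hfac _ h₂
    exact ⟨_, _, Der.pair hm hd hd', by rw [List.length_append]; omega⟩

theorem exists_short (A : Fin P.grammar.nt) : ∃ z : List (Fin P.grammar.tm),
    P.grammar.Derives [.nonterminal A] (P.grammar.ofTerminals z) ∧ z.length ≤ 16 * P.price := by
  obtain ⟨v, hv, rfl⟩ := exists_nonterm A
  obtain ⟨_, _, ⟨z, hz, rfl, rfl⟩, hl⟩ := exists_der hv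
  rw [← length_eq, List.length_map] at hl
  exact ⟨z, hz, hl⟩

variable (P) in
/-- The nonterminal occurs in a sentential form. -/
def Reach (v : MPSymbol) : Prop := ∃ α β : P.grammar.Form,
  P.grammar.Derives [.nonterminal (P.nonterm .start)] (α ++ [.nonterminal (P.nonterm v)] ++ β)

theorem Reach.step {v w : MPSymbol} {γ : RHS} (hv : P.Reach v) (h : (v, γ) ∈ P.productions)
    (hw : Symbol.nonterminal w ∈ γ) : P.Reach w := by
  obtain ⟨α, β, hd⟩ := hv
  obtain ⟨γ₁, γ₂, rfl⟩ := List.append_of_mem hw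
  have hr := rule_derives h
  rw [List.map_append, List.map_cons,
    show P.symbolG (.nonterminal w) = .nonterminal (P.nonterm w) from rfl] at hr
  refine ⟨α ++ γ₁.map P.symbolG, γ₂.map P.symbolG ++ β, hd.trans ?_⟩
  have := Grammar.Derives.append (Grammar.Derives.append (.refl α) hr) (.refl β)
  simpa [List.append_assoc] using this

theorem reach_valid {v : MPSymbol} (hv : P.Valid v) : P.Reach v := by
  have hstart : P.Reach .start := ⟨[], [], .refl _⟩
  have hletter : ∀ p < P.letters, P.Reach (letter p) := fun p hp =>
    hstart.step (mem_of_index (P := P) 4 (by norm_num) p hp) (by simp)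
  have hprod : ∀ c < P.prods, P.Reach (prod c) := fun c hc =>
    hstart.step (mem_of_index (P := P) 7 (by norm_num) c hc) (by simp)
  have hfactor : ∀ a < 2 * P.prods, P.Reach (factor a) := by
    intro a ha
    by_cases h : a < P.prods
    · have h1 : a / P.side2 < P.side2 := Nat.div_lt_of_lt_mul h
      have hc : a / P.side2 * P.side2 + 0 < P.prods := pair_lt h1 P.side2_pos
      rw [add_zero] at hc
      have hm := prod_mem hc (Nat.mod_lt a P.side2_pos)
      refine (hprod _ hc).step hm ?_
      rw [Nat.mul_div_cancel _ P.side2_pos, mul_comm, Nat.div_add_mod]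
      simp
    · have h1 : a - P.prods < P.prods := by omega
      have h2 : (a - P.prods) % P.side2 < P.side2 := Nat.mod_lt _ P.side2_pos
      have hc : 0 * P.side2 + (a - P.prods) % P.side2 < P.prods := pair_lt P.side2_pos h2
      rw [zero_mul, zero_add] at hc
      have hm := prod_mem hc (Nat.div_lt_of_lt_mul h1 : (a - P.prods) / P.side2 < P.side2)
      refine (hprod _ hc).step hm ?_
      rw [Nat.mod_mod, add_assoc P.prods, mul_comm ((a - P.prods) / P.side2) P.side2, Nat.div_add_mod, Nat.add_sub_cancel' (by omega)]
      simp
  -- Productions lead from higher to lower levels, so the induction is on the distance `s` to the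
  -- top level, which is reached from `factor`. The same is done for `power`, whose top is reached
  -- from `mid`.
  have hchain : ∀ s t, s + t = P.len → ∀ e < P.entries, P.Reach (chain (P.entries * t + e)) := by
    intro s
    induction s with
    | zero =>
      intro t ht e he
      rw [zero_add] at ht
      rw [ht]
      exact (hfactor _ (block_lt he)).step (mem_of_index (P := P) 9 (by norm_num) e he)
        (by simp)
    | succ s ih =>
      intro t ht e he
      have h := ih (t + 1) (by omega) e he
      have hx : P.entries * t + e < P.entries * P.len := by
        have : P.entries * (t + 1) ≤ P.entries * P.len := Nat.mul_le_mul_left _ (by omega)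
        rw [mul_add] at this; omega
      rw [mul_add, mul_one, add_right_comm] at h
      exact h.step (mem_of_index (P := P) 11 (by norm_num) _ hx) (by simp)
  have hmid : P.Reach .mid := by
    have h := hchain P.len 0 rfl 0 P.entries_pos
    rw [mul_zero] at h
    exact h.step (mem_of_index (P := P) 10 (by norm_num) 0 P.entries_pos) (by simp)
  have hpower : ∀ s t, s + t = P.len + 2 → P.Reach (power t) := by
    intro s
    induction s with
    | zero =>
      intro t ht
      rw [zero_add] at ht
      rw [ht]
      exact hmid.step (mem_of_index (P := P) 5 (by norm_num) 0 P.letters_pos) (by simp)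
    | succ s ih =>
      intro t ht
      exact (ih (t + 1) (by omega)).step
        (mem_of_index (P := P) 6 (by norm_num) t (show t < P.len + 2 by omega)) (by simp)
  cases v with
  | start => exact hstart
  | mid => exact hmid
  | letter p => exact hletter p hv
  | prod c => exact hprod c hv
  | factor a => exact hfactor a hv
  | power t =>
    have : t < P.len + 3 := hv
    exact hpower (P.len + 2 - t) t (by omega)
  | chain h =>
    have ht : h / P.entries < P.len + 1 := Nat.div_lt_of_lt_mul hv
    have := hchain (P.len - h / P.entries) (h / P.entries) (by omega) _ (Nat.mod_lt h P.entries_pos)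
    rwa [Nat.div_add_mod] at this

theorem nonterm_start : P.nonterm .start = P.grammar.start :=
  Fin.ext (nonterm_val (v := .start) trivial)

theorem start_derives_nil : P.grammar.Derives [.nonterminal P.grammar.start] [] := by
  rw [← nonterm_start]
  exact rule_derives (mem_of_index (P := P) 0 (by norm_num) 0 Nat.one_pos)

theorem cnf : P.grammar.IsCNF := by
  intro r hr
  obtain ⟨r, hr', rfl⟩ := List.mem_map.1 hr
  obtain ⟨f, hf, x, hx, rfl⟩ := P.mem_productions.1 hr'
  simp only [families, List.mem_cons, List.not_mem_nil, or_false] at hf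
  rcases hf with rfl | rfl | rfl | rfl | rfl | rfl | rfl | rfl | rfl | rfl | rfl | rfl
  · exact .inr (.inr ⟨nonterm_start, rfl⟩)
  · exact .inl ⟨_, _, rfl⟩
  · exact .inr (.inl ⟨_, rfl⟩)
  · exact .inr (.inl ⟨_, rfl⟩)
  all_goals exact .inl ⟨_, _, rfl⟩

theorem admissible (P : MinPlus) : P.grammar.Admissible := by
  refine ⟨cnf, fun A => ?_, ?_⟩
  · obtain ⟨v, hv, rfl⟩ := exists_nonterm A
    obtain ⟨α, β, h⟩ := reach_valid hv
    obtain ⟨z, hz⟩ := Grammar.exists_derives (G := P.grammar)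
      (fun A => (exists_short A).imp fun _ h => h.1) (α ++ [.nonterminal (P.nonterm v)] ++ β)
    rw [nonterm_start] at h
    exact ⟨α, β, z, h, hz⟩
  · exact start_derives_nil

variable (P) in
/-- The string of all letters. -/
def word : List (Fin P.grammar.tm) := (List.range P.letters).map P.letterG

theorem word_map_val : P.word.map Fin.val = List.range P.letters := by
  rw [word, List.map_map]
  conv_rhs => rw [← List.map_id (List.range P.letters)]
  refine List.map_congr_left fun a ha => ?_
  have := List.mem_range.1 ha
  exact letterG_val (by omega)

theorem word_length : P.word.length = P.letters := by simp [word]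

theorem start_derives_letters (y : List (Fin P.grammar.tm))
    (hy : ∀ a ∈ y.map Fin.val, a < P.letters) :
    P.grammar.Derives [.nonterminal P.grammar.start]
      (P.grammar.ofTerminals y ++ [.nonterminal P.grammar.start]) := by
  induction y with
  | nil => exact .refl _
  | cons a y ih =>
    have h1 := rule_derives (mem_of_index (P := P) 4 (by norm_num) a (hy a (by simp)))
    have h2 := rule_derives (mem_of_index (P := P) 3 (by norm_num) a (hy a (by simp)))
    rw [nonterm_start] at h1
    have h3 : P.grammar.Derives [.nonterminal (P.nonterm (letter a))] [.terminal a] := by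
      have e : P.letterG a = a := Fin.ext (Nat.mod_eq_of_lt a.2)
      have e' : P.symbolG (.terminal a) = .terminal a := congrArg Symbol.terminal e
      change P.grammar.Derives _ [P.symbolG (.terminal a)] at h2
      rw [e'] at h2
      exact h2
    refine h1.trans ?_
    have h4 := Grammar.Derives.append h3 (ih fun b hb => hy b (by simp_all))
    rw [← nonterm_start] at h4 ⊢
    exact h4

theorem context_derives {c : ℕ} (hc : c < P.prods) (y y' : List (Fin P.grammar.tm))
    (hy : ∀ a ∈ y.map Fin.val, a < P.letters) (hy' : ∀ a ∈ y'.map Fin.val, a < P.letters) :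
    P.grammar.Derives [.nonterminal P.grammar.start]
      (P.grammar.ofTerminals y ++ [.nonterminal (P.nonterm (prod c))] ++
        P.grammar.ofTerminals y') := by
  refine (start_derives_letters y hy).trans ?_
  rw [List.append_assoc]
  refine Grammar.Derives.append (.refl _) ?_
  have h1 := rule_derives (mem_of_index (P := P) 7 (by norm_num) c hc)
  rw [nonterm_start] at h1
  refine h1.trans ?_
  change P.grammar.Derives ([.nonterminal (P.nonterm (prod c))] ++
    [.nonterminal (P.nonterm .start)]) _
  rw [nonterm_start]
  refine Grammar.Derives.append (.refl _) ((start_derives_letters y' hy').trans ?_)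
  have := Grammar.Derives.append (.refl (P.grammar.ofTerminals y')) (start_derives_nil (P := P))
  rwa [List.append_nil] at this

/-- Positions in a string count from 1 but letters from 0, so the substring runs from letter `i %
side` to letter `2 * side + 3 + j % side`. Attainment comes from `der_prod`, minimality from
`exists_score_le`, and the context from `context_derives`. -/
theorem mcDerives {i j k : ℕ} (hi : i < P.dim) (hj : j < P.dim) (hk : k < P.dim)
    (hmin : ∀ k' < P.dim, P.val i k + P.val k j ≤ P.val i k' + P.val k' j) :
    MCDerives P.grammar P.word (P.nonterm (prod (i / P.side * P.side2 + j / P.side)))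
      (i % P.side + 1) (2 * P.side + 4 + j % P.side) (P.score i j (P.val i k + P.val k j)) := by
  have hi' := Nat.mod_lt i P.side_pos
  have hj' := Nat.mod_lt j P.side_pos
  have hn : P.letters = 3 * P.side + 3 := rfl
  have hv : P.Valid (prod (i / P.side * P.side2 + j / P.side)) := prod_lt hi hj
  have hsub : (substr P.word (i % P.side + 1) (2 * P.side + 4 + j % P.side)).map Fin.val =
      List.range' (i % P.side) (P.width i j) := by
    rw [substr, List.map_drop, List.map_take, word_map_val, List.take_range,
      List.range_eq_range', List.drop_range', Nat.min_eq_left (by omega)]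
    congr 1; omega
  have hsubl : (substr P.word (i % P.side + 1) (2 * P.side + 4 + j % P.side)).length =
      P.width i j := by
    rw [← List.length_map (f := Fin.val), hsub, List.length_range']
  refine ⟨⟨?_, ?_⟩, ?_⟩
  · obtain ⟨z, hz, h1, h2⟩ := der_prod hi hj hk
    refine ⟨z, hz, ?_⟩
    have hs : (substr P.word (i % P.side + 1) (2 * P.side + 4 + j % P.side)).Sublist z := by
      have hf : (List.range' (i % P.side) (P.width i j)).Sublist (z.map Fin.val) := by
        rw [← h1]; exact List.filter_sublist
      rw [← hsub] at hf
      obtain ⟨z', hz', he⟩ := List.sublist_map_iff.1 hf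
      rwa [List.map_injective_iff.2 Fin.val_injective he]
    have := Insertions.of_sublist hs
    rwa [hsubl, ← List.length_map (f := Fin.val) (as := z), length_eq, h1, h2, List.length_range',
      Nat.add_sub_cancel_left] at this
  · rintro l ⟨z, hz, hl⟩
    have h1 := spec_of_derives hz
    rw [nonterm_val hv, decode_code hv] at h1
    have h2 := hl.sublist.map Fin.val
    rw [hsub] at h2
    obtain ⟨k', hk', h3⟩ := exists_score_le hi hj h1 h2
    rw [List.length_map, hl.length, hsubl] at h3
    have h4 := hmin k' hk'
    have : P.score i j (P.val i k + P.val k j) ≤ P.score i j (P.val i k' + P.val k' j) := by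
      unfold score; omega
    omega
  · have h1 : ∀ a ∈ P.word.map Fin.val, a < P.letters := by
      rw [word_map_val]; simp
    refine context_derives (prod_lt hi hj) _ _ (fun a ha => h1 a ?_) (fun a ha => h1 a ?_)
    · exact ((List.take_sublist _ _).map _).subset ha
    · exact ((List.drop_sublist _ _).map _).subset ha

end MinPlus
end LanEd

/-! ## Walks and min-plus squaring -/

namespace APSP

/-- Walks with `s` steps in the complete graph on `0, …, N - 1` with weights `D`. -/
def StepWalk (D : ℕ → ℕ → ℤ) (N : ℕ) : ℕ → ℕ → ℕ → ℤ → Prop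
  | 0, u, v, d => u = v ∧ d = 0
  | s + 1, u, v, d => ∃ k < N, ∃ d', StepWalk D N s k v d' ∧ d = D u k + d'

/-- `E` holds the least weights of the walks with `s` steps. -/
def IsMinMatrix (D : ℕ → ℕ → ℤ) (N s : ℕ) (E : ℕ → ℕ → ℤ) : Prop :=
  ∀ u < N, ∀ v < N, IsLeast {d | StepWalk D N s u v d} (E u v)

variable {D : ℕ → ℕ → ℤ} {N : ℕ}

theorem StepWalk.add_iff {a b u v : ℕ} (hu : u < N) {d : ℤ} :
    StepWalk D N (a + b) u v d ↔
      ∃ k < N, ∃ d₁ d₂, StepWalk D N a u k d₁ ∧ StepWalk D N b k v d₂ ∧ d = d₁ + d₂ := by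
  induction a generalizing u d with
  | zero =>
    rw [zero_add]
    constructor
    · exact fun h => ⟨u, hu, 0, d, ⟨rfl, rfl⟩, h, by simp⟩
    · rintro ⟨k, hk, d₁, d₂, ⟨rfl, rfl⟩, h, rfl⟩
      simpa using h
  | succ a ih =>
    rw [Nat.succ_add]
    constructor
    · rintro ⟨l, hl, d', h, rfl⟩
      obtain ⟨k, hk, d₁, d₂, h₁, h₂, rfl⟩ := (ih hl).1 h
      exact ⟨k, hk, D u l + d₁, d₂, ⟨l, hl, d₁, h₁, rfl⟩, h₂, by ring⟩
    · rintro ⟨k, hk, _, d₂, ⟨l, hl, d₁, h₁, rfl⟩, h₂, rfl⟩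
      exact ⟨l, hl, d₁ + d₂, (ih hl).2 ⟨k, hk, d₁, d₂, h₁, h₂, rfl⟩, by ring⟩

theorem isMinMatrix_one : IsMinMatrix D N 1 D := by
  intro u hu v hv
  refine ⟨⟨v, hv, 0, ⟨rfl, rfl⟩, by simp⟩, ?_⟩
  rintro d ⟨k, hk, d', ⟨rfl, rfl⟩, rfl⟩
  simp

/-- A walk with `s + s` steps is cut at its midpoint `k`. -/
theorem IsMinMatrix.square {s : ℕ} {E E' : ℕ → ℕ → ℤ} (h : IsMinMatrix D N s E)
    (hE : ∀ u < N, ∀ v < N, ∃ k < N, E' u v = E u k + E k v ∧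
      ∀ k' < N, E u k + E k v ≤ E u k' + E k' v) : IsMinMatrix D N (s + s) E' := by
  intro u hu v hv
  obtain ⟨k, hk, he, hmin⟩ := hE u hu v hv
  constructor
  · exact (StepWalk.add_iff hu).2 ⟨k, hk, _, _, (h u hu k hk).1, (h k hk v hv).1, he⟩
  · rintro d hd
    obtain ⟨k', hk', d₁, d₂, h₁, h₂, rfl⟩ := (StepWalk.add_iff hu).1 hd
    have := hmin k' hk'
    have := (h u hu k' hk').2 h₁
    have := (h k' hk' v hv).2 h₂
    rw [he]; linarith

theorem StepWalk.abs_le {Z : ℤ} (hD : ∀ u v, |D u v| ≤ Z) {s u v : ℕ} {d : ℤ}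
    (h : StepWalk D N s u v d) : |d| ≤ s * Z := by
  induction s generalizing u d with
  | zero => obtain ⟨rfl, rfl⟩ := h; simp
  | succ s ih =>
    obtain ⟨k, -, d', h', rfl⟩ := h
    have := ih h'
    have := hD u k
    have := abs_add_le (D u k) d'
    push_cast; linarith

theorem IsMinMatrix.abs_le {Z : ℤ} (hD : ∀ u v, |D u v| ≤ Z) {s : ℕ} {E : ℕ → ℕ → ℤ}
    (h : IsMinMatrix D N s E) {u v : ℕ} (hu : u < N) (hv : v < N) : |E u v| ≤ s * Z :=
  StepWalk.abs_le hD (h u hu v hv).1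

/-! ### Walks of a digraph as walks of fixed length in a complete graph -/

variable {m : ℕ} (w : WDigraph m)

/-- The weights of the complete graph, with `Z` for missing edges. -/
def initial (Z : ℤ) (u v : ℕ) : ℤ :=
  if u = v then 0 else if h : u < m ∧ v < m then (w ⟨u, h.1⟩ ⟨v, h.2⟩).getD Z else Z

variable {w}

theorem abs_initial_le {Z : ℤ} (hZ : 0 ≤ Z) (hw : ∀ u v x, w u v = some x → |x| ≤ Z) (u v : ℕ) :
    |initial w Z u v| ≤ Z := by
  unfold initial
  split_ifs with h h'
  · simpa using hZ
  · cases hx : w ⟨u, h'.1⟩ ⟨v, h'.2⟩ with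
    | none => simp [abs_of_nonneg hZ]
    | some x => exact hw _ _ _ hx
  · simp [abs_of_nonneg hZ]

theorem neg_le_initial {Z W : ℤ} (hZ : 0 ≤ Z) (hW : 0 ≤ W)
    (hw : ∀ u v x, w u v = some x → |x| ≤ W) (u v : ℕ) : -W ≤ initial w Z u v := by
  unfold initial
  split_ifs with h h'
  · linarith
  · cases hx : w ⟨u, h'.1⟩ ⟨v, h'.2⟩ with
    | none => simp; linarith
    | some x => exact (abs_le.1 (hw _ _ _ hx)).1
  · linarith

theorem StepWalk.neg_le {W : ℤ} (hD : ∀ u v, -W ≤ D u v) {s u v : ℕ} {d : ℤ}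
    (h : StepWalk D N s u v d) : -(s * W) ≤ d := by
  induction s generalizing u d with
  | zero => obtain ⟨rfl, rfl⟩ := h; simp
  | succ s ih =>
    obtain ⟨k, -, d', h', rfl⟩ := h
    have := ih h'
    have := hD u k
    push_cast; linarith

/-- A walk that uses no missing edge is a walk of the digraph once its pauses on the diagonal are
dropped. A missing edge costs `Z`, and all other steps together gain at most `s * W`. -/
theorem StepWalk.isWalk_or {Z W : ℤ} (hZ : 0 ≤ Z) (hW : 0 ≤ W)
    (hw : ∀ u v x, w u v = some x → |x| ≤ W) {s : ℕ} {u v : Fin m} {d : ℤ}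
    (h : StepWalk (initial w Z) N s u v d) :
    (IsWalk w u v d ∧ d ≤ s * W) ∨ Z - s * W ≤ d := by
  induction s generalizing u d with
  | zero =>
    obtain ⟨h, rfl⟩ := h
    obtain rfl := Fin.ext h
    exact .inl ⟨.nil u, by simp⟩
  | succ s ih =>
    obtain ⟨k, -, d', h', rfl⟩ := h
    push_cast
    by_cases hk : (u : ℕ) = k
    · subst hk
      rw [initial, if_pos rfl, zero_add]
      exact (ih h').imp (fun h => ⟨h.1, by linarith [h.2]⟩) fun h => by linarith
    · have hneg := h'.neg_le (neg_le_initial hZ hW hw)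
      rw [initial, if_neg hk]
      split_ifs with hm
      · cases hx : w ⟨u, hm.1⟩ ⟨k, hm.2⟩ with
        | none => right; simp only [Option.getD_none]; linarith
        | some x =>
          have hxW := _root_.abs_le.1 (hw _ _ _ hx)
          rcases ih (u := ⟨k, hm.2⟩) h' with ⟨h1, h2⟩ | h1
          · exact .inl ⟨.cons hx h1, by simp only [Option.getD_some]; linarith⟩
          · right; simp only [Option.getD_some]; linarith
      · right; linarith

/-- The vertices and the partial sums of a walk with `s` edges. -/
structure IsPath (w : WDigraph m) (s : ℕ) (p : ℕ → Fin m) (c : ℕ → ℤ) : Prop where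
  edge : ∀ i < s, w (p i) (p (i + 1)) = some (c (i + 1) - c i)

theorem IsWalk.exists_path {u v : Fin m} {d : ℤ} (h : IsWalk w u v d) :
    ∃ s p c, IsPath w s p c ∧ p 0 = u ∧ p s = v ∧ c 0 = 0 ∧ c s = d := by
  induction h with
  | nil u => exact ⟨0, fun _ => u, fun _ => 0, ⟨by simp⟩, rfl, rfl, rfl, rfl⟩
  | @cons u _ _ x _ he _ ih =>
    obtain ⟨s, p, c, h, rfl, rfl, hc, rfl⟩ := ih
    refine ⟨s + 1, fun | 0 => u | i + 1 => p i, fun | 0 => 0 | i + 1 => x + c i, ⟨?_⟩, rfl, rfl,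
      rfl, rfl⟩
    rintro (_ | i) hi
    · simp [he, hc]
    · simp [h.edge i (by omega)]

theorem IsPath.isWalk {s : ℕ} {p : ℕ → Fin m} {c : ℕ → ℤ} (h : IsPath w s p c) {i k : ℕ}
    (hk : i + k ≤ s) : IsWalk w (p i) (p (i + k)) (c (i + k) - c i) := by
  induction k generalizing i with
  | zero => simpa using IsWalk.nil (w := w) (p i)
  | succ k ih =>
    have h1 := ih (i := i + 1) (by omega)
    have h2 := IsWalk.cons (h.edge i (by omega)) h1
    rw [show i + 1 + k = i + (k + 1) by omega] at h2
    convert h2 using 1; ring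

/-- With `m` or more edges some vertex repeats, by the pigeonhole principle; cutting out the cycle
in between does not increase the weight. -/
theorem IsPath.exists_short (hw : NoNegativeCycle w) {s : ℕ} {p : ℕ → Fin m} {c : ℕ → ℤ}
    (h : IsPath w s p c) : ∃ s' < m, ∃ p' c', IsPath w s' p' c' ∧ p' 0 = p 0 ∧ p' s' = p s ∧
      c' 0 = c 0 ∧ c' s' ≤ c s := by
  induction s using Nat.strong_induction_on generalizing p c with
  | _ s ih =>
  by_cases hs : s < m
  · exact ⟨s, hs, p, c, h, rfl, rfl, rfl, le_rfl⟩
  obtain ⟨i, j, hij, hjs, he⟩ : ∃ i j, i < j ∧ j ≤ s ∧ p i = p j := by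
    obtain ⟨a, b, hab, he⟩ := Fintype.exists_ne_map_eq_of_card_lt
      (fun a : Fin (s + 1) => p a) (by simp; omega)
    have := a.2
    have := b.2
    rcases lt_or_gt_of_ne hab with hlt | hlt
    · exact ⟨a, b, hlt, by omega, he⟩
    · exact ⟨b, a, hlt, by omega, he.symm⟩
  have hcyc : 0 ≤ c j - c i := by
    have := h.isWalk (i := i) (k := j - i) (by omega)
    rw [show i + (j - i) = j by omega, ← he] at this
    exact hw _ _ this
  obtain ⟨l, rfl⟩ : ∃ l, j = i + l := ⟨j - i, by omega⟩
  obtain ⟨s', hs', p', c', h', h1, h2, h3, h4⟩ := ih (s - l) (by omega)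
    -- The path skips the cycle from `i` to `i + l`, and later partial sums are lowered by the
    -- weight of the cycle.
    (p := fun t => if t ≤ i then p t else p (t + l))
    (c := fun t => if t ≤ i then c t else c (t + l) - (c (i + l) - c i)) ⟨by
      intro t ht
      rcases lt_trichotomy t i with hlt | rfl | hlt
      · rw [if_pos hlt.le, if_pos (Nat.succ_le_of_lt hlt), if_pos hlt.le, if_pos (Nat.succ_le_of_lt hlt)]
        exact h.edge t (by omega)
      · rw [if_pos le_rfl, if_neg (by omega), if_pos le_rfl, if_neg (by omega), he,
          show t + 1 + l = t + l + 1 by omega, h.edge _ (by omega)]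
        congr 1; ring
      · rw [if_neg (by omega), if_neg (by omega), if_neg (by omega), if_neg (by omega),
          show t + 1 + l = t + l + 1 by omega, h.edge _ (by omega)]
        congr 1; ring⟩
  refine ⟨s', hs', p', c', h', by simpa using h1, h2.trans ?_, by simpa using h3, h4.trans ?_⟩
  · split_ifs with hle
    · rw [show s - l = i by omega, he]; congr 1; omega
    · congr 1; omega
  · split_ifs with hle
    · rw [show s - l = i by omega, show s = i + l by omega]; linarith
    · rw [show s - l + l = s by omega]; linarith

/-- Only an inequality holds, because a loop of the digraph is replaced by a diagonal step of weight
zero; a loop is a cycle and so has nonnegative weight. -/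
theorem IsPath.exists_stepWalk {Z : ℤ} (hw : NoNegativeCycle w) (hN : m ≤ N) {s : ℕ}
    {p : ℕ → Fin m} {c : ℕ → ℤ} (h : IsPath w s p c) :
    ∃ d ≤ c s - c 0, StepWalk (initial w Z) N s (p 0) (p s) d := by
  induction s generalizing p c with
  | zero => exact ⟨0, by simp, rfl, rfl⟩
  | succ s ih =>
    obtain ⟨d, hd, h'⟩ := ih (p := fun i => p (i + 1)) (c := fun i => c (i + 1))
      ⟨fun i hi => h.edge (i + 1) (by omega)⟩
    have he := h.edge 0 (by omega)
    rw [zero_add] at he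
    refine ⟨initial w Z (p 0) (p 1) + d, ?_, p 1, (p 1).2.trans_le hN, d, h', rfl⟩
    have hi : initial w Z (p 0) (p 1) ≤ c 1 - c 0 := by
      unfold initial
      split_ifs with h1 h2
      · rw [← Fin.ext h1] at he
        have := hw _ _ (IsWalk.cons he (.nil _))
        linarith
      · rw [he]; simp
      · exact absurd ⟨(p 0).2, (p 1).2⟩ h2
    rw [zero_add] at hd
    linarith

theorem StepWalk.pad {Z : ℤ} (s t : ℕ) {u v : ℕ} (hu : u < N) {d : ℤ}
    (h : StepWalk (initial w Z) N s u v d) : StepWalk (initial w Z) N (t + s) u v d := by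
  induction t with
  | zero => rwa [zero_add]
  | succ t ih =>
    rw [Nat.succ_add]
    exact ⟨u, hu, d, ih, by simp [initial]⟩

theorem IsWalk.exists_stepWalk {Z : ℤ} (hw : NoNegativeCycle w) (hN : m ≤ N) {s : ℕ} (hs : m ≤ s)
    {u v : Fin m} {d : ℤ} (h : IsWalk w u v d) :
    ∃ d' ≤ d, StepWalk (initial w Z) N s u v d' := by
  obtain ⟨_, p, c, hp, rfl, rfl, hc, rfl⟩ := h.exists_path
  obtain ⟨s', hs', p', c', h', h1, h2, h3, h4⟩ := hp.exists_short hw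
  obtain ⟨d, hd, hsw⟩ := h'.exists_stepWalk (Z := Z) hw hN
  rw [h1, h2] at hsw
  refine ⟨d, by linarith, ?_⟩
  have := hsw.pad s' (s - s') ((p 0).2.trans_le hN)
  rwa [Nat.sub_add_cancel (by omega)] at this

/-- The distances, from the least weights of walks with sufficiently many steps. -/
theorem IsMinMatrix.distance {W : ℤ} (hW : 0 ≤ W) (hw : NoNegativeCycle w)
    (hwW : ∀ u v x, w u v = some x → |x| ≤ W) (hN : m ≤ N) {s : ℕ} (hs : m ≤ s)
    {E : ℕ → ℕ → ℤ} (h : IsMinMatrix (initial w (2 * (s * W) + 1)) N s E) (u v : Fin m) :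
    ((∃ d, IsWalk w u v d) → E u v ≤ s * W ∧ IsLeast {d | IsWalk w u v d} (E u v)) ∧
    ((¬ ∃ d, IsWalk w u v d) → ¬ E u v ≤ s * W) := by
  have hsW : 0 ≤ s * W := by positivity
  obtain ⟨hE, hmin⟩ := h u (u.2.trans_le hN) v (v.2.trans_le hN)
  have hdich : ∀ {d}, StepWalk (initial w (2 * (s * W) + 1)) N s u v d →
      (IsWalk w u v d ∧ d ≤ s * W) ∨ 2 * (s * W) + 1 - s * W ≤ d := fun h =>
    h.isWalk_or (by linarith) hW hwW
  constructor
  · rintro ⟨d, hd⟩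
    -- A reachable vertex is reached by fewer than `m ≤ s` edges of weight at most `W`, padded with
    -- diagonal steps. The value `2 * s * W + 1` for missing edges is chosen so that a walk through
    -- one of them has weight greater than `s * W`.
    have key : E u v ≤ s * W := by
      by_contra hlt
      obtain ⟨_, p, c, hp, rfl, rfl, hc, rfl⟩ := hd.exists_path
      obtain ⟨s', hs', p', c', h', h1, h2, h3, h4⟩ := hp.exists_short hw
      obtain ⟨d, hd, hsw⟩ := h'.exists_stepWalk (Z := 2 * (s * W) + 1) hw hN
      have hle : ∀ k ≤ s', c' k - c' 0 ≤ k * W := by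
        intro k hk
        induction k with
        | zero => simp
        | succ k ih =>
          have := ih (by omega)
          have := (_root_.abs_le.1 (hwW _ _ _ (h'.edge k (by omega)))).2
          push_cast; linarith
      rw [h1, h2] at hsw
      have := hsw.pad s' (s - s') ((p 0).2.trans_le hN)
      rw [Nat.sub_add_cancel (by omega)] at this
      have h5 := hmin this
      have h6 := hle s' le_rfl
      have h7 : (s' : ℤ) * W ≤ s * W := by gcongr; omega
      linarith
    refine ⟨key, ?_, ?_⟩
    · rcases hdich hE with h | h
      · exact h.1
      · linarith
    · intro d hd
      obtain ⟨d', hd', h'⟩ := hd.exists_stepWalk (Z := 2 * (s * W) + 1) hw hN hs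
      exact (hmin h').trans hd'
  · intro hno hle
    rcases hdich hE with h | h
    · exact hno ⟨_, h.1⟩
    · linarith

end APSP

/-! ## Writing the grammar into memory -/

namespace Imp

open LanEd MinPlus MPSymbol

/-- The memory `σ'` differs from `σ` only in the simulated machine and in two counters. -/
structure Frame (σ σ' : Mem) : Prop where
  reg : ∀ x, x ≠ .ctr → x ≠ .count → σ'.reg x = σ.reg x
  arr : ∀ a < 4, σ'.arr a = σ.arr a
  cell : ∀ (a : ℕ) (k : ℤ), k % σ.reg .rounds ≠ σ.reg .rnd → σ'.arr a k = σ.arr a k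

theorem Frame.refl (σ : Mem) : Frame σ σ := ⟨fun _ _ _ => rfl, fun _ _ => rfl, fun _ _ _ => rfl⟩

theorem Frame.trans {σ σ' σ'' : Mem} (h : Frame σ σ') (h' : Frame σ' σ'') : Frame σ σ'' := by
  refine ⟨fun x h₁ h₂ => (h'.reg x h₁ h₂).trans (h.reg x h₁ h₂),
    fun a ha => (h'.arr a ha).trans (h.arr a ha), fun a k hk => (h'.cell a k ?_).trans (h.cell a k hk)⟩
  rwa [h.reg _ (by decide) (by decide), h.reg _ (by decide) (by decide)]

theorem SimFrame.frame {σ σ' : Mem} (h : SimFrame σ σ') : Frame σ σ' :=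
  ⟨fun x _ _ => congrFun h.reg x, h.arr, h.cell⟩

theorem Frame.set {σ : Mem} {x : Var} (hx : x = .ctr ∨ x = .count) (v : ℤ) :
    Frame σ (σ.set x v) := by
  refine ⟨fun y h₁ h₂ => ?_, fun _ _ => rfl, fun _ _ _ => rfl⟩
  rw [Mem.set_reg, if_neg]
  rcases hx with rfl | rfl <;> assumption

theorem Frame.simOK {σ σ' : Mem} (h : Frame σ σ') (hσ : σ.SimOK) : σ'.SimOK := by
  unfold Mem.SimOK
  rw [h.reg _ (by decide) (by decide), h.reg _ (by decide) (by decide)]; exact hσ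

theorem view_set {σ : Mem} {x : Var} (hx : x = .ctr ∨ x = .count) (v : ℤ) :
    (σ.set x v).view = σ.view := by
  have h := Frame.set (σ := σ) hx v
  unfold Mem.view
  rw [h.reg _ (by decide) (by decide), h.reg _ (by decide) (by decide)]; rfl

namespace Expr

def letters : Expr := 3 * Var.side + 3
def side2 : Expr := Var.side * Var.side
def dim : Expr := Var.side * Var.side * Var.side
def dim2 : Expr := dim * dim
def prods : Expr := side2 * side2
def entries : Expr := 2 * dim2
/-- The weight of missing edges. -/
def top : Expr := 2 * (Var.pw * Var.wmax) + 1
/-- The number that is added to the entries of the matrix. -/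
def shift : Expr := Var.pw * top
def fac (e : Expr) : Expr := e / dim2
def row (e : Expr) : Expr := e % dim2 / dim
def col (e : Expr) : Expr := e % dim2 % dim
def value (e : Expr) : Expr := .load 2 (e % dim2) + shift
def first (e : Expr) : Expr := fac e * (Var.side + 2) + row e % Var.side
def last (e : Expr) : Expr := fac e * (Var.side + 2) + (Var.side + 1) + col e % Var.side
def block (e : Expr) : Expr := fac e * prods + row e / Var.side * side2 + col e / Var.side
def letter (p : Expr) : Expr := 2 + p
def power (t : Expr) : Expr := 2 + letters + t
def prod (c : Expr) : Expr := 2 + letters + (Var.len + 3) + c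
def factor (a : Expr) : Expr := 2 + letters + (Var.len + 3) + prods + a
def chain (h : Expr) : Expr := 2 + letters + (Var.len + 3) + 3 * prods + h

end Expr

/-- The memory holds the data of a min-plus square. -/
structure Holds (P : MinPlus) (σ : Mem) : Prop where
  side : σ.reg .side = P.side
  len : σ.reg .len = P.len
  big : σ.reg .big = 2 ^ P.len
  pow : ∀ t ≤ P.len, σ.arr 3 t = 2 ^ t
  val : ∀ i < P.dim, ∀ j < P.dim,
    σ.arr 2 ((i * P.dim + j : ℕ) : ℤ) + Expr.shift.eval σ = P.val i j

theorem Frame.eval_shift {σ σ' : Mem} (h : Frame σ σ') :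
    Expr.shift.eval σ' = Expr.shift.eval σ := by
  simp [Expr.shift, Expr.top, h.reg]

theorem Holds.frame {P : MinPlus} {σ σ' : Mem} (h : Holds P σ) (hf : Frame σ σ') : Holds P σ' := by
  refine ⟨?_, ?_, ?_, ?_, ?_⟩
  · rw [hf.reg _ (by decide) (by decide), h.side]
  · rw [hf.reg _ (by decide) (by decide), h.len]
  · rw [hf.reg _ (by decide) (by decide), h.big]
  · rw [hf.arr 3 (by norm_num)]; exact h.pow
  · rw [hf.arr 2 (by norm_num), hf.eval_shift]; exact h.val

namespace Holds

variable {P : MinPlus} {σ : Mem} (h : Holds P σ)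

include h

theorem letters : Expr.letters.eval σ = P.letters := by
  simp [Expr.letters, h.side, MinPlus.letters]

theorem side2 : Expr.side2.eval σ = P.side2 := by simp [Expr.side2, h.side, MinPlus.side2]

theorem dim : Expr.dim.eval σ = P.dim := by simp [Expr.dim, h.side, MinPlus.dim]

theorem dim2 : Expr.dim2.eval σ = P.dim2 := by simp [Expr.dim2, h.dim, MinPlus.dim2]

theorem prods : Expr.prods.eval σ = P.prods := by simp [Expr.prods, h.side2, MinPlus.prods]

theorem entries : Expr.entries.eval σ = P.entries := by
  simp [Expr.entries, h.dim2, MinPlus.entries]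

variable {e : Expr} {n : ℕ} (he : e.eval σ = n)

include he

theorem fac : (Expr.fac e).eval σ = P.fac n := by simp [Expr.fac, h.dim2, he, MinPlus.fac]

theorem row : (Expr.row e).eval σ = P.row n := by simp [Expr.row, h.dim, h.dim2, he, MinPlus.row]

theorem col : (Expr.col e).eval σ = P.col n := by simp [Expr.col, h.dim, h.dim2, he, MinPlus.col]

/-- The matrix is kept unshifted in array `2` and the shift is added on reading. Both factors use
the same matrix, so the index is reduced modulo `dim2`. -/
theorem value : (Expr.value e).eval σ = P.value n := by
  rw [MinPlus.value, ← h.val _ (row_lt n) _ (col_lt n), MinPlus.row, MinPlus.col, mul_comm,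
    Nat.div_add_mod]
  simp [Expr.value, h.dim2, he]

theorem first : (Expr.first e).eval σ = P.first n := by
  simp [Expr.first, h.fac he, h.row he, h.side, MinPlus.first]

theorem last : (Expr.last e).eval σ = P.last n := by
  simp [Expr.last, h.fac he, h.col he, h.side, MinPlus.last]

theorem block : (Expr.block e).eval σ = P.block n := by
  simp [Expr.block, h.fac he, h.row he, h.col he, h.side, h.side2, h.prods, MinPlus.block]

omit h in
theorem letter : (Expr.letter e).eval σ = P.code (letter n) := by simp [Expr.letter, he, code]

theorem power : (Expr.power e).eval σ = P.code (power n) := by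
  simp [Expr.power, he, code, h.letters]

theorem prod : (Expr.prod e).eval σ = P.code (prod n) := by
  simp [Expr.prod, he, code, h.letters, h.len]

theorem factor : (Expr.factor e).eval σ = P.code (factor n) := by
  simp [Expr.factor, he, code, h.letters, h.len, h.prods]

theorem chain : (Expr.chain e).eval σ = P.code (chain n) := by
  simp [Expr.chain, he, code, h.letters, h.len, h.prods]

end Holds

/-- The code of the `k`-th symbol on a right-hand side. -/
def rhsCode (P : MinPlus) (γ : RHS) (k : ℕ) : ℤ :=
  (γ[k]?).elim 0 fun | .nonterminal v => P.code v + 1 | .terminal a => -(a + 1)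

/-- Expressions for a family of productions: the number of its members, the left-hand side and the
codes of the right-hand side. -/
structure Family where
  num : Expr
  lhs : Expr
  rhs₀ : Expr
  rhs₁ : Expr

namespace Expr

/-- The families of productions. -/
def familyList : List Family :=
  let x : Expr := Var.ctr
  [⟨1, 0, 0, 0⟩,
   ⟨1, 1, 2, 2⟩,
   ⟨1, power 0, 0 - (letters + 1), 0⟩,
   ⟨letters, letter x, 0 - (x + 1), 0⟩,
   ⟨letters, 0, letter x + 1, 1⟩,
   ⟨letters, 1, letter x + 1, power (Var.len + 2) + 1⟩,
   ⟨Var.len + 2, power (x + 1), power x + 1, power x + 1⟩,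
   ⟨prods, 0, prod x + 1, 1⟩,
   ⟨prods * side2, prod (x % prods), factor (x % prods / side2 * side2 + x / prods) + 1,
      factor (prods + x / prods * side2 + x % prods % side2) + 1⟩,
   ⟨entries, factor (block x), chain (entries * Var.len + x) + 1, letter (last x) + 1⟩,
   ⟨entries, chain x, letter (first x) + 1, 2⟩,
   ⟨entries * Var.len, chain (x + entries), chain x + 1,
      power (x / entries + value (x % entries) / .load 3 (x / entries) % 2) + 1⟩]

end Expr

/-- The expressions describe the family of productions. -/
def Family.Describes (P : MinPlus) (F : Family) (f : ℕ × (ℕ → MPSymbol × RHS)) : Prop :=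
  ∀ σ : Mem, Holds P σ → F.num.eval σ = f.1 ∧ ∀ x < f.1, σ.reg .ctr = x →
    F.lhs.eval σ = P.code (f.2 x).1 ∧ F.rhs₀.eval σ = rhsCode P (f.2 x).2 0 ∧
    F.rhs₁.eval σ = rhsCode P (f.2 x).2 1

/-- Nonterminals are coded by their number plus one: on right-hand sides the constants 1 and 2 stand
for `start` and `mid`, and 0 for a missing symbol. The power of two used to extract a bit comes from
the table in array `3`. -/
theorem familyList_describes (P : MinPlus) :
    List.Forall₂ (Family.Describes P) Expr.familyList P.families := by
  unfold Expr.familyList families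
  refine .cons ?_ (.cons ?_ (.cons ?_ (.cons ?_ (.cons ?_ (.cons ?_ (.cons ?_ (.cons ?_ (.cons ?_
    (.cons ?_ (.cons ?_ (.cons ?_ .nil))))))))))) <;>
    intro σ h <;>
    refine ⟨by simp [h.letters, h.len, h.prods, h.side2, h.entries], fun x hx hc => ?_⟩ <;>
    have hc' : (Expr.var .ctr).eval σ = x := hc
  · exact ⟨rfl, rfl, rfl⟩
  · exact ⟨rfl, rfl, rfl⟩
  · exact ⟨h.power (n := 0) rfl, by simp [rhsCode, h.letters], rfl⟩
  · exact ⟨Holds.letter hc', by simp [rhsCode, hc], rfl⟩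
  · exact ⟨rfl, by simp [rhsCode, Holds.letter (P := P) hc'], rfl⟩
  · exact ⟨rfl, by simp [rhsCode, Holds.letter (P := P) hc'], by
      simp [rhsCode, h.power (e := Var.len + 2) (n := P.len + 2) (by simp [h.len])]⟩
  · exact ⟨h.power (by simp [hc]), by simp [rhsCode, h.power hc'], by
      simp [rhsCode, h.power hc']⟩
  · exact ⟨rfl, by simp [rhsCode, h.prod hc'], rfl⟩
  · refine ⟨h.prod (by simp [hc, h.prods]), ?_, ?_⟩
    · rw [Expr.eval_add, h.factor (n := x % P.prods / P.side2 * P.side2 + x / P.prods)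
        (by simp [hc, h.prods, h.side2])]
      rfl
    · rw [Expr.eval_add, h.factor (n := P.prods + x / P.prods * P.side2 + x % P.prods % P.side2)
        (by simp [hc, h.prods, h.side2])]
      rfl
  · refine ⟨h.factor (h.block hc'), ?_, ?_⟩
    · rw [Expr.eval_add, h.chain (n := P.entries * P.len + x) (by simp [hc, h.entries, h.len])]
      rfl
    · rw [Expr.eval_add, Holds.letter (h.last hc')]
      rfl
  · refine ⟨h.chain hc', ?_, rfl⟩
    rw [Expr.eval_add, Holds.letter (h.first hc')]
    rfl
  · refine ⟨h.chain (by simp [hc, h.entries]), ?_, ?_⟩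
    · rw [Expr.eval_add, h.chain hc']
      rfl
    · have ht : x / P.entries ≤ P.len := (Nat.div_lt_of_lt_mul hx).le
      have hv := h.value (e := Var.ctr % Expr.entries) (n := x % P.entries)
        (by simp [hc, h.entries])
      rw [Expr.eval_add, h.power (n := x / P.entries +
        P.value (x % P.entries) / 2 ^ (x / P.entries) % 2)]
      · rfl
      · have hp := h.pow _ ht
        push_cast at hp
        simp [hv, h.entries, hc, hp]

/-- The simulated machine holds a list of productions. -/
structure Enc (P : MinPlus) (L : List (MPSymbol × RHS)) (σ : Mem) : Prop where
  count : σ.reg .count = L.length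
  lhs : ∀ k, σ.view.arr 0 k =
    if k < 0 then 0 else (L[k.toNat]?).elim 0 fun r => (P.code r.1 : ℤ)
  rhs : ∀ k, σ.view.arr 1 k =
    if k < 0 then 0 else (L[k.toNat / 2]?).elim 0 fun r => rhsCode P r.2 (k.toNat % 2)

/-- Append a production to the list. -/
def Family.emit (F : Family) : Stmt :=
  .seq (.simSetArr 0 Var.count F.lhs) (.seq (.simSetArr 1 (2 * Var.count) F.rhs₀)
    (.seq (.simSetArr 1 (2 * Var.count + 1) F.rhs₁) (.assign .count (Var.count + 1))))

/-- Append a family to the list. -/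
def Family.emitAll (F : Family) : Stmt := .for .ctr F.num F.emit

/-- Write all productions. -/
def emitFamilies : List Family → Stmt
  | [] => .skip
  | F :: l => .seq F.emitAll (emitFamilies l)

/-- The parts of the simulated machine that do not hold productions are unchanged. -/
def SameRest (σ σ' : Mem) : Prop :=
  σ'.view.reg = σ.view.reg ∧ ∀ a, 2 ≤ a → σ'.view.arr a = σ.view.arr a

theorem getElem?_concat_ne {α : Type*} (L : List α) (r : α) {k : ℕ} (h : k ≠ L.length) :
    (L ++ [r])[k]? = L[k]? := by
  rcases lt_or_gt_of_ne h with h | h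
  · exact List.getElem?_append_left h
  · rw [List.getElem?_eq_none (by simp; omega), List.getElem?_eq_none (by omega)]

theorem Holds.abs_rhsCode_le {P : MinPlus} {M : ℕ} (hM : P.nonterminals ≤ M)
    {r : MPSymbol × RHS} (hr : r ∈ P.productions) (k : ℕ) : |rhsCode P r.2 k| ≤ M := by
  unfold rhsCode
  cases hs : r.2[k]? with
  | none => simp
  | some s =>
    have hv := (productions_valid hr).2 s (List.mem_of_getElem? hs)
    cases s with
    | terminal a =>
      have h1 : a ≤ P.letters := hv
      have h2 : P.letters + 1 ≤ P.nonterminals := by unfold nonterminals; omega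
      simp only [Option.elim, abs_neg]
      rw [abs_of_nonneg (by positivity)]
      exact_mod_cast (by omega)
    | nonterminal v =>
      have h1 := code_lt hv
      simp only [Option.elim]
      rw [abs_of_nonneg (by positivity)]
      exact_mod_cast (by omega)

theorem Family.emit_runs {P : MinPlus} {M : ℕ} (hM : P.nonterminals ≤ M) {F : Family}
    {f : ℕ × (ℕ → MPSymbol × RHS)} (hF : F.Describes P f) {L : List (MPSymbol × RHS)} {σ : Mem}
    (hσ : σ.SimOK) (hH : Holds P σ) (hL : Enc P L σ) (hLM : L.length + 1 ≤ M) {x : ℕ}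
    (hx : x < f.1) (hc : σ.reg .ctr = x) (hr : f.2 x ∈ P.productions) :
    Runs M F.emit σ 4 fun σ' => Frame σ σ' ∧ σ'.reg .ctr = x ∧ SameRest σ σ' ∧
      Enc P (L ++ [f.2 x]) σ' := by
  have hv := (productions_valid hr).1
  have hco := code_lt hv
  refine Runs.mono (Runs.seq (Runs.simSetArr hσ 0 ?_ fun σ₁ f₁ v₁ => Runs.seq
    (Runs.simSetArr (f₁.simOK hσ) 1 ?_ fun σ₂ f₂ v₂ => Runs.seq
    (Runs.simSetArr (f₂.simOK (f₁.simOK hσ)) 1 ?_ fun σ₃ f₃ v₃ =>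
    Runs.assign ?_ ?_)))) (by norm_num : 1 + (1 + (1 + 1)) ≤ 4) (fun _ h => h)
  · rw [((hF σ hH).2 x hx hc).1, Nat.abs_cast]; exact_mod_cast (by omega)
  · rw [((hF σ₁ (hH.frame f₁.frame)).2 x hx (by rw [f₁.reg, hc])).2.1]
    exact Holds.abs_rhsCode_le hM hr 0
  · rw [((hF σ₂ (hH.frame (f₁.frame.trans f₂.frame))).2 x hx (by rw [f₂.reg, f₁.reg, hc])).2.2]
    exact Holds.abs_rhsCode_le hM hr 1
  · have : (Var.count + 1 : Expr).eval σ₃ = ((L.length + 1 : ℕ) : ℤ) := by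
      simp [f₃.reg, f₂.reg, f₁.reg, hL.count]
    rw [this, Nat.abs_cast]; exact_mod_cast hLM
  · have hf := f₁.frame.trans (f₂.frame.trans f₃.frame)
    rw [((hF σ₂ (hH.frame (f₁.frame.trans f₂.frame))).2 x hx
      (by rw [f₂.reg, f₁.reg, hc])).2.2] at v₃
    rw [((hF σ₁ (hH.frame f₁.frame)).2 x hx (by rw [f₁.reg, hc])).2.1] at v₂
    rw [((hF σ hH).2 x hx hc).1] at v₁
    have c₃ : (Var.count : Expr).eval σ = L.length := hL.count
    have c₂ : (2 * Var.count : Expr).eval σ₁ = ((2 * L.length : ℕ) : ℤ) := by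
      simp [f₁.reg, hL.count]
    have c₁ : (2 * Var.count + 1 : Expr).eval σ₂ = ((2 * L.length + 1 : ℕ) : ℤ) := by
      simp [f₂.reg, f₁.reg, hL.count]
    rw [c₁] at v₃
    rw [c₂] at v₂
    rw [c₃] at v₁
    have hview : (σ₃.set .count ((Var.count + 1 : Expr).eval σ₃)).view = _ :=
      (view_set (.inr rfl) _).trans (v₃.trans (by rw [v₂, v₁]))
    refine ⟨hf.trans (.set (.inr rfl) _), ?_, ?_, ?_⟩
    · rw [Mem.set_reg, if_neg (by decide), f₃.reg, f₂.reg, f₁.reg, hc]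
    · refine ⟨by rw [hview]; rfl, fun a ha => ?_⟩
      rw [hview]
      simp only [RAM.State.setArr]
      rw [Function.update_of_ne (by omega), Function.update_of_ne (by omega),
        Function.update_of_ne (by omega)]
    · refine ⟨?_, fun k => ?_, fun k => ?_⟩
      · rw [Mem.set_reg, if_pos rfl]; simp [f₃.reg, f₂.reg, f₁.reg, hL.count]
      · rw [hview]
        simp only [RAM.State.setArr]
        rw [Function.update_of_ne (by norm_num), Function.update_of_ne (by norm_num),
          Function.update_self, Function.update_apply]
        by_cases hk : k = L.length
        · subst hk; simp
        · rw [if_neg hk, hL.lhs k]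
          split_ifs with h0
          · rfl
          · rw [getElem?_concat_ne _ _ (by omega)]
      · rw [hview]
        simp only [RAM.State.setArr]
        rw [Function.update_self, Function.update_apply, Function.update_self,
          Function.update_apply, Function.update_of_ne (by norm_num)]
        by_cases hk : k = ((2 * L.length + 1 : ℕ) : ℤ)
        · subst hk
          rw [if_pos rfl, if_neg (by omega), Int.toNat_natCast,
            show (2 * L.length + 1) / 2 = L.length by omega,
            show (2 * L.length + 1) % 2 = 1 by omega]
          simp
        · rw [if_neg hk]
          by_cases hk' : k = ((2 * L.length : ℕ) : ℤ)
          · subst hk'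
            rw [if_pos rfl, if_neg (by omega), Int.toNat_natCast,
              show (2 * L.length) / 2 = L.length by omega,
              show (2 * L.length) % 2 = 0 by omega]
            simp
          · rw [if_neg hk', hL.rhs k]
            split_ifs with h0
            · rfl
            · rw [getElem?_concat_ne _ _ (by omega)]

theorem Enc.set_ctr {P : MinPlus} {L : List (MPSymbol × RHS)} {σ : Mem} (h : Enc P L σ) (v : ℤ) :
    Enc P L (σ.set .ctr v) :=
  ⟨by rw [Mem.set_reg, if_neg (by decide), h.count], by rw [view_set (.inl rfl)]; exact h.lhs,
    by rw [view_set (.inl rfl)]; exact h.rhs⟩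

theorem SameRest.trans {σ σ' σ'' : Mem} (h : SameRest σ σ') (h' : SameRest σ' σ'') :
    SameRest σ σ'' := ⟨h'.1.trans h.1, fun a ha => (h'.2 a ha).trans (h.2 a ha)⟩

theorem SameRest.set_ctr (σ : Mem) (v : ℤ) : SameRest σ (σ.set .ctr v) := by
  rw [SameRest, view_set (.inl rfl)]; exact ⟨rfl, fun _ _ => rfl⟩

theorem Family.emitAll_runs {P : MinPlus} {M : ℕ} (hM : P.nonterminals ≤ M) {F : Family}
    {f : ℕ × (ℕ → MPSymbol × RHS)} (hF : F.Describes P f) {L : List (MPSymbol × RHS)} {σ : Mem}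
    (hσ : σ.SimOK) (hH : Holds P σ) (hL : Enc P L σ) (hLM : L.length + f.1 ≤ M)
    (hr : ∀ x < f.1, f.2 x ∈ P.productions) :
    Runs M F.emitAll σ (f.1 * 6 + 2) fun σ' => Frame σ σ' ∧ SameRest σ σ' ∧
      Enc P (L ++ (List.range f.1).map f.2) σ' := by
  refine (Runs.for (M := M) (p := F.emit) (T := 4) f.1
    (fun i σ' => σ'.reg .ctr = i ∧ i ≤ f.1 ∧ Frame σ σ' ∧ SameRest σ σ' ∧
      Enc P (L ++ (List.range i).map f.2) σ') (fun i σ h => h.1)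
    (fun i σ' h => (hF σ' (hH.frame h.2.2.1)).1) (by omega) ?_ ?_).mono le_rfl
    (fun σ' h => h.2.2)
  · refine ⟨by rw [Mem.set_reg, if_pos rfl]; rfl, Nat.zero_le _, .set (.inl rfl) _,
      .set_ctr σ _, ?_⟩
    simpa using hL.set_ctr 0
  · rintro i hi σ' ⟨hc, -, hf, hs, hE⟩
    refine (Family.emit_runs hM hF (hf.simOK hσ) (hH.frame hf) hE (by simp; omega) hi hc
      (hr i hi)).mono le_rfl ?_
    rintro σ'' ⟨hf', hc', hs', hE'⟩
    refine ⟨hc', by rw [Mem.set_reg, if_pos rfl], hi, (hf.trans hf').trans (.set (.inl rfl) _),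
      (hs.trans hs').trans (.set_ctr _ _), ?_⟩
    rw [List.range_succ, List.map_append, List.map_singleton, ← List.append_assoc]
    exact hE'.set_ctr _

/-- The members of families of productions. -/
def members (l : List (ℕ × (ℕ → MPSymbol × RHS))) : List (MPSymbol × RHS) :=
  l.flatMap fun f => (List.range f.1).map f.2

theorem emitFamilies_runs {P : MinPlus} {M : ℕ} (hM : P.nonterminals ≤ M) {l : List Family}
    {l' : List (ℕ × (ℕ → MPSymbol × RHS))} (hl : List.Forall₂ (Family.Describes P) l l')
    (hsub : ∀ f ∈ l', ∀ x < f.1, f.2 x ∈ P.productions) {L : List (MPSymbol × RHS)} {σ : Mem}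
    (hσ : σ.SimOK) (hH : Holds P σ) (hL : Enc P L σ)
    (hLM : (L ++ members l').length ≤ M) :
    Runs M (emitFamilies l) σ
      ((members l').length * 6 + 2 * l.length + 1)
      fun σ' => Frame σ σ' ∧ SameRest σ σ' ∧
        Enc P (L ++ members l') σ' := by
  induction hl generalizing L σ with
  | nil =>
    exact ⟨σ, 1, .skip σ, by simp, .refl _, ⟨rfl, fun _ _ => rfl⟩, by simpa [members] using hL⟩
  | @cons F f l l' hF _ ih =>
    have hcons : members (f :: l') = (List.range f.1).map f.2 ++ members l' := List.flatMap_cons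
    rw [hcons] at hLM ⊢
    simp only [List.length_append, List.length_map, List.length_range] at hLM
    refine (Runs.seq ((Family.emitAll_runs hM hF hσ hH hL (by omega)
      (hsub f (List.mem_cons_self ..))).mono le_rfl ?_)).mono
      (T := f.1 * 6 + 2 + ((members l').length * 6 + 2 * l.length + 1))
      (T' := ((List.range f.1).map f.2 ++ members l').length * 6 + 2 * (F :: l).length + 1)
      (by simp only [List.length_append, List.length_map, List.length_range, List.length_cons]
          omega) (fun _ h => h)
    rintro σ₁ ⟨f₁, s₁, e₁⟩
    refine (ih (fun f hf => hsub f (List.mem_cons_of_mem _ hf)) (f₁.simOK hσ) (hH.frame f₁) e₁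
      ?_).mono le_rfl ?_
    · simp only [List.length_append, List.length_map, List.length_range]; omega
    rintro σ₂ ⟨f₂, s₂, e₂⟩
    rw [← List.append_assoc]
    exact ⟨f₁.trans f₂, s₁.trans s₂, e₂⟩

end Imp

/-! ## One min-plus square -/

namespace Imp

open LanEd MinPlus MPSymbol

theorem Runs.bdd {M : ℕ} {p : Stmt} {σ : Mem} {T : ℕ} {Q : Mem → Prop} (h : Runs M p σ T Q)
    (hσ : σ.Bdd M) : Runs M p σ T fun σ' => Q σ' ∧ σ'.Bdd M := by
  obtain ⟨σ', t, e, ht, hQ⟩ := h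
  exact ⟨σ', t, e, ht, hQ, e.bdd hσ⟩

theorem symbolCode_symbolFin {P : MinPlus} {s : Symbol ℕ MPSymbol} (h : P.ValidSymbol s) :
    symbolCode (P.symbolFin s) =
      match s with | .nonterminal v => (P.code v + 1 : ℤ) | .terminal a => -(a + 1) := by
  cases s with
  | nonterminal v => simp only [symbolFin, symbolCode]; rw [Nat.mod_eq_of_lt (code_lt h)]
  | terminal a =>
    simp only [symbolFin, symbolCode, Fin.val_ofNat]
    rw [Nat.mod_eq_of_lt (Nat.lt_succ_of_le h)]

/-- The oracle has to be started in exactly the prescribed memory, with zeros everywhere else.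
Register `2` needs no write, since the start symbol has number 0. -/
theorem view_eq_inputState {P : MinPlus} {σ : Mem} (hE : Enc P P.productions σ)
    (hreg : ∀ x, σ.view.reg x = match x with
      | 0 => (P.nonterminals : ℤ)
      | 1 => P.letters + 1
      | 3 => P.productions.length
      | 4 => P.letters
      | _ => 0)
    (h2 : ∀ k, σ.view.arr 2 k = if 0 ≤ k ∧ k < P.letters then k else 0)
    (h3 : ∀ a k, 3 ≤ a → σ.view.arr a k = 0) : σ.view = inputState P.grammar P.word := by
  have hlen : P.grammar.rules.length = P.productions.length := List.length_map _
  refine RAM.State.mk.injEq .. ▸ ⟨?_, ?_⟩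
  · ext x
    rw [show σ.arr 4 (x * σ.reg .rounds + σ.reg .rnd) = _ from hreg x]
    match x with
    | 0 => rfl
    | 1 => exact (Nat.cast_succ _).symm
    | 2 => rfl
    | 3 => exact congrArg Nat.cast hlen.symm
    | 4 => exact congrArg Nat.cast word_length.symm
    | _ + 5 => rfl
  · ext a k
    change σ.view.arr a k = _
    match a with
    | 0 =>
      rw [hE.lhs]
      simp only
      split_ifs with hk
      · rfl
      · change _ = ((P.productions.map P.toRule)[k.toNat]?).elim 0 _
        rw [List.getElem?_map]
        cases h : P.productions[k.toNat]? with
        | none => rfl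
        | some r =>
          have hv := (productions_valid (List.mem_of_getElem? h)).1
          exact congrArg Nat.cast (Nat.mod_eq_of_lt (code_lt hv)).symm
    | 1 =>
      rw [hE.rhs]
      simp only
      split_ifs with hk
      · rfl
      · change _ = ((P.productions.map P.toRule)[k.toNat / 2]?).elim 0 _
        rw [List.getElem?_map]
        cases h : P.productions[k.toNat / 2]? with
        | none => rfl
        | some r =>
          have hv := (productions_valid (List.mem_of_getElem? h)).2
          change rhsCode P r.2 (k.toNat % 2) = ((r.2.map P.symbolFin)[k.toNat % 2]?).elim 0 _
          rw [List.getElem?_map, rhsCode]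
          cases hs : r.2[k.toNat % 2]? with
          | none => rfl
          | some s =>
            simp only [Option.map_some, Option.elim]
            have hsym := (symbolCode_symbolFin (hv s (List.mem_of_getElem? hs))).symm
            cases s <;> exact hsym
    | 2 =>
      rw [h2]
      simp only
      by_cases hk : k < 0
      · rw [if_pos hk, if_neg (by omega)]
      · rw [if_neg hk, word, List.getElem?_map]
        by_cases hk' : k < P.letters
        · rw [if_pos (by omega), List.getElem?_range (by omega)]
          simp only [Option.map_some, Option.elim]
          rw [letterG_val (by omega)]; omega
        · rw [if_neg (by omega), List.getElem?_eq_none (by simp; omega)]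
          rfl
    | a + 3 =>
      rw [h3 _ _ (by omega)]
      simp only; split_ifs <;> rfl

namespace Expr

def nonterminals : Expr :=
  2 + letters + (Var.len + 3) + 3 * prods + entries * (Var.len + 1)

/-- An entry of the product, from the answer of the oracle. -/
def answer : Expr :=
  .simReg 0 - (4 * Var.big * (2 * Var.side + col Var.ctr % Var.side - row Var.ctr % Var.side) +
    2 * (Var.big - 1)) - 2 * shift

end Expr

/-- Write the input of the oracle into the memory of the simulated machine. -/
def loadInput : Stmt :=
  .seq (.assign .count 0) (.seq (emitFamilies Expr.familyList)
    (.seq (.for .ctr Expr.letters (.simSetArr 2 Var.ctr Var.ctr))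
    (.seq (.simSetReg 0 Expr.nonterminals) (.seq (.simSetReg 1 (Expr.letters + 1))
    (.seq (.simSetReg 3 Var.count) (.simSetReg 4 Expr.letters))))))

/-- Put the query for an entry of the product into the memory of the simulated machine. -/
def askEntry : Stmt :=
  .seq (.simSetReg 0 (Expr.prod
      (Expr.row Var.ctr / Var.side * Expr.side2 + Expr.col Var.ctr / Var.side)))
    (.seq (.simSetReg 1 (Expr.row Var.ctr % Var.side + 1))
    (.simSetReg 2 (2 * Var.side + 4 + Expr.col Var.ctr % Var.side)))

/-- Ask for an entry of the product, and store it. -/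
def queryEntry (Q : RAM.Prog) : Stmt :=
  .seq askEntry (.seq (simulate Q) (.store 2 Var.ctr Expr.answer))

/-- Ask for all entries of the product. -/
def queryAll (Q : RAM.Prog) : Stmt := .for .ctr Expr.dim2 (queryEntry Q)

theorem letters_lt (P : MinPlus) : P.letters + 1 < P.nonterminals := by
  unfold nonterminals; omega

theorem loadLetters_runs {P : MinPlus} {M : ℕ} (hM : P.nonterminals ≤ M) {σ : Mem}
    (hσ : σ.SimOK) (hH : Holds P σ) {L : List (MPSymbol × RHS)} (hE : Enc P L σ)
    (h2 : ∀ k, σ.view.arr 2 k = 0) :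
    Runs M (.for .ctr Expr.letters (.simSetArr 2 Var.ctr Var.ctr)) σ (P.letters * 3 + 2)
      fun σ' => Frame σ σ' ∧ Enc P L σ' ∧ σ'.view.reg = σ.view.reg ∧
        (∀ k, σ'.view.arr 2 k = if 0 ≤ k ∧ k < P.letters then k else 0) ∧
        ∀ a, 3 ≤ a → σ'.view.arr a = σ.view.arr a := by
  have hl := letters_lt P
  refine (Runs.for (M := M) (T := 1) P.letters
    (fun i σ' => σ'.reg .ctr = i ∧ Frame σ σ' ∧ Enc P L σ' ∧ σ'.view.reg = σ.view.reg ∧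
        (∀ k, σ'.view.arr 2 k = if 0 ≤ k ∧ k < i then k else 0) ∧
        ∀ a, 3 ≤ a → σ'.view.arr a = σ.view.arr a)
    (fun i σ h => h.1) (fun i σ' h => (hH.frame h.2.1).letters) (by omega) ?_ ?_).mono le_rfl
    (fun σ' h => h.2)
  · refine ⟨by rw [Mem.set_reg, if_pos rfl]; rfl, .set (.inl rfl) _, hE.set_ctr _, ?_⟩
    rw [view_set (.inl rfl)]
    refine ⟨rfl, fun k => ?_, fun _ _ => rfl⟩
    rw [h2, if_neg (by push_cast; omega)]
  · rintro i hi σ' ⟨hc, hf, hE', hr, ha, h3⟩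
    have hc' : (Expr.var .ctr).eval σ' = i := hc
    refine Runs.simSetArr (hf.simOK hσ) 2 ?_ ?_
    · rw [hc', Nat.abs_cast]; exact_mod_cast (by omega)
    · intro σ'' f v
      rw [hc'] at v
      refine ⟨by rw [f.reg, hc], by rw [Mem.set_reg, if_pos rfl],
        (hf.trans f.frame).trans (.set (.inl rfl) _), Enc.set_ctr ⟨?_, ?_, ?_⟩ _, ?_⟩
      · rw [f.reg, hE'.count]
      · rw [v]; simp only [RAM.State.setArr]
        rw [Function.update_of_ne (by norm_num)]; exact hE'.lhs
      · rw [v]; simp only [RAM.State.setArr]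
        rw [Function.update_of_ne (by norm_num)]; exact hE'.rhs
      · rw [view_set (.inl rfl), v]
        refine ⟨hr, fun k => ?_, fun a h => ?_⟩
        · simp only [RAM.State.setArr]
          rw [Function.update_self, Function.update_apply, ha]
          split_ifs <;> push_cast at * <;> omega
        · simp only [RAM.State.setArr]
          rw [Function.update_of_ne (by omega), h3 a h]

theorem loadInput_runs {P : MinPlus} {M : ℕ} (hM : P.nonterminals ≤ M)
    (hM' : P.productions.length ≤ M) {σ : Mem} (hσ : σ.SimOK) (hH : Holds P σ)
    (h0 : σ.view = ⟨fun _ => 0, fun _ _ => 0⟩) :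
    Runs M loadInput σ (P.productions.length * 6 + P.letters * 3 + 32)
      fun σ' => Frame σ σ' ∧ σ'.view = inputState P.grammar P.word := by
  have hl := letters_lt P
  refine Runs.mono (T := 1 + ((members P.families).length * 6 + 2 * Expr.familyList.length + 1 +
    (P.letters * 3 + 2 + (1 + (1 + (1 + 1)))))) (Runs.seq (Runs.assign (by simp) ?_)) ?_
    (fun _ h => h)
  · have f₀ : Frame σ (σ.set .count 0) := .set (.inr rfl) 0
    have e₀ : Enc P [] (σ.set .count 0) := by
      refine ⟨by rw [Mem.set_reg, if_pos rfl]; rfl, ?_, ?_⟩ <;> rw [view_set (.inr rfl), h0] <;>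
        simp
    have hview : (σ.set .count 0).view = ⟨fun _ => 0, fun _ _ => 0⟩ :=
      (view_set (.inr rfl) 0).trans h0
    refine Runs.seq ((emitFamilies_runs hM (familyList_describes P) (fun f hf x hx =>
      P.mem_productions.2 ⟨f, hf, x, hx, rfl⟩) (f₀.simOK hσ) (hH.frame f₀) e₀
      hM').mono le_rfl ?_)
    rintro σ₁ ⟨f₁, ⟨r₁, a₁⟩, e₁⟩
    replace f₁ := f₀.trans f₁
    replace e₁ : Enc P P.productions σ₁ := e₁
    rw [hview] at r₁ a₁
    refine Runs.seq ((loadLetters_runs hM (f₁.simOK hσ) (hH.frame f₁) e₁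
      (fun k => by rw [a₁ 2 le_rfl])).mono le_rfl ?_)
    rintro σ₂ ⟨f₂, e₂, r₂, h₂, a₂⟩
    replace f₂ := f₁.trans f₂
    have hH₂ := hH.frame f₂
    have hnt : ∀ {σ'}, Holds P σ' → Expr.nonterminals.eval σ' = P.nonterminals := fun h => by
      simp [Expr.nonterminals, h.letters, h.len, h.prods, h.entries, nonterminals]
    refine Runs.seq (Runs.simSetReg (f₂.simOK hσ) 0 ?_ fun σ₃ f₃ v₃ => Runs.seq
      (Runs.simSetReg (f₃.simOK (f₂.simOK hσ)) 1 ?_ fun σ₄ f₄ v₄ => Runs.seq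
      (Runs.simSetReg (f₄.simOK (f₃.simOK (f₂.simOK hσ))) 3 ?_ fun σ₅ f₅ v₅ =>
      (Runs.simSetReg (f₅.simOK (f₄.simOK (f₃.simOK (f₂.simOK hσ)))) 4 ?_ fun σ₆ f₆ v₆ => ?_))))
    · rw [hnt hH₂, Nat.abs_cast]; exact_mod_cast hM
    · rw [Expr.eval_add, (hH₂.frame f₃.frame).letters, Expr.eval_one, ← Nat.cast_succ, Nat.abs_cast]
      exact_mod_cast (by omega)
    · rw [Expr.eval_var, f₄.reg, f₃.reg, e₂.count, Nat.abs_cast]; exact_mod_cast hM'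
    · rw [(hH₂.frame (f₃.frame.trans (f₄.frame.trans f₅.frame))).letters, Nat.abs_cast]
      exact_mod_cast (by omega)
    · rw [hnt hH₂] at v₃
      rw [Expr.eval_add, (hH₂.frame f₃.frame).letters, Expr.eval_one, v₃] at v₄
      rw [Expr.eval_var, f₄.reg, f₃.reg, e₂.count, v₄] at v₅
      rw [(hH₂.frame (f₃.frame.trans (f₄.frame.trans f₅.frame))).letters, v₅] at v₆
      refine ⟨f₂.trans (f₃.frame.trans (f₄.frame.trans (f₅.frame.trans f₆.frame))), ?_⟩
      refine view_eq_inputState ⟨?_, ?_, ?_⟩ ?_ ?_ ?_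
      · rw [f₆.reg, f₅.reg, f₄.reg, f₃.reg, e₂.count]
      · rw [v₆]; exact e₂.lhs
      · rw [v₆]; exact e₂.rhs
      · intro x
        rw [v₆]
        simp only [RAM.State.setReg, Function.update_apply, r₂, r₁]
        match x with
        | 0 | 1 | 2 | 3 | 4 => simp
        | x + 5 => simp
      · rw [v₆]; exact h₂
      · intro a k ha
        rw [v₆]
        change σ₂.view.arr a k = 0
        rw [a₂ a ha, a₁ a (by omega)]
  · have h1 : members P.families = P.productions := rfl
    have h2 : Expr.familyList.length = 12 := rfl
    rw [h1, h2]; omega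

/-- The memory `σ'` differs from `σ` only in the simulated machine, in two counters and in
array `2`. -/
structure MatFrame (σ σ' : Mem) : Prop where
  reg : ∀ x, x ≠ .ctr → x ≠ .count → σ'.reg x = σ.reg x
  arr : ∀ a < 4, a ≠ 2 → σ'.arr a = σ.arr a
  cell : ∀ (a : ℕ) (k : ℤ), 4 ≤ a → k % σ.reg .rounds ≠ σ.reg .rnd → σ'.arr a k = σ.arr a k

theorem Frame.mat {σ σ' : Mem} (h : Frame σ σ') : MatFrame σ σ' :=
  ⟨h.reg, fun a ha _ => h.arr a ha, fun a k _ => h.cell a k⟩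

theorem MatFrame.trans {σ σ' σ'' : Mem} (h : MatFrame σ σ') (h' : MatFrame σ' σ'') :
    MatFrame σ σ'' := by
  refine ⟨fun x h₁ h₂ => (h'.reg x h₁ h₂).trans (h.reg x h₁ h₂),
    fun a ha h₂ => (h'.arr a ha h₂).trans (h.arr a ha h₂),
    fun a k ha hk => (h'.cell a k ha ?_).trans (h.cell a k ha hk)⟩
  rwa [h.reg _ (by decide) (by decide), h.reg _ (by decide) (by decide)]

theorem MatFrame.setArr (σ : Mem) (k v : ℤ) : MatFrame σ (σ.setArr 2 k v) := by
  refine ⟨fun _ _ _ => rfl, fun a _ ha => ?_, fun a l ha _ => ?_⟩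
  · ext l; rw [Mem.setArr_arr, if_neg (by tauto)]
  · rw [Mem.setArr_arr, if_neg (by omega)]

theorem MatFrame.simOK {σ σ' : Mem} (h : MatFrame σ σ') (hσ : σ.SimOK) : σ'.SimOK := by
  unfold Mem.SimOK
  rw [h.reg _ (by decide) (by decide), h.reg _ (by decide) (by decide)]; exact hσ

theorem MatFrame.eval_shift {σ σ' : Mem} (h : MatFrame σ σ') :
    Expr.shift.eval σ' = Expr.shift.eval σ := by
  simp [Expr.shift, Expr.top, h.reg]

theorem view_setArr_two (σ : Mem) (k v : ℤ) : (σ.setArr 2 k v).view = σ.view := by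
  simp only [Mem.view, Mem.setArr_arr, Mem.setArr_reg, RAM.State.mk.injEq]
  constructor
  · ext y; rw [if_neg (by omega)]
  · ext b k; rw [if_neg (by omega)]

theorem simulate_runs {B M : ℕ} (hBM : B ≤ M) {p : RAM.Prog} {ν ν' : RAM.State} {t : ℕ}
    (h : RAM.Exec B p ν ν' t) {σ : Mem} (hσ : σ.Bdd M) (hs : σ.SimOK) (hν : σ.view = ν)
    {T : ℕ} (hT : t ≤ T) :
    Runs M (simulate p) σ T fun σ' => SimFrame σ σ' ∧ σ'.view = ν' := by
  obtain ⟨σ', e, f⟩ := simulate_exec hBM h σ hσ hs hν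
  exact ⟨σ', t, e, hT, f⟩

/-- The query program answers all queries. -/
def Answers (P : MinPlus) (B K : ℕ) (Q : RAM.Prog) (ν₀ : RAM.State) : Prop :=
  ∀ ν : RAM.State, Served B Q P.grammar.nt P.word.length ν₀ ν →
    ∀ (A : Fin P.grammar.nt) (i j : ℕ), 1 ≤ i → i ≤ j → j ≤ P.word.length →
      ∃ (ν' : RAM.State) (t : ℕ), RAM.Exec B Q (ask ν A i j) ν' t ∧ t ≤ K ∧
        ∀ l : ℕ, MCDerives P.grammar P.word A i j l → ν'.reg 0 = l

/-- `y` is an entry of the min-plus square of the matrix `E`. -/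
def IsSquareEntry (N : ℕ) (E : ℕ → ℕ → ℤ) (u v : ℕ) (y : ℤ) : Prop :=
  ∃ k < N, y = E u k + E k v ∧ ∀ k' < N, E u k + E k v ≤ E u k' + E k' v

/-- The matrix in array `2`. -/
def Mem.matrix (σ : Mem) (N : ℕ) (u v : ℕ) : ℤ := σ.arr 2 ((u * N + v : ℕ) : ℤ)

/-- The variables hold the parameters of a min-plus square. -/
structure HoldsParams (P : MinPlus) (h : ℤ) (σ : Mem) : Prop where
  side : σ.reg .side = P.side
  len : σ.reg .len = P.len
  big : σ.reg .big = 2 ^ P.len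
  shift : Expr.shift.eval σ = h

theorem HoldsParams.frame {P : MinPlus} {h : ℤ} {σ σ' : Mem} (hσ : HoldsParams P h σ)
    (hf : MatFrame σ σ') : HoldsParams P h σ' := by
  refine ⟨?_, ?_, ?_, ?_⟩
  · rw [hf.reg _ (by decide) (by decide), hσ.side]
  · rw [hf.reg _ (by decide) (by decide), hσ.len]
  · rw [hf.reg _ (by decide) (by decide), hσ.big]
  · rw [hf.eval_shift, hσ.shift]

theorem HoldsParams.row {P : MinPlus} {h : ℤ} {σ : Mem} (hσ : HoldsParams P h σ) {x : ℕ}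
    (hx : σ.reg .ctr = x) : (Expr.row Var.ctr).eval σ = P.row x := by
  simp [Expr.row, Expr.dim2, Expr.dim, hx, hσ.side, MinPlus.row, MinPlus.dim2, MinPlus.dim]

theorem HoldsParams.col {P : MinPlus} {h : ℤ} {σ : Mem} (hσ : HoldsParams P h σ) {x : ℕ}
    (hx : σ.reg .ctr = x) : (Expr.col Var.ctr).eval σ = P.col x := by
  simp [Expr.col, Expr.dim2, Expr.dim, hx, hσ.side, MinPlus.col, MinPlus.dim2, MinPlus.dim]

theorem askEntry_runs {P : MinPlus} {M : ℕ} (hM : P.nonterminals ≤ M) {h : ℤ} {σ : Mem}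
    (hs : σ.SimOK) (hp : HoldsParams P h σ) {x : ℕ} (hx : σ.reg .ctr = x) :
    Runs M askEntry σ 3 fun σ' => SimFrame σ σ' ∧ σ'.view = ask σ.view
      (P.code (prod (P.row x / P.side * P.side2 + P.col x / P.side)))
      (P.row x % P.side + 1) (2 * P.side + 4 + P.col x % P.side) := by
  have hl := letters_lt P
  have hn : P.letters = 3 * P.side + 3 := rfl
  have hi' := Nat.mod_lt (P.row x) P.side_pos
  have hj' := Nat.mod_lt (P.col x) P.side_pos
  have hco := code_lt (P := P) (v := prod (P.row x / P.side * P.side2 + P.col x / P.side))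
    (prod_lt (row_lt x) (col_lt x))
  have v₀ : ∀ {σ'}, HoldsParams P h σ' → σ'.reg .ctr = x →
      (Expr.prod (Expr.row Var.ctr / Var.side * Expr.side2 +
        Expr.col Var.ctr / Var.side)).eval σ' =
      P.code (prod (P.row x / P.side * P.side2 + P.col x / P.side)) := fun hp hx => by
    simp [Expr.prod, hp.row hx, hp.col hx, code, Expr.letters, hp.side, hp.len, MinPlus.letters,
      Expr.side2, MinPlus.side2]
  have v₁ : ∀ {σ'}, HoldsParams P h σ' → σ'.reg .ctr = x →
      (Expr.row Var.ctr % Var.side + 1).eval σ' = ((P.row x % P.side + 1 : ℕ) : ℤ) :=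
    fun hp hx => by simp [hp.row hx, hp.side]
  have v₂ : ∀ {σ'}, HoldsParams P h σ' → σ'.reg .ctr = x →
      (2 * Var.side + 4 + Expr.col Var.ctr % Var.side).eval σ' =
      ((2 * P.side + 4 + P.col x % P.side : ℕ) : ℤ) :=
    fun hp hx => by simp [hp.col hx, hp.side]
  have fr : ∀ {σ σ'}, SimFrame σ σ' → HoldsParams P h σ → HoldsParams P h σ' := fun f hp =>
    hp.frame f.frame.mat
  refine Runs.seq (Runs.simSetReg hs 0 ?_ fun σ₁ f₁ w₁ => Runs.seq (Runs.simSetReg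
    (f₁.simOK hs) 1 ?_ fun σ₂ f₂ w₂ => Runs.simSetReg (f₂.simOK (f₁.simOK hs)) 2 ?_
    fun σ₃ f₃ w₃ => ?_))
  · rw [v₀ hp hx, Nat.abs_cast]; exact_mod_cast (by omega)
  · rw [v₁ (fr f₁ hp) (by rw [f₁.reg, hx]), Nat.abs_cast]; exact_mod_cast (by omega)
  · rw [v₂ (fr f₂ (fr f₁ hp)) (by rw [f₂.reg, f₁.reg, hx]), Nat.abs_cast]
    exact_mod_cast (by omega)
  · rw [v₀ hp hx] at w₁
    rw [v₁ (fr f₁ hp) (by rw [f₁.reg, hx]), w₁] at w₂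
    rw [v₂ (fr f₂ (fr f₁ hp)) (by rw [f₂.reg, f₁.reg, hx]), w₂] at w₃
    exact ⟨f₁.trans (f₂.trans f₃), w₃⟩

/-- The expression inverts `score`, with `4 * big` as the price and `width - 4` written out. The
shift is removed twice because both summands contain it. -/
theorem eval_answer {P : MinPlus} {h : ℤ} {σ : Mem} (hp : HoldsParams P h σ) {x : ℕ}
    (hx : σ.reg .ctr = x) {d : ℕ} (hd : σ.view.reg 0 = P.score (P.row x) (P.col x) d) :
    Expr.answer.eval σ = d - 2 * h := by
  have h5 := P.five_le_width (P.row x) (P.col x)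
  have hi' := Nat.mod_lt (P.row x) P.side_pos
  have hw : ((P.width (P.row x) (P.col x) - 4 : ℕ) : ℤ) =
      2 * P.side + ((P.col x % P.side : ℕ) : ℤ) - ((P.row x % P.side : ℕ) : ℤ) := by
    unfold width at *; omega
  have h1 : ((2 ^ P.len - 1 : ℕ) : ℤ) = 2 ^ P.len - 1 := by
    rw [Nat.cast_sub Nat.one_le_two_pow]; push_cast; rfl
  simp only [Expr.answer, Expr.eval_sub, Expr.eval_add, Expr.eval_mul, Expr.eval_simReg,
    Expr.eval_var, Expr.eval_mod, Expr.eval_ofNat, Expr.eval_one, hd, hp.row hx, hp.col hx,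
    hp.side, hp.big, hp.shift, score, price_eq]
  push_cast [h1] at hw ⊢
  rw [hw]; ring

/-- The matrix `E` is the one from before the round. Overwriting array `2` in place is harmless,
since the oracle works on its own memory, which already contains what it needs. -/
theorem queryEntry_runs {P : MinPlus} {M B K : ℕ} {Q : RAM.Prog} {ν₀ : RAM.State}
    (hM : P.nonterminals ≤ M) (hBM : B ≤ M) (hQ : Answers P B K Q ν₀) {E : ℕ → ℕ → ℤ} {h : ℤ}
    (hE : ∀ i < P.dim, ∀ j < P.dim, E i j + h = P.val i j)
    (hEM : ∀ i < P.dim, ∀ j < P.dim, 2 * |E i j| ≤ M) {σ : Mem} (hσ : σ.Bdd M) (hs : σ.SimOK)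
    (hp : HoldsParams P h σ)
    (hserved : Served B Q P.grammar.nt P.word.length ν₀ σ.view) {x : ℕ}
    (hx : σ.reg .ctr = x) :
    Runs M (queryEntry Q) σ (K + 4)
      fun σ' => MatFrame σ σ' ∧ σ'.reg .ctr = x ∧
        Served B Q P.grammar.nt P.word.length ν₀ σ'.view ∧
        ∃ y, IsSquareEntry P.dim E (P.row x) (P.col x) y ∧
          ∀ k, σ'.arr 2 k = if k = x then y else σ.arr 2 k := by
  have hi := row_lt (P := P) x
  have hj := col_lt (P := P) x
  have hn : P.letters = 3 * P.side + 3 := rfl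
  have hi' := Nat.mod_lt (P.row x) P.side_pos
  have hj' := Nat.mod_lt (P.col x) P.side_pos
  have hv : P.Valid (prod (P.row x / P.side * P.side2 + P.col x / P.side)) := prod_lt hi hj
  obtain ⟨k, hk, hmin⟩ := Finset.exists_min_image (Finset.range P.dim)
    (fun k => P.val (P.row x) k + P.val k (P.col x)) ⟨0, Finset.mem_range.2 P.dim_pos⟩
  rw [Finset.mem_range] at hk
  have hmin' : ∀ k' < P.dim, P.val (P.row x) k + P.val k (P.col x) ≤
      P.val (P.row x) k' + P.val k' (P.col x) := fun k' hk' => hmin k' (Finset.mem_range.2 hk')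
  obtain ⟨ν', t, hex, ht, hans⟩ := hQ σ.view hserved
    (P.nonterm (prod (P.row x / P.side * P.side2 + P.col x / P.side)))
    (P.row x % P.side + 1) (2 * P.side + 4 + P.col x % P.side) (by omega) (by omega)
    (by rw [word_length]; omega)
  have hreg := hans _ (mcDerives hi hj hk hmin')
  have hserved' := Served.query hserved
    (P.nonterm (prod (P.row x / P.side * P.side2 + P.col x / P.side))).2 (by omega) (by omega)
    (by rw [word_length]; omega) hex
  rw [nonterm_val hv] at hex
  refine Runs.mono (T := 3 + (K + 1)) (Runs.seq (((askEntry_runs hM hs hp hx).bdd hσ).mono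
    le_rfl ?_)) (by omega) (fun _ h => h)
  rintro σ₁ ⟨⟨f₁, w₁⟩, b₁⟩
  refine Runs.seq ((simulate_runs hBM hex b₁ (f₁.simOK hs) w₁ ht).mono le_rfl ?_)
  rintro σ₂ ⟨f₂, rfl⟩
  have hf := f₁.trans f₂
  have hx₂ : σ₂.reg .ctr = x := by rw [hf.reg, hx]
  have ha := eval_answer (hp.frame hf.frame.mat) hx₂ hreg
  have ha' : Expr.answer.eval σ₂ = E (P.row x) k + E k (P.col x) := by
    rw [ha, Nat.cast_add, ← hE _ hi _ hk, ← hE _ hk _ hj]; ring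
  refine Runs.store ?_ ⟨hf.frame.mat.trans (.setArr _ _ _), by rw [Mem.setArr_reg, hx₂],
    by rwa [view_setArr_two], _, ⟨k, hk, ha', fun k' hk' => ?_⟩, fun l => ?_⟩
  · rw [ha']
    have h1 := hEM _ hi _ hk
    have h2 := hEM _ hk _ hj
    have h3 := abs_add_le (E (P.row x) k) (E k (P.col x))
    linarith
  · have h1 := hmin' k' hk'
    zify at h1
    rw [← hE _ hi _ hk, ← hE _ hk _ hj, ← hE _ hi _ hk', ← hE _ hk' _ hj] at h1
    linarith
  · have hx₃ : (Expr.var .ctr).eval σ₂ = x := hx₂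
    rw [Mem.setArr_arr, hx₃, hf.arr 2 (by norm_num)]; simp

theorem queryAll_runs {P : MinPlus} {M B K : ℕ} {Q : RAM.Prog} {ν₀ : RAM.State}
    (hM : P.nonterminals ≤ M) (hM' : P.dim2 ≤ M) (hBM : B ≤ M) (hQ : Answers P B K Q ν₀)
    {E : ℕ → ℕ → ℤ} {h : ℤ} (hE : ∀ i < P.dim, ∀ j < P.dim, E i j + h = P.val i j)
    (hEM : ∀ i < P.dim, ∀ j < P.dim, 2 * |E i j| ≤ M) {σ : Mem} (hσ : σ.Bdd M) (hs : σ.SimOK)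
    (hp : HoldsParams P h σ)
    (hserved : Served B Q P.grammar.nt P.word.length ν₀ σ.view) :
    Runs M (queryAll Q) σ (P.dim2 * (K + 6) + 2)
      fun σ' => MatFrame σ σ' ∧ ∀ i < P.dim, ∀ j < P.dim,
        IsSquareEntry P.dim E i j (σ'.matrix P.dim i j) := by
  have hset : ∀ (σ' : Mem) (v : ℤ), MatFrame σ' (σ'.set .ctr v) := fun σ' v =>
    (Frame.set (.inl rfl) v).mat
  refine (Runs.for (M := M) (T := K + 4) P.dim2
    (fun i σ' => σ'.reg .ctr = i ∧ MatFrame σ σ' ∧ σ'.Bdd M ∧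
      Served B Q P.grammar.nt P.word.length ν₀ σ'.view ∧
      ∀ x < i, IsSquareEntry P.dim E (P.row x) (P.col x) (σ'.arr 2 (x : ℕ)))
    (fun i σ h => h.1) (fun i σ' h => ?_) hM' ?_ ?_).mono (by simp [add_assoc]) ?_
  · simp [Expr.dim2, Expr.dim, (hp.frame h.2.1).side, MinPlus.dim2, MinPlus.dim]
  · refine ⟨by rw [Mem.set_reg, if_pos rfl]; rfl, hset _ _, hσ.set _ (by simp), ?_, by simp⟩
    rwa [view_set (.inl rfl)]
  · rintro i hi σ' ⟨hc, hf, hb, hsv, hall⟩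
    refine ((queryEntry_runs hM hBM hQ hE hEM hb (hf.simOK hs) (hp.frame hf) hsv hc).bdd hb).mono
      le_rfl ?_
    rintro σ'' ⟨⟨hf', hc', hsv', y, hy, harr⟩, hb'⟩
    refine ⟨hc', by rw [Mem.set_reg, if_pos rfl], (hf.trans hf').trans (hset _ _),
      hb'.set _ ?_, by rwa [view_set (.inl rfl)], fun x hx => ?_⟩
    · rw [Nat.abs_cast]; exact_mod_cast (by omega)
    · rw [Mem.set_arr, harr]
      by_cases hxi : x = i
      · subst hxi; rwa [if_pos rfl]
      · rw [if_neg (by exact_mod_cast hxi)]; exact hall x (by omega)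
  · rintro σ' ⟨-, hf, -, -, hall⟩
    refine ⟨hf, fun i hi j hj => ?_⟩
    have := hall (i * P.dim + j) (pair_lt hi hj)
    have hlt : i * P.dim + j < P.dim2 := pair_lt hi hj
    have hrow : P.row (i * P.dim + j) = i := by
      rw [MinPlus.row, Nat.mod_eq_of_lt hlt, mul_comm, Nat.mul_add_div P.dim_pos,
        Nat.div_eq_of_lt hj, add_zero]
    have hcol : P.col (i * P.dim + j) = j := by
      rw [MinPlus.col, Nat.mod_eq_of_lt hlt, mul_comm, Nat.mul_add_mod, Nat.mod_eq_of_lt hj]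
    rwa [hrow, hcol] at this

/-- One min-plus square, for the programs of an oracle. -/
def squareMatrix (p Q : RAM.Prog) : Stmt :=
  .seq loadInput (.seq (simulate p) (queryAll Q))

theorem squareMatrix_runs {P : MinPlus} {M B K T : ℕ} {p Q : RAM.Prog} {ν₀ : RAM.State}
    (hM : P.nonterminals ≤ M) (hM₁ : P.productions.length ≤ M) (hM₂ : P.dim2 ≤ M) (hBM : B ≤ M)
    (hp : RAM.Exec B p (inputState P.grammar P.word) ν₀ T) (hQ : Answers P B K Q ν₀)
    {σ : Mem} (hσ : σ.Bdd M) (hs : σ.SimOK) (hH : Holds P σ)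
    (h0 : σ.view = ⟨fun _ => 0, fun _ _ => 0⟩)
    (hEM : ∀ i < P.dim, ∀ j < P.dim, 2 * |σ.matrix P.dim i j| ≤ M) :
    Runs M (squareMatrix p Q) σ
      (P.productions.length * 6 + P.letters * 3 + 34 + T + P.dim2 * (K + 6))
      fun σ' => MatFrame σ σ' ∧ ∀ i < P.dim, ∀ j < P.dim,
        IsSquareEntry P.dim (σ.matrix P.dim) i j (σ'.matrix P.dim i j) := by
  refine Runs.mono (T := P.productions.length * 6 + P.letters * 3 + 32 +
    (T + (P.dim2 * (K + 6) + 2))) (Runs.seq (((loadInput_runs hM hM₁ hs hH h0).bdd hσ).mono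
      le_rfl ?_)) (by omega) (fun _ h => h)
  rintro σ₁ ⟨⟨f₁, v₁⟩, b₁⟩
  refine Runs.seq (((simulate_runs hBM hp b₁ (f₁.simOK hs) v₁ le_rfl).bdd b₁).mono le_rfl ?_)
  rintro σ₂ ⟨⟨f₂, v₂⟩, b₂⟩
  have hf := f₁.trans f₂.frame
  have hH₂ := hH.frame hf
  have hserved : Served B Q P.grammar.nt P.word.length ν₀ σ₂.view := by rw [v₂]; exact .start
  refine (queryAll_runs hM hM₂ hBM hQ (E := σ.matrix P.dim) (h := Expr.shift.eval σ) hH.val hEM b₂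
    (hf.simOK hs) ⟨hH₂.side, hH₂.len, hH₂.big, hf.eval_shift⟩ hserved).mono le_rfl ?_
  rintro σ₃ ⟨f₃, h₃⟩
  exact ⟨hf.mat.trans f₃, h₃⟩

end Imp

/-! ## The parameters of the squaring rounds -/

namespace Imp

/-- The memory `σ'` differs from `σ` only in the variables `X` and the arrays `A`. -/
structure Keeps (X : List Var) (A : List ℕ) (σ σ' : Mem) : Prop where
  reg : ∀ x ∉ X, σ'.reg x = σ.reg x
  arr : ∀ a ∉ A, σ'.arr a = σ.arr a

namespace Keeps

variable {X : List Var} {A : List ℕ} {σ σ' : Mem}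

theorem refl (σ : Mem) : Keeps X A σ σ := ⟨fun _ _ => rfl, fun _ _ => rfl⟩

theorem set (h : Keeps X A σ σ') {x : Var} (hx : x ∈ X) (v : ℤ) : Keeps X A σ (σ'.set x v) := by
  refine ⟨fun y hy => ?_, h.arr⟩
  rw [Mem.set_reg, if_neg (by rintro rfl; exact hy hx), h.reg y hy]

theorem setArr (h : Keeps X A σ σ') {a : ℕ} (ha : a ∈ A) (k v : ℤ) :
    Keeps X A σ (σ'.setArr a k v) := by
  refine ⟨h.reg, fun b hb => ?_⟩
  ext l
  rw [Mem.setArr_arr, if_neg (by rintro ⟨rfl, -⟩; exact hb ha), h.arr b hb]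

end Keeps

/-- Find the least `side ≥ 1` with `vtx ≤ side ^ 3`. -/
def findSide : Stmt :=
  .seq (.assign .side 1) (.loop Expr.dim Var.vtx (.assign .side (Var.side + 1)))

/-- The upper bound on `m` lets the vertices fit into `side ^ 3` indices; the lower bound makes
`side ^ 3` at most `8 * m`. -/
theorem findSide_runs {M m : ℕ} (hm : 1 ≤ m) (hM : m + 1 ≤ M) {σ : Mem} (hσ : σ.reg .vtx = m) :
    Runs M findSide σ (m * 2 + 2) fun σ' => Keeps [.side] [] σ σ' ∧
      ∃ j < m, σ'.reg .side = ((j + 1 : ℕ) : ℤ) ∧ j ^ 3 < m ∧ m ≤ (j + 1) ^ 3 := by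
  have hcube : ∀ j : ℕ, j ≤ j ^ 3 := fun j => Nat.le_self_pow (by norm_num) j
  have key : ∀ {σ'}, Keeps [.side] [] σ σ' → σ'.reg .vtx = m := fun h => by
    rw [h.reg _ (by decide), hσ]
  refine Runs.mono (T := 1 + ((m - 0) * (1 + 1) + 1)) (Runs.seq (Runs.assign (by simp; omega)
    ((Runs.loop m (fun i σ' => Keeps [.side] [] σ σ' ∧ σ'.reg .side = ((i + 1 : ℕ) : ℤ) ∧
      i ^ 3 < m) (fun i σ' hI hc => ?_) 0 (Nat.zero_le _) ⟨(Keeps.refl σ).set (by decide) _, ?_, ?_⟩).mono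
      le_rfl ?_))) (by omega) (fun _ h => h)
  · obtain ⟨hk, hs, hi⟩ := hI
    have h1 := hcube i
    simp only [Expr.dim, Expr.eval_mul, Expr.eval_var, hs, key hk] at hc
    refine ⟨by omega, Runs.assign ?_ ⟨hk.set (by decide) _, ?_, ?_⟩⟩
    · simp only [Expr.eval_add, Expr.eval_var, hs, Expr.eval_one]
      rw [← Nat.cast_succ, Nat.abs_cast]; exact_mod_cast (by omega)
    · rw [Mem.set_reg, if_pos rfl]; simp [hs]
    · rw [pow_three']; exact_mod_cast hc
  · rw [Mem.set_reg, if_pos rfl]; rfl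
  · simp; omega
  · rintro σ' ⟨j, -, ⟨hk, hs, hj⟩, hc⟩
    have h1 := hcube j
    simp only [Expr.dim, Expr.eval_mul, Expr.eval_var, hs, key hk] at hc
    refine ⟨hk, j, by omega, hs, hj, ?_⟩
    rw [pow_three']; exact_mod_cast not_lt.1 hc

/-- The greatest absolute value of a weight. -/
def findMax : Stmt :=
  .seq (.assign .wmax 0) (.for .ctr (Var.vtx * Var.vtx) (.assign .wmax
    (.ite Var.wmax (.load 0 Var.ctr) (.load 0 Var.ctr)
      (.ite Var.wmax (0 - .load 0 Var.ctr) (0 - .load 0 Var.ctr) Var.wmax))))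

/-- The bound `W` is not part of the input, so the largest absolute value is computed and used in
its place. -/
theorem findMax_runs {M m W : ℕ} (hM : m * m ≤ M) (hW : W ≤ M) {σ : Mem} (hσ : σ.reg .vtx = m)
    (h0 : ∀ k, |σ.arr 0 k| ≤ W) :
    Runs M findMax σ (m * m * 3 + 3) fun σ' => Keeps [.ctr, .wmax] [] σ σ' ∧
      ∃ w : ℕ, w ≤ W ∧ σ'.reg .wmax = w ∧ ∀ k < m * m, |σ.arr 0 (k : ℕ)| ≤ w := by
  have key : ∀ {σ'}, Keeps [.ctr, .wmax] [] σ σ' → σ'.reg .vtx = m := fun h => by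
    rw [h.reg _ (by decide), hσ]
  refine Runs.mono (T := 1 + (m * m * (1 + 2) + 2)) (Runs.seq (Runs.assign (by simp)
    ((Runs.for (m * m) (fun i σ' => σ'.reg .ctr = i ∧ Keeps [.ctr, .wmax] [] σ σ' ∧
      ∃ w : ℕ, w ≤ W ∧ σ'.reg .wmax = w ∧ ∀ k < i, |σ.arr 0 (k : ℕ)| ≤ w)
      (fun i σ h => h.1) (fun i σ' h => by simp [key h.2.1]) hM ⟨?_, ?_, 0, ?_, ?_, ?_⟩
      (fun i hi σ' => ?_)).mono le_rfl ?_))) (by omega) (fun _ h => h)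
  · simp [Mem.set_reg]
  · exact ((Keeps.refl σ).set (by decide) _).set (by decide) _
  · omega
  · simp [Mem.set_reg]
  · simp
  · rintro ⟨hc, hk, w, hw, hr, hall⟩
    have hx : |σ.arr 0 (i : ℕ)| ≤ W := h0 i
    obtain ⟨w', hw', he, h1, h2⟩ : ∃ w' : ℕ, w' ≤ W ∧
        (Expr.ite Var.wmax (.load 0 Var.ctr) (.load 0 Var.ctr)
          (.ite Var.wmax (0 - .load 0 Var.ctr) (0 - .load 0 Var.ctr) Var.wmax)).eval σ' = w' ∧
        w ≤ w' ∧ |σ.arr 0 (i : ℕ)| ≤ w' := by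
      simp only [Expr.eval_ite, Expr.eval_var, Expr.eval_load, Expr.eval_sub, Expr.eval_zero, hc,
        hr, hk.arr 0 (by simp)]
      rw [abs_le] at hx
      simp only [abs_le]
      split_ifs
      · exact ⟨(σ.arr 0 i).toNat, by omega, by omega, by omega, by omega, by omega⟩
      · exact ⟨(-σ.arr 0 i).toNat, by omega, by omega, by omega, by omega, by omega⟩
      · exact ⟨w, by omega, by omega, by omega, by omega, by omega⟩
    refine Runs.assign ?_ ⟨?_, ?_, ?_, w', hw', ?_, fun k hk => ?_⟩
    · rw [he, Nat.abs_cast]; exact_mod_cast hw'.trans hW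
    · rw [Mem.set_reg, if_neg (by decide), hc]
    · simp [Mem.set_reg]
    · exact (hk.set (by decide) _).set (by decide) _
    · rw [Mem.set_reg, if_neg (by decide), Mem.set_reg, if_pos rfl, he]
    · rcases Nat.lt_succ_iff_lt_or_eq.1 hk with hlt | rfl
      · exact (hall k hlt).trans (by exact_mod_cast h1)
      · exact h2
  · rintro σ' ⟨-, hk, h⟩
    exact ⟨hk, h⟩

/-- The least power of `2` that is at least `side ^ 3`. -/
def findRounds : Stmt :=
  .seq (.assign .pw 1) (.seq (.assign .rounds 0) (.loop Var.pw Expr.dim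
    (.seq (.assign .pw (Var.pw + Var.pw)) (.assign .rounds (Var.rounds + 1)))))

theorem findRounds_runs {M N : ℕ} (hM : 2 ^ Nat.clog 2 N ≤ M) {σ : Mem}
    (hσ : Expr.dim.eval σ = N) :
    Runs M findRounds σ (Nat.clog 2 N * 3 + 3) fun σ' => Keeps [.pw, .rounds] [] σ σ' ∧
      σ'.reg .rounds = Nat.clog 2 N ∧ σ'.reg .pw = 2 ^ Nat.clog 2 N := by
  have h2 : ∀ {i}, i < Nat.clog 2 N ↔ 2 ^ i < N := Nat.lt_clog_iff_pow_lt (by norm_num)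
  have hlt : Nat.clog 2 N < 2 ^ Nat.clog 2 N := Nat.lt_two_pow_self
  have key : ∀ {σ'}, Keeps [.pw, .rounds] [] σ σ' → Expr.dim.eval σ' = N := fun h => by
    rw [← hσ]; simp [Expr.dim, h.reg .side (by decide)]
  refine Runs.mono (T := 1 + (1 + ((Nat.clog 2 N - 0) * (1 + 1 + 1) + 1)))
    (Runs.seq (Runs.assign ?_ (Runs.seq (Runs.assign (by simp)
    ((Runs.loop (Nat.clog 2 N) (fun i σ' => Keeps [.pw, .rounds] [] σ σ' ∧
      σ'.reg .rounds = i ∧ σ'.reg .pw = 2 ^ i) (fun i σ' hI hc => ?_) 0 (Nat.zero_le _)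
      ⟨?_, ?_, ?_⟩).mono le_rfl ?_))))) (by omega) (fun _ h => h)
  · simp; omega
  · obtain ⟨hk, hr, hp⟩ := hI
    rw [Expr.eval_var, hp, key hk] at hc
    have hi : i < Nat.clog 2 N := h2.2 (by exact_mod_cast hc)
    have hpow : 2 ^ (i + 1) ≤ M := (Nat.pow_le_pow_right (by norm_num) hi).trans hM
    have he : (Var.pw + Var.pw : Expr).eval σ' = ((2 ^ (i + 1) : ℕ) : ℤ) := by
      simp [hp]; ring
    refine ⟨hi, Runs.seq (Runs.assign ?_ (Runs.assign ?_ ⟨?_, ?_, ?_⟩))⟩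
    · rw [he, Nat.abs_cast]; exact_mod_cast hpow
    · simp only [Expr.eval_add, Expr.eval_var, Expr.eval_one, Mem.set_reg]
      rw [if_neg (by decide), hr, ← Nat.cast_succ, Nat.abs_cast]
      exact_mod_cast (by omega)
    · exact (hk.set (by decide) _).set (by decide) _
    · simp [Mem.set_reg, hr]
    · rw [Mem.set_reg, if_neg (by decide), Mem.set_reg, if_pos rfl, he]; simp
  · exact ((Keeps.refl σ).set (by decide) _).set (by decide) _
  · simp [Mem.set_reg]
  · simp [Mem.set_reg]
  · rintro σ' ⟨j, hj, ⟨hk, hr, hp⟩, hc⟩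
    rw [Expr.eval_var, hp, key hk] at hc
    obtain rfl : j = Nat.clog 2 N := by
      refine hj.antisymm (not_lt.1 fun h => hc ?_)
      exact_mod_cast h2.1 h
    exact ⟨hk, hr, hp⟩

/-- The powers of `2` up to the first one that is greater than `2 * shift`. -/
def findPowers : Stmt :=
  .seq (.assign .big 1) (.seq (.assign .len 0) (.seq (.store 3 0 1)
    (.loop Var.big (2 * Expr.shift + 1) (.seq (.assign .big (Var.big + Var.big))
      (.seq (.assign .len (Var.len + 1)) (.store 3 Var.len Var.big))))))

theorem findPowers_runs {M h : ℕ} (hM : 2 ^ Nat.clog 2 (2 * h + 1) ≤ M) {σ : Mem}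
    (hσ : Expr.shift.eval σ = h) :
    Runs M findPowers σ (Nat.clog 2 (2 * h + 1) * 4 + 4) fun σ' => Keeps [.big, .len] [3] σ σ' ∧
      σ'.reg .len = Nat.clog 2 (2 * h + 1) ∧ σ'.reg .big = 2 ^ Nat.clog 2 (2 * h + 1) ∧
      ∀ t ≤ Nat.clog 2 (2 * h + 1), σ'.arr 3 (t : ℕ) = 2 ^ t := by
  set ℓ := Nat.clog 2 (2 * h + 1)
  have h2 : ∀ {i}, i < ℓ ↔ 2 ^ i < 2 * h + 1 := Nat.lt_clog_iff_pow_lt (by norm_num)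
  have hlt : ℓ < 2 ^ ℓ := Nat.lt_two_pow_self
  have key : ∀ {σ'}, Keeps [.big, .len] [3] σ σ' →
      (2 * Expr.shift + 1 : Expr).eval σ' = ((2 * h + 1 : ℕ) : ℤ) := fun h => by
    push_cast
    rw [← hσ]
    simp [Expr.shift, Expr.top, h.reg .pw (by decide), h.reg .wmax (by decide)]
  refine Runs.mono (T := 1 + (1 + (1 + ((ℓ - 0) * (1 + (1 + 1) + 1) + 1))))
    (Runs.seq (Runs.assign ?_ (Runs.seq (Runs.assign (by simp) (Runs.seq (Runs.store ?_
    ((Runs.loop ℓ (fun i σ' => Keeps [.big, .len] [3] σ σ' ∧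
      σ'.reg .len = i ∧ σ'.reg .big = 2 ^ i ∧ ∀ t ≤ i, σ'.arr 3 (t : ℕ) = 2 ^ t)
      (fun i σ' hI hc => ?_) 0 (Nat.zero_le _)
      ⟨?_, ?_, ?_, ?_⟩).mono le_rfl ?_))))))) (by omega) (fun _ h => h)
  · simp; omega
  · simp; omega
  · obtain ⟨hk, hr, hp, ha⟩ := hI
    rw [Expr.eval_var, hp, key hk] at hc
    have hi : i < ℓ := h2.2 (by exact_mod_cast hc)
    have hpow : 2 ^ (i + 1) ≤ M := (Nat.pow_le_pow_right (by norm_num) hi).trans hM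
    have he : (Var.big + Var.big : Expr).eval σ' = ((2 ^ (i + 1) : ℕ) : ℤ) := by
      simp [hp]; ring
    refine ⟨hi, Runs.seq (Runs.assign ?_ (Runs.seq (Runs.assign ?_ (Runs.store ?_
      ⟨?_, ?_, ?_, fun t ht => ?_⟩))))⟩
    · rw [he, Nat.abs_cast]; exact_mod_cast hpow
    · simp only [Expr.eval_add, Expr.eval_var, Expr.eval_one, Mem.set_reg]
      rw [if_neg (by decide), hr, ← Nat.cast_succ, Nat.abs_cast]
      exact_mod_cast (by omega)
    · rw [Expr.eval_var, Mem.set_reg, if_neg (by decide), Mem.set_reg, if_pos rfl, he,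
        Nat.abs_cast]
      exact_mod_cast hpow
    · exact ((hk.set (by decide) _).set (by decide) _).setArr (by decide) _ _
    · simp [Mem.set_reg, hr]
    · rw [Mem.setArr_reg, Mem.set_reg, if_neg (by decide), Mem.set_reg, if_pos rfl, he]; simp
    · rw [Mem.setArr_arr]
      simp only [Expr.eval_var, Expr.eval_add, Mem.set_reg, Expr.eval_one, Mem.set_arr]
      simp only [reduceCtorEq, ↓reduceIte, hr, hp, true_and]
      rcases ht.lt_or_eq with hlt | rfl
      · rw [if_neg (by exact_mod_cast hlt.ne), ha t (by omega)]
      · rw [if_pos (by simp)]; ring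
  · exact (((Keeps.refl σ).set (by decide) _).set (by decide) _).setArr (by decide) _ _
  · simp [Mem.set_reg]
  · simp [Mem.set_reg]
  · intro t ht
    obtain rfl : t = 0 := by omega
    simp [Mem.setArr_arr]
  · rintro σ' ⟨j, hj, ⟨hk, hr, hp, ha⟩, hc⟩
    rw [Expr.eval_var, hp, key hk] at hc
    obtain rfl : j = ℓ := by
      refine hj.antisymm (not_lt.1 fun h => hc ?_)
      exact_mod_cast h2.1 h
    exact ⟨hk, hr, hp, ha⟩

end Imp

/-! ## Computing the distances -/

namespace Imp

open LanEd APSP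

theorem inputState_arr {m : ℕ} (w : WDigraph m) (u v : Fin m) :
    (APSP.inputState w).arr 0 ((u : ℤ) * m + v) = (w u v).getD 0 ∧
    (APSP.inputState w).arr 1 ((u : ℤ) * m + v) = if (w u v).isSome then 1 else 0 := by
  have hlt : (u : ℕ) * m + v < m * m := by have := u.2; have := v.2; nlinarith
  have h : 0 ≤ (u : ℤ) * m + v ∧ (u : ℤ) * m + v < (m : ℤ) * m :=
    ⟨by positivity, by exact_mod_cast hlt⟩
  have ht : ((u : ℤ) * m + v).toNat = u * m + v := by omega
  have hm : 0 < m := by have := u.2; omega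
  have hd : (⟨((u : ℤ) * m + v).toNat / m, by
      rw [ht]; exact Nat.div_lt_of_lt_mul hlt⟩ : Fin m) = u := by
    apply Fin.ext
    simp only [ht]
    rw [mul_comm, Nat.mul_add_div hm, Nat.div_eq_of_lt v.2, add_zero]
  have hr : (⟨((u : ℤ) * m + v).toNat % m, Nat.mod_lt _ hm⟩ : Fin m) = v := by
    apply Fin.ext
    simp only [ht]
    rw [mul_comm, Nat.mul_add_mod, Nat.mod_eq_of_lt v.2]
  simp only [APSP.inputState, dif_pos h, hd, hr, and_self]

theorem abs_inputState_arr_le {m W : ℕ} {w : WDigraph m}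
    (hw : ∀ (u v : Fin m) (x : ℤ), w u v = some x → |x| ≤ W) (k : ℤ) :
    |(APSP.inputState w).arr 0 k| ≤ W := by
  simp only [APSP.inputState]
  split_ifs with h
  · cases hx : w _ _ with
    | none => simp
    | some x => exact hw _ _ x hx
  · simp

theorem inputState_arr_of_two_le {m : ℕ} (w : WDigraph m) {a : ℕ} (ha : 2 ≤ a) (k : ℤ) :
    (APSP.inputState w).arr a k = 0 := by
  simp only [APSP.inputState]
  match a, ha with
  | a + 2, _ => split_ifs <;> rfl

theorem abs_inputState_arr_one_le {m : ℕ} (w : WDigraph m) (k : ℤ) :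
    |(APSP.inputState w).arr 1 k| ≤ 1 := by
  simp only [APSP.inputState]
  split_ifs <;> simp

/-- The entry of the initial matrix with number `ctr`. -/
def Expr.initial : Expr :=
  let u : Expr := Var.ctr / Expr.dim
  let v : Expr := Var.ctr % Expr.dim
  let k : Expr := u * Var.vtx + v
  let x : Expr := .ite u Var.vtx (.ite v Var.vtx (.ite 0 (.load 1 k) (.load 0 k) top) top) top
  .ite u v x (.ite v u x 0)

theorem eval_initial {m N : ℕ} {w : WDigraph m} {σ : Mem} (h0 : σ.arr 0 = (APSP.inputState w).arr 0)
    (h1 : σ.arr 1 = (APSP.inputState w).arr 1) (hv : σ.reg .vtx = m)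
    (hN : Expr.dim.eval σ = N) {u v : ℕ} (hvN : v < N)
    (hc : σ.reg .ctr = ((u * N + v : ℕ) : ℤ)) :
    Expr.initial.eval σ = APSP.initial w (Expr.top.eval σ) u v := by
  have hu : (Var.ctr / Expr.dim : Expr).eval σ = u := by
    rw [Expr.eval_div, Expr.eval_var, hc, hN]
    norm_cast
    rw [mul_comm, Nat.mul_add_div (by omega), Nat.div_eq_of_lt hvN, add_zero]
  have hv' : (Var.ctr % Expr.dim : Expr).eval σ = v := by
    rw [Expr.eval_mod, Expr.eval_var, hc, hN]
    norm_cast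
    rw [mul_comm, Nat.mul_add_mod, Nat.mod_eq_of_lt hvN]
  simp only [Expr.initial, Expr.eval_ite, hu, hv', Expr.eval_load, Expr.eval_add, Expr.eval_mul,
    Expr.eval_var, hv, Expr.eval_zero, h0, h1, APSP.initial, Nat.cast_lt]
  by_cases huv : u = v
  · simp [huv]
  · rw [if_neg huv]
    have hx : (if u < v then
        (if u < m then if v < m then if 0 < (APSP.inputState w).arr 1 ((u : ℤ) * m + v) then
          (APSP.inputState w).arr 0 ((u : ℤ) * m + v) else Expr.top.eval σ
          else Expr.top.eval σ else Expr.top.eval σ) else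
        if v < u then (if u < m then if v < m then
          if 0 < (APSP.inputState w).arr 1 ((u : ℤ) * m + v) then
          (APSP.inputState w).arr 0 ((u : ℤ) * m + v) else Expr.top.eval σ
          else Expr.top.eval σ else Expr.top.eval σ) else 0) =
        (if u < m then if v < m then if 0 < (APSP.inputState w).arr 1 ((u : ℤ) * m + v) then
          (APSP.inputState w).arr 0 ((u : ℤ) * m + v) else Expr.top.eval σ
          else Expr.top.eval σ else Expr.top.eval σ) := by
      rcases lt_or_gt_of_ne huv with h | h
      · rw [if_pos h]
      · rw [if_neg h.le.not_gt, if_pos h]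
    rw [hx]
    by_cases hum : u < m
    · by_cases hvm : v < m
      · obtain ⟨e0, e1⟩ := inputState_arr w ⟨u, hum⟩ ⟨v, hvm⟩
        rw [if_pos hum, if_pos hvm, dif_pos ⟨hum, hvm⟩]
        simp only at e0 e1
        rw [e0, e1]
        cases w ⟨u, hum⟩ ⟨v, hvm⟩ <;> simp
      · rw [if_pos hum, if_neg hvm, dif_neg (by tauto)]
    · rw [if_neg hum, dif_neg (by tauto)]

/-- Write the weights into array `2`. -/
def initMatrix : Stmt := .for .ctr Expr.dim2 (.store 2 Var.ctr Expr.initial)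

theorem initMatrix_runs {M m N : ℕ} {w : WDigraph m} (hN : N * N ≤ M) {Z : ℕ} (hZ : Z ≤ M)
    (hw : ∀ (u v : Fin m) (x : ℤ), w u v = some x → |x| ≤ Z) {σ : Mem}
    (h0 : σ.arr 0 = (APSP.inputState w).arr 0)
    (h1 : σ.arr 1 = (APSP.inputState w).arr 1) (hv : σ.reg .vtx = m)
    (hd : Expr.dim.eval σ = N) (ht : Expr.top.eval σ = Z) :
    Runs M initMatrix σ (N * N * 3 + 2) fun σ' => Keeps [.ctr] [2] σ σ' ∧
      ∀ u < N, ∀ v < N, σ'.matrix N u v = APSP.initial w Z u v := by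
  have hk : ∀ {σ'}, Keeps [.ctr] [2] σ σ' → Expr.dim.eval σ' = N ∧ Expr.top.eval σ' = Z :=
    fun h => ⟨by rw [← hd]; simp [Expr.dim, h.reg .side (by decide)],
      by rw [← ht]; simp [Expr.top, h.reg .pw (by decide), h.reg .wmax (by decide)]⟩
  refine (Runs.for (T := 1) (N * N) (fun i σ' => σ'.reg .ctr = i ∧ Keeps [.ctr] [2] σ σ' ∧
    ∀ u < N, ∀ v < N, u * N + v < i → σ'.matrix N u v = APSP.initial w Z u v)
    (fun i σ h => h.1) (fun i σ' h => ?_) hN ⟨?_, (Keeps.refl σ).set (by decide) _, by simp⟩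
    (fun i hi σ' h => ?_)).mono le_rfl ?_
  · simp [Expr.dim2, (hk h.2.1).1]
  · simp [Mem.set_reg]
  · obtain ⟨hc, hkeep, hall⟩ := h
    have hNpos : 0 < N := Nat.pos_of_ne_zero (by rintro rfl; simp at hi)
    have hi' : i / N * N + i % N = i := Nat.div_add_mod' i N
    have hev := eval_initial (N := N) (u := i / N) (v := i % N)
      ((hkeep.arr 0 (by decide)).trans h0) ((hkeep.arr 1 (by decide)).trans h1)
      ((hkeep.reg .vtx (by decide)).trans hv) (hk hkeep).1 (Nat.mod_lt _ hNpos)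
      (by rw [hi', hc])
    rw [(hk hkeep).2] at hev
    refine Runs.store ?_ ⟨hc, by simp [Mem.set_reg],
      (hkeep.setArr (by decide) _ _).set (by decide) _, fun u hu v hv' hlt => ?_⟩
    · rw [hev]
      exact (abs_initial_le (by positivity) hw _ _).trans (by exact_mod_cast hZ)
    · rw [Mem.matrix, Mem.set_arr, Mem.setArr_arr, Expr.eval_var, hc, hev]
      by_cases he : u * N + v = i
      · rw [if_pos ⟨rfl, by exact_mod_cast he⟩, ← he, mul_comm, Nat.mul_add_div hNpos,
          Nat.div_eq_of_lt hv', add_zero, Nat.mul_add_mod, Nat.mod_eq_of_lt hv']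
      · rw [if_neg (by rintro ⟨-, h⟩; exact he (by exact_mod_cast h))]
        exact hall u hu v hv' (by omega)
  · rintro σ' ⟨-, hkeep, hall⟩
    exact ⟨hkeep, fun u hu v hv' => hall u hu v hv' (MinPlus.pair_lt hu hv')⟩

/-- Write the distances. -/
def writeOutput : Stmt :=
  .for .ctr (Var.vtx * Var.vtx)
    (.seq (.store 0 Var.ctr (.load 2 (Var.ctr / Var.vtx * Expr.dim + Var.ctr % Var.vtx)))
    (.store 1 Var.ctr (.ite (Var.pw * Var.wmax)
      (.load 2 (Var.ctr / Var.vtx * Expr.dim + Var.ctr % Var.vtx)) 0 1)))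

theorem writeOutput_runs {M m N : ℕ} (hM : m * m ≤ M) (hM1 : 1 ≤ M) {σ : Mem} (hσ : σ.Bdd M)
    (hv : σ.reg .vtx = m) (hd : Expr.dim.eval σ = N) :
    Runs M writeOutput σ (m * m * 4 + 2) fun σ' => ∀ u < m, ∀ v < m,
      σ'.arr 0 ((u : ℤ) * m + v) = σ.matrix N u v ∧ σ'.arr 1 ((u : ℤ) * m + v) =
        if σ.reg .pw * σ.reg .wmax < σ.matrix N u v then 0 else 1 := by
  have hk : ∀ {σ'}, Keeps [.ctr] [0, 1] σ σ' → σ'.reg .vtx = m ∧ Expr.dim.eval σ' = N :=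
    fun h => ⟨(h.reg _ (by decide)).trans hv,
      by rw [← hd]; simp [Expr.dim, h.reg .side (by decide)]⟩
  refine (Runs.for (T := 2) (m * m) (fun i σ' => σ'.reg .ctr = i ∧ Keeps [.ctr] [0, 1] σ σ' ∧
    ∀ u < m, ∀ v < m, u * m + v < i → σ'.arr 0 ((u * m + v : ℕ) : ℤ) = σ.matrix N u v ∧
      σ'.arr 1 ((u * m + v : ℕ) : ℤ) =
        if σ.reg .pw * σ.reg .wmax < σ.matrix N u v then 0 else 1)
    (fun i σ h => h.1) (fun i σ' h => ?_) hM ⟨?_, (Keeps.refl σ).set (by decide) _, by simp⟩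
    (fun i hi σ' h => ?_)).mono le_rfl ?_
  · simp [(hk h.2.1).1]
  · simp [Mem.set_reg]
  · obtain ⟨hc, hkeep, hall⟩ := h
    have hmpos : 0 < m := Nat.pos_of_ne_zero (by rintro rfl; simp at hi)
    have hi' : i / m * m + i % m = i := Nat.div_add_mod' i m
    have hev : ∀ {σ'}, Keeps [.ctr] [0, 1] σ σ' → σ'.reg .ctr = i →
        (Expr.load 2 (Var.ctr / Var.vtx * Expr.dim + Var.ctr % Var.vtx)).eval σ' =
        σ.matrix N (i / m) (i % m) := fun h hc => by
      simp [h.arr 2 (by decide), hc, hk h, Mem.matrix]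
    have hk' := hkeep.setArr (a := 0) (by decide) ((Expr.var .ctr).eval σ')
      ((Expr.load 2 (Var.ctr / Var.vtx * Expr.dim + Var.ctr % Var.vtx)).eval σ')
    have hev' : (Expr.ite (Var.pw * Var.wmax)
        (.load 2 (Var.ctr / Var.vtx * Expr.dim + Var.ctr % Var.vtx)) 0 1).eval (σ'.setArr 0
        ((Expr.var .ctr).eval σ')
        ((Expr.load 2 (Var.ctr / Var.vtx * Expr.dim + Var.ctr % Var.vtx)).eval σ')) =
        if σ.reg .pw * σ.reg .wmax < σ.matrix N (i / m) (i % m) then 0 else 1 := by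
      rw [Expr.eval_ite, hev hk' hc]
      simp [hkeep.reg .pw (by decide),
        hkeep.reg .wmax (by decide)]
    refine Runs.seq (Runs.store ?_ (Runs.store ?_ ⟨hc, by simp [Mem.set_reg],
      (hk'.setArr (by decide) _ _).set (by decide) _, fun u hu v hv' hlt => ?_⟩))
    · rw [hev hkeep hc]
      exact hσ.2 _ _
    · rw [hev']; split_ifs <;> simp; omega
    · rw [hev', hev hkeep hc]
      simp only [Mem.set_arr, Mem.setArr_arr, Expr.eval_var, Mem.setArr_reg, hc]
      by_cases he : u * m + v = i
      · have e1 : i / m = u := by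
          rw [← he, mul_comm, Nat.mul_add_div hmpos, Nat.div_eq_of_lt hv', add_zero]
        have e2 : i % m = v := by rw [← he, mul_comm, Nat.mul_add_mod, Nat.mod_eq_of_lt hv']
        rw [e1, e2, he]; simp
      · have he' : ((u * m + v : ℕ) : ℤ) ≠ i := by exact_mod_cast he
        have := hall u hu v hv' (by omega)
        simpa only [he', and_false, if_false, if_neg, reduceCtorEq, true_and] using this
  · rintro σ' ⟨-, hkeep, hall⟩ u hu v hv'
    have := hall u hu v hv' (MinPlus.pair_lt hu hv')
    exact_mod_cast this

end Imp

/-! ## The program for all-pairs shortest paths -/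

namespace Imp

open LanEd APSP

/-- The oracle programs `p` and `Q` can be used for a min-plus square: numbers are at most `M`,
and the square takes at most `T` steps. -/
def Affordable (P : MinPlus) (p Q : RAM.Prog) (K M T : ℕ) : Prop :=
  P.nonterminals ≤ M ∧ P.productions.length ≤ M ∧ ∃ (B T' : ℕ) (ν₀ : RAM.State), B ≤ M ∧
    RAM.Exec B p (LanEd.inputState P.grammar P.word) ν₀ T' ∧ Answers P B K Q ν₀ ∧
    P.productions.length * 6 + P.letters * 3 + 34 + T' + P.dim2 * (K + 6) ≤ T

/-- The squaring rounds. -/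
def squareAll (p Q : RAM.Prog) : Stmt := .for .rnd Var.rounds (squareMatrix p Q)

/-- The matrix `E`, shifted by `h`, as the data of a min-plus square. -/
def shifted (q ℓ : ℕ) (hq : 0 < q) (E : ℕ → ℕ → ℤ) (h : ℕ)
    (hE : ∀ i < q * q * q, ∀ j < q * q * q, E i j + h < 2 ^ ℓ) : MinPlus where
  side := q
  len := ℓ
  val i j := if i < q * q * q ∧ j < q * q * q then (E i j + h).toNat else 0
  side_pos := hq
  val_lt i j := by
    split_ifs with hij
    · have := hE i hij.1 j hij.2
      exact (Int.toNat_lt' (by positivity)).2 (by exact_mod_cast this)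
    · positivity

/-- The memory before the first squaring round. -/
structure Ready {m : ℕ} (w : WDigraph m) (q ℓ R Z : ℕ) (σ : Mem) : Prop where
  side : σ.reg .side = q
  len : σ.reg .len = ℓ
  big : σ.reg .big = 2 ^ ℓ
  rounds : σ.reg .rounds = R
  pow : ∀ t ≤ ℓ, σ.arr 3 t = 2 ^ t
  shift : Expr.shift.eval σ = (2 ^ R * Z : ℕ)
  matrix : ∀ u < q * q * q, ∀ v < q * q * q,
    σ.matrix (q * q * q) u v = APSP.initial w Z u v
  zero : ∀ a k, 4 ≤ a → σ.arr a k = 0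

/-- After `r` rounds the matrix is the one for `2 ^ r` steps, and all simulated cells in residue
classes from `r` on are still zero. So round `r` finds a clean memory without any clearing. -/
theorem squareAll_runs {M m q ℓ R Z K T : ℕ} {p Q : RAM.Prog} {w : WDigraph m} (hq : 0 < q)
    (hO : ∀ P : MinPlus, P.side = q → P.len = ℓ → Affordable P p Q K M T)
    (hℓ : 2 * (2 ^ R * Z) < 2 ^ ℓ) (hℓM : 2 ^ ℓ ≤ M) (hRM : R ≤ M)
    (hdM : (q * q * q) * (q * q * q) ≤ M)
    (hw : ∀ (u v : Fin m) (x : ℤ), w u v = some x → |x| ≤ Z) {σ : Mem} (hσ : σ.Bdd M)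
    (h : Ready w q ℓ R Z σ) :
    Runs M (squareAll p Q) σ (R * (T + 2) + 2) fun σ' =>
      (∀ x, x ≠ .ctr → x ≠ .count → x ≠ .rnd → σ'.reg x = σ.reg x) ∧
      IsMinMatrix (APSP.initial w Z) (q * q * q) (2 ^ R) (σ'.matrix (q * q * q)) := by
  set N := q * q * q with hN
  have hD : ∀ u v, |APSP.initial w Z u v| ≤ (Z : ℤ) := abs_initial_le (by positivity) hw
  refine (Runs.for (T := T) R (fun r σ' => σ'.reg .rnd = r ∧
    (∀ x, x ≠ .ctr → x ≠ .count → x ≠ .rnd → σ'.reg x = σ.reg x) ∧ σ'.Bdd M ∧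
    σ'.arr 3 = σ.arr 3 ∧ (∀ a k, 4 ≤ a → (r : ℤ) ≤ k % R → σ'.arr a k = 0) ∧
    IsMinMatrix (APSP.initial w Z) N (2 ^ r) (σ'.matrix N)) (fun r σ' h => h.1)
    (fun r σ' h' => ?_) hRM ⟨?_, ?_, ?_, rfl, fun a k ha _ => h.zero a k ha, ?_⟩
    (fun r hr σ' hI => ?_)).mono le_rfl ?_
  · rw [Expr.eval_var, h'.2.1 _ (by decide) (by decide) (by decide), h.rounds]
  · simp [Mem.set_reg]
  · intro x _ _ hx; rw [Mem.set_reg, if_neg hx]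
  · exact hσ.set _ (by simp)
  · rw [pow_zero]
    intro u hu v hv
    have := isMinMatrix_one (D := APSP.initial w Z) u hu v hv
    rwa [← h.matrix u hu v hv] at this
  · obtain ⟨hrnd, hreg, hb, h3, hzero, hmin⟩ := hI
    have hpow : 2 ^ r ≤ 2 ^ R := Nat.pow_le_pow_right (by norm_num) hr.le
    -- One bound serves for all rounds, so the shift `2 ^ R * Z` and the number `ℓ` of bits are
    -- computed only once: shifted entries lie between 0 and `2 * (2 ^ R * Z) < 2 ^ ℓ`.
    have habs : ∀ i < N, ∀ j < N, |σ'.matrix N i j| ≤ (2 ^ R * Z : ℕ) := fun i hi j hj => by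
      refine (hmin.abs_le hD hi hj).trans ?_
      exact_mod_cast Nat.mul_le_mul_right Z hpow
    have hR : σ'.reg .rounds = R := by
      rw [hreg _ (by decide) (by decide) (by decide), h.rounds]
    have hs : σ'.SimOK := ⟨by omega, by rw [hrnd, hR]; exact_mod_cast hr⟩
    have hmod : ∀ k : ℤ, (k * R + r) % R = r := fun k => by
      rw [add_comm, Int.add_mul_emod_self_right, Int.emod_eq_of_lt (by omega) (by omega)]
    have hview : σ'.view = ⟨fun _ => 0, fun _ _ => 0⟩ := by
      simp only [Mem.view, hrnd, hR, RAM.State.mk.injEq]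
      exact ⟨funext fun x => hzero _ _ le_rfl (hmod _).ge,
        funext fun a => funext fun k => hzero _ _ (by omega) (hmod _).ge⟩
    have hshift : Expr.shift.eval σ' = (2 ^ R * Z : ℕ) := by
      rw [← h.shift]
      simp [Expr.shift, Expr.top, hreg]
    let P := shifted q ℓ hq (σ'.matrix N) (2 ^ R * Z) fun i hi j hj => by
      have h1 := (abs_le.1 (habs i hi j hj)).2
      have h2 : 2 * (((2 ^ R * Z : ℕ)) : ℤ) < 2 ^ ℓ := by exact_mod_cast hℓ
      linarith
    have hdim : P.dim = N := rfl
    have hH : Holds P σ' := by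
      refine ⟨?_, ?_, ?_, ?_, fun i hi j hj => ?_⟩
      · rw [hreg _ (by decide) (by decide) (by decide), h.side]; rfl
      · rw [hreg _ (by decide) (by decide) (by decide), h.len]; rfl
      · rw [hreg _ (by decide) (by decide) (by decide), h.big]; rfl
      · rw [h3]; exact h.pow
      · have hval : P.val i j = (σ'.matrix N i j + (2 ^ R * Z : ℕ)).toNat := if_pos ⟨hi, hj⟩
        have h1 := (abs_le.1 (habs i hi j hj)).1
        rw [hval, Int.toNat_of_nonneg (by linarith), hshift]
        rfl
    obtain ⟨hM₁, hM₂, B, T', ν₀, hB, hex, hans, hT⟩ := hO P rfl rfl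
    refine ((squareMatrix_runs hM₁ hM₂ hdM hB hex hans hb hs hH hview fun i hi j hj => ?_).bdd
      hb).mono hT ?_
    · have h1 := habs i hi j hj
      have h2 : ((2 * (2 ^ R * Z) : ℕ) : ℤ) ≤ M := by exact_mod_cast hℓ.le.trans hℓM
      push_cast at h1 h2
      rw [hdim]
      linarith
    · rintro σ'' ⟨⟨hf, hsq⟩, hb'⟩
      have hrnd' : σ''.reg .rnd = r := by rw [hf.reg _ (by decide) (by decide), hrnd]
      refine ⟨hrnd', by simp [Mem.set_reg], fun x h1 h2 h3 => ?_, hb'.set _ ?_, ?_,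
        fun a k ha hk => ?_, ?_⟩
      · rw [Mem.set_reg, if_neg h3, hf.reg _ h1 h2, hreg _ h1 h2 h3]
      · rw [Nat.abs_cast]; exact_mod_cast (by omega)
      · rw [Mem.set_arr, hf.arr 3 (by norm_num) (by norm_num), h3]
      · push_cast at hk
        rw [Mem.set_arr, hf.cell a k ha (by rw [hR, hrnd]; omega), hzero a k ha (by omega)]
      · rw [pow_succ, mul_two]
        exact hmin.square hsq
  · rintro σ' ⟨-, hreg, -, -, -, hmin⟩
    exact ⟨hreg, hmin⟩

/-- All-pairs shortest paths. -/
def shortestPaths (p Q : RAM.Prog) : Stmt :=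
  .seq findSide (.seq findMax (.seq findRounds (.seq findPowers (.seq initMatrix
    (.seq (squareAll p Q) writeOutput)))))

/-- The memory that holds the input. -/
def inputMem {m : ℕ} (w : WDigraph m) : Mem where
  reg x := if x = .vtx then m else 0
  arr := (APSP.inputState w).arr

theorem rep_inputMem {m : ℕ} (w : WDigraph m) : Rep (inputMem w) (APSP.inputState w) :=
  ⟨fun x => by cases x <;> rfl, rfl⟩

theorem inputMem_bdd {m M : ℕ} {w : WDigraph m} (hm : m ≤ M) (hM : 1 ≤ M)
    (hw : ∀ (u v : Fin m) (x : ℤ), w u v = some x → |x| ≤ M) : (inputMem w).Bdd M := by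
  refine ⟨fun x => ?_, fun a k => ?_⟩
  · simp only [inputMem]
    split_ifs <;> simp; omega
  · match a with
    | 0 => exact abs_inputState_arr_le hw k
    | 1 => exact (abs_inputState_arr_one_le w k).trans (by exact_mod_cast hM)
    | a + 2 => simp [inputMem, inputState_arr_of_two_le w (by omega : 2 ≤ a + 2)]

/-- The weight of missing edges. -/
def missing (N x : ℕ) : ℕ := 2 * (2 ^ Nat.clog 2 N * x) + 1

/-- The number of bits of the entries of the matrices. -/
def bits (N x : ℕ) : ℕ := Nat.clog 2 (2 * (2 ^ Nat.clog 2 N * missing N x) + 1)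

/-- The side `j + 1` and the largest weight `x` are found at run time, so the resources are required
uniformly for all admissible values. -/
theorem shortestPaths_runs {M m W K T T' : ℕ} {p Q : RAM.Prog} {w : WDigraph m} (hm : 1 ≤ m)
    (hw : ∀ (u v : Fin m) (x : ℤ), w u v = some x → |x| ≤ W) (hc : NoNegativeCycle w)
    (hmM : m + 1 ≤ M) (hmM2 : m * m ≤ M) (hWM : W ≤ M)
    (hM : ∀ j x : ℕ, j ^ 3 < m → m ≤ (j + 1) ^ 3 → x ≤ W →
      let N := (j + 1) * (j + 1) * (j + 1)
      N * N ≤ M ∧ 2 ^ bits N x ≤ M ∧ (∀ P : MinPlus, P.side = j + 1 → P.len = bits N x →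
        Affordable P p Q K M T) ∧ N * N + (Nat.clog 2 N * (T + 5) + bits N x * 4) ≤ T') :
    Runs M (shortestPaths p Q) (inputMem w) (m * 2 + m * m * 7 + T' * 3 + 30) fun σ =>
      ∀ u v : Fin m, ((∃ d : ℤ, IsWalk w u v d) → σ.arr 1 ((u : ℤ) * m + v) = 1 ∧
          IsLeast {d : ℤ | IsWalk w u v d} (σ.arr 0 ((u : ℤ) * m + v))) ∧
        ((¬ ∃ d : ℤ, IsWalk w u v d) → σ.arr 1 ((u : ℤ) * m + v) = 0) := by
  have hb₀ : (inputMem w).Bdd M := inputMem_bdd (by omega) (by omega) fun u v x hx =>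
    (hw u v x hx).trans (by exact_mod_cast hWM)
  refine Runs.mono (T := m * 2 + 2 + (m * m * 3 + 3 + (m * m * 4 + T' * 3 + 25))) (Runs.seq
    (((findSide_runs hm hmM (σ := inputMem w) rfl).bdd hb₀).mono le_rfl ?_)) (by omega) fun _ h => h
  rintro σ₁ ⟨⟨k₁, j, -, hside, hj, hj'⟩, b₁⟩
  have a₁ : ∀ a, σ₁.arr a = (APSP.inputState w).arr a := fun a => k₁.arr a (by simp)
  have v₁ : σ₁.reg .vtx = m := k₁.reg .vtx (by decide)
  refine Runs.seq (((findMax_runs hmM2 hWM v₁ fun k => ?_).bdd b₁).mono le_rfl ?_)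
  · rw [a₁]; exact abs_inputState_arr_le hw k
  rintro σ₂ ⟨⟨k₂, x, hxW, hx, hwx⟩, b₂⟩
  have a₂ : ∀ a, σ₂.arr a = (APSP.inputState w).arr a := fun a =>
    (k₂.arr a (by simp)).trans (a₁ a)
  have v₂ : σ₂.reg .vtx = m := (k₂.reg .vtx (by decide)).trans v₁
  have s₂ : σ₂.reg .side = ((j + 1 : ℕ) : ℤ) := (k₂.reg .side (by decide)).trans hside
  have hwx' : ∀ (u v : Fin m) (y : ℤ), w u v = some y → |y| ≤ x := fun u v y hy => by
    have h1 := hwx (u * m + v) (MinPlus.pair_lt u.2 v.2)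
    push_cast at h1
    rwa [a₁, (inputState_arr w u v).1, hy] at h1
  obtain ⟨hN, hbits, hO, hT⟩ := hM j x hj hj' hxW
  set N := (j + 1) * (j + 1) * (j + 1)
  have hmN : m ≤ N := hj'.trans (by rw [pow_three'])
  set R := Nat.clog 2 N with hR
  have hNR : N ≤ 2 ^ R := Nat.le_pow_clog (by norm_num) N
  set ℓ := bits N x with hℓ
  set Z := missing N x with hZ
  have hH : 2 * (2 ^ R * Z) + 1 ≤ 2 ^ ℓ := Nat.le_pow_clog (by norm_num) _
  have hRpos : 1 ≤ 2 ^ R := Nat.one_le_two_pow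
  have hZ' : Z = 2 * (2 ^ R * x) + 1 := rfl
  have hZ1 : 2 ^ R * x ≤ Z := by omega
  have hxZ : x ≤ Z := (Nat.le_mul_of_pos_left _ hRpos).trans hZ1
  have hZH : Z ≤ 2 ^ R * Z := Nat.le_mul_of_pos_left _ hRpos
  have hRZ : 2 ^ R ≤ 2 ^ R * Z := Nat.le_mul_of_pos_right _ (by omega)
  have hRlt : R < 2 ^ R := Nat.lt_two_pow_self
  have hdim : ∀ {σ : Mem}, σ.reg .side = ((j + 1 : ℕ) : ℤ) → Expr.dim.eval σ = N := fun h => by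
    simp [Expr.dim, h, N]
  refine Runs.mono (T := R * 3 + 3 + (ℓ * 4 + 4 + (N * N * 3 + 2 + (R * (T + 2) + 2 +
    (m * m * 4 + 2))))) (Runs.seq (((findRounds_runs (show 2 ^ R ≤ M by omega) (hdim s₂)).bdd b₂).mono le_rfl ?_))
    (by rw [show T + 5 = T + 2 + 3 from rfl, mul_add] at hT; omega) fun _ h => h
  rintro σ₃ ⟨⟨k₃, hrounds, hpw⟩, b₃⟩
  rw [← hR] at hrounds hpw
  have x₃ : σ₃.reg .wmax = x := (k₃.reg .wmax (by decide)).trans hx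
  have s₃ : σ₃.reg .side = ((j + 1 : ℕ) : ℤ) := (k₃.reg .side (by decide)).trans s₂
  have t₃ : Expr.top.eval σ₃ = Z := by
    simp [Expr.top, hpw, x₃, hZ']
  have hsh : Expr.shift.eval σ₃ = (2 ^ R * Z : ℕ) := by
    simp [Expr.shift, hpw, t₃]
  refine Runs.seq (((findPowers_runs hbits hsh).bdd b₃).mono le_rfl ?_)
  rintro σ₄ ⟨⟨k₄, hlen, hbig, hpows⟩, b₄⟩
  have s₄ := (k₄.reg .side (by decide)).trans s₃
  have v₄ : σ₄.reg .vtx = m :=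
    (k₄.reg .vtx (by decide)).trans ((k₃.reg .vtx (by decide)).trans v₂)
  have x₄ : σ₄.reg .wmax = x := (k₄.reg .wmax (by decide)).trans x₃
  have p₄ : σ₄.reg .pw = 2 ^ R := (k₄.reg .pw (by decide)).trans hpw
  have t₄ : Expr.top.eval σ₄ = Z := by
    simp [Expr.top, p₄, x₄, hZ']
  have a₄ : ∀ a, a ≠ 3 → σ₄.arr a = (APSP.inputState w).arr a := fun a ha =>
    (k₄.arr a (by simpa using ha)).trans ((k₃.arr a (by simp)).trans (a₂ a))
  refine Runs.seq (((initMatrix_runs hN (by omega) (fun u v y hy => (hwx' u v y hy).trans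
    (by exact_mod_cast hxZ)) (a₄ 0 (by norm_num)) (a₄ 1 (by norm_num)) v₄ (hdim s₄)
    t₄).bdd b₄).mono le_rfl ?_)
  rintro σ₅ ⟨⟨k₅, hmat⟩, b₅⟩
  have ready : Ready w (j + 1) ℓ R Z σ₅ := by
    refine ⟨?_, ?_, ?_, ?_, ?_, ?_, hmat, fun a k ha => ?_⟩
    · rw [k₅.reg _ (by decide), s₄]
    · rw [k₅.reg _ (by decide), hlen]; rfl
    · rw [k₅.reg _ (by decide), hbig]; rfl
    · rw [k₅.reg _ (by decide), k₄.reg _ (by decide), hrounds]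
    · rw [k₅.arr _ (by decide)]; exact hpows
    · simp [Expr.shift, Expr.top, k₅.reg, p₄, x₄, hZ']
    · rw [k₅.arr _ (by simp; omega), a₄ _ (by omega)]
      exact inputState_arr_of_two_le w (by omega) k
  refine Runs.seq (((squareAll_runs (Nat.succ_pos j) hO (by omega) hbits (by omega) hN
    (fun u v y hy => (hwx' u v y hy).trans (by exact_mod_cast hxZ)) b₅ ready).bdd b₅).mono
    le_rfl ?_)
  rintro σ₆ ⟨⟨hreg, hmin⟩, b₆⟩
  have v₆ : σ₆.reg .vtx = m := by
    rw [hreg _ (by decide) (by decide) (by decide), k₅.reg _ (by decide), v₄]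
  have p₆ : σ₆.reg .pw * σ₆.reg .wmax = ((2 ^ R : ℕ) : ℤ) * x := by
    rw [hreg _ (by decide) (by decide) (by decide), hreg _ (by decide) (by decide) (by decide),
      k₅.reg _ (by decide), k₅.reg _ (by decide), p₄, x₄]
    push_cast; rfl
  refine (writeOutput_runs hmM2 (by omega) b₆ v₆ (hdim ?_)).mono le_rfl ?_
  · rw [hreg _ (by decide) (by decide) (by decide), ready.side]
  intro σ₇ hout u v
  obtain ⟨h0, h1⟩ := hout u u.2 v v.2
  rw [h0, h1, p₆]
  have hZc : (Z : ℤ) = 2 * (((2 ^ R : ℕ) : ℤ) * x) + 1 := by exact_mod_cast hZ'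
  rw [hZc] at hmin
  obtain ⟨hd₁, hd₂⟩ := hmin.distance (by positivity) hc hwx' hmN (hmN.trans hNR) u v
  exact ⟨fun h => ⟨if_neg (hd₁ h).1.not_gt, (hd₁ h).2⟩, fun h => if_pos (not_le.1 (hd₂ h))⟩

end Imp

/-! ## Sizes -/

namespace LanEd

theorem Grammar.IsCNF.size_le {G : Grammar} (h : G.IsCNF) : G.size ≤ G.rules.length * 3 := by
  unfold Grammar.size
  refine (List.sum_le_card_nsmul _ 3 fun x hx => ?_).trans (by simp)
  obtain ⟨r, hr, rfl⟩ := List.mem_map.1 hx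
  rcases h r hr with ⟨B, C, h⟩ | ⟨x, h⟩ | ⟨-, h⟩ <;> simp [h]

namespace MinPlus

variable (P : MinPlus)

theorem productions_length : P.productions.length =
    5 + 3 * P.letters + P.len + P.prods + P.prods * P.side2 + 2 * P.entries +
      P.entries * P.len := by
  simp only [productions, families, List.flatMap_cons, List.flatMap_nil, List.length_append,
    List.length_map, List.length_range, List.length_nil]
  ring

theorem side_pow_le {a b : ℕ} (h : a ≤ b) : P.side ^ a ≤ P.side ^ b :=
  Nat.pow_le_pow_right P.side_pos h

/-- The chains dominate: `2 * side ^ 6` entries with `len` levels each. The splittings of `prod`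
number only `side ^ 4 * side ^ 2`. -/
theorem productions_length_le : P.productions.length ≤ 30 * P.side ^ 6 * (P.len + 1) := by
  have h0 := P.side_pow_le (Nat.zero_le 6)
  have h1 := P.side_pow_le (show 1 ≤ 6 by norm_num)
  have h4 := P.side_pow_le (show 4 ≤ 6 by norm_num)
  have hl := Nat.mul_le_mul_right P.len h0
  have e1 : P.prods = P.side ^ 4 := by rw [prods, side2]; ring
  have e2 : P.prods * P.side2 = P.side ^ 6 := by rw [e1, side2]; ring
  have e3 : P.entries = 2 * P.side ^ 6 := by rw [entries, dim2, dim]; ring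
  rw [productions_length, e2, e1, e3, letters]
  rw [pow_zero] at h0 hl
  rw [pow_one] at h1
  nlinarith

theorem nonterminals_le : P.nonterminals ≤ 30 * P.side ^ 6 * (P.len + 1) := by
  have h0 := P.side_pow_le (Nat.zero_le 6)
  have h1 := P.side_pow_le (show 1 ≤ 6 by norm_num)
  have h4 := P.side_pow_le (show 4 ≤ 6 by norm_num)
  have hl := Nat.mul_le_mul_right P.len h0
  have e1 : P.prods = P.side ^ 4 := by rw [prods, side2]; ring
  have e3 : P.entries = 2 * P.side ^ 6 := by rw [entries, dim2, dim]; ring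
  rw [nonterminals, e1, e3, letters]
  rw [pow_zero] at h0 hl
  rw [pow_one] at h1
  nlinarith

theorem size_le : P.grammar.size ≤ 90 * P.side ^ 6 * (P.len + 1) := by
  have h := P.admissible.1.size_le
  rw [show P.grammar.rules.length = P.productions.length from List.length_map _] at h
  have := P.productions_length_le
  nlinarith

theorem letters_le : P.letters ≤ 6 * P.side := by
  have := P.side_pos
  rw [letters]; omega

end MinPlus

end LanEd

theorem RAM.Exec.one_le {B : ℕ} {p : RAM.Prog} {σ σ' : RAM.State} {t : ℕ}
    (h : RAM.Exec B p σ σ' t) : 1 ≤ t := by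
  induction h <;> omega

namespace LanEd

open Filter in
/-- The oracle has to be initialized. -/
theorem SolvableInO.exponent_nonneg {δ : ℝ}
    (h : SolvableInO fun g n => (g : ℝ) * (n : ℝ) ^ (3 - δ)) : δ ≤ 3 := by
  by_contra! hδ
  obtain ⟨p, Q, K, K', c, h⟩ := h
  let P : MinPlus := ⟨1, 0, fun _ _ => 0, one_pos, fun _ _ => one_pos⟩
  -- Every run takes at least one step. For a fixed grammar and growing strings, the time bound
  -- would tend to zero if `δ` were greater than 3.
  have hle : ∀ n : ℕ, 1 ≤ K * ((P.grammar.size : ℝ) * ((n + 1 : ℕ) : ℝ) ^ (3 - δ)) := fun n => by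
    obtain ⟨B, σ₀, T, -, hex, hT, -⟩ := h P.grammar (List.replicate (n + 1) ⟨0, Nat.succ_pos _⟩)
      (16 * P.price) P.admissible (by simp) MinPlus.exists_short
    rw [List.length_replicate] at hT
    exact le_trans (by exact_mod_cast hex.one_le) hT
  have hlim : Tendsto (fun n : ℕ => ((n + 1 : ℕ) : ℝ) ^ (3 - δ)) atTop (nhds 0) := by
    have h1 := (tendsto_rpow_neg_atTop (y := δ - 3) (by linarith)).comp
      (tendsto_natCast_atTop_atTop (R := ℝ) |>.comp (tendsto_add_atTop_nat 1))
    rwa [neg_sub] at h1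
  have hlim' := (hlim.const_mul (P.grammar.size : ℝ)).const_mul K
  simp only [mul_zero] at hlim'
  have := ge_of_tendsto' hlim' hle
  linarith

end LanEd

/-! ### Polynomial bounds for the numbers -/

namespace Imp

open LanEd

theorem two_pow_clog_le {n k : ℕ} (hn : 1 ≤ n) (hk : n ≤ k) : 2 ^ Nat.clog 2 n ≤ 2 * k := by
  rcases hn.eq_or_lt with rfl | h
  · simp; omega
  · have h1 := Nat.pow_pred_clog_lt_self (b := 2) (by norm_num) h
    have h2 := Nat.clog_pos (b := 2) (by norm_num) h
    rw [← Nat.succ_pred_eq_of_pos h2, pow_succ]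
    omega

theorem two_pow_bits_le {N m x W : ℕ} (hN : 1 ≤ N) (hm : N ≤ 8 * m) (hx : x ≤ W) :
    2 ^ bits N x ≤ 2 ^ 12 * ((m + 2) ^ 2 * (W + 2)) := by
  have h1 : 2 ^ Nat.clog 2 N ≤ 16 * m := (two_pow_clog_le hN hm).trans (by omega)
  have h2 : missing N x ≤ 32 * m * W + 1 := by
    rw [missing]
    have := Nat.mul_le_mul h1 hx
    nlinarith
  have h3 := Nat.mul_le_mul h1 h2
  refine (two_pow_clog_le (by omega) (Nat.add_le_add_right (Nat.mul_le_mul_left 2 h3) 1)).trans ?_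
  have : 0 ≤ m * m * W := Nat.zero_le _
  nlinarith [Nat.zero_le (m * W), Nat.zero_le W, Nat.zero_le m, Nat.zero_le (m * m)]

end Imp

/-! ## The running time -/

namespace Imp

open LanEd

/-- The programs `p` and `Q` are an oracle as in `SolvableInO`. -/
def IsOracle (p Q : RAM.Prog) (κ : ℝ) (K c : ℕ) (f : ℕ → ℕ → ℝ) : Prop :=
  ∀ (G : Grammar) (s : List (Fin G.tm)) (L : ℕ), G.Admissible → s ≠ [] →
    (∀ A : Fin G.nt, ∃ z : List (Fin G.tm),
      G.Derives [Symbol.nonterminal A] (G.ofTerminals z) ∧ z.length ≤ L) →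
    ∃ (B : ℕ) (σ₀ : RAM.State) (T : ℕ),
      B = (G.size + G.tm + s.length + L + 2) ^ c ∧
      RAM.Exec B p (LanEd.inputState G s) σ₀ T ∧
      (T : ℝ) ≤ κ * f G.size s.length ∧
      ∀ σ : RAM.State, Served B Q G.nt s.length σ₀ σ →
        ∀ (A : Fin G.nt) (i j : ℕ), 1 ≤ i → i ≤ j → j ≤ s.length →
          ∃ (σ' : RAM.State) (t : ℕ),
            RAM.Exec B Q (ask σ A i j) σ' t ∧ t ≤ K ∧
            ∀ l : ℕ, MCDerives G s A i j l → σ'.reg 0 = l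

section

variable {P : MinPlus} {m : ℕ} (hq : P.side ^ 3 ≤ 8 * m)

include hq

theorem side_pow_six_le : P.side ^ 6 ≤ 64 * m ^ 2 := by
  calc P.side ^ 6 = (P.side ^ 3) ^ 2 := by rw [← pow_mul]
    _ ≤ (8 * m) ^ 2 := Nat.pow_le_pow_left hq 2
    _ = _ := by ring

/-- The cube of the word length is at most `6 ^ 3 * 8 * m = 1728 * m`, and `3 - δ` is three times `1
- δ / 3`. Monotonicity of the power needs `δ ≤ 3`. -/
theorem letters_rpow_le {δ : ℝ} (hδ : 0 ≤ δ) (hδ3 : δ ≤ 3) :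
    (P.letters : ℝ) ^ (3 - δ) ≤ 1728 * (m : ℝ) ^ (1 - δ / 3) := by
  have h1 : (P.letters : ℝ) ^ 3 ≤ 1728 * m := by
    have h := Nat.pow_le_pow_left P.letters_le 3
    have h' : P.letters ^ 3 ≤ 1728 * m := by rw [mul_pow] at h; omega
    exact_mod_cast h'
  calc (P.letters : ℝ) ^ (3 - δ) = ((P.letters : ℝ) ^ 3) ^ (1 - δ / 3) := by
        rw [← Real.rpow_natCast, ← Real.rpow_mul (by positivity)]; congr 1; push_cast; ring
    _ ≤ (1728 * (m : ℝ)) ^ (1 - δ / 3) := Real.rpow_le_rpow (by positivity) h1 (by linarith)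
    _ = 1728 ^ (1 - δ / 3) * (m : ℝ) ^ (1 - δ / 3) :=
        Real.mul_rpow (by norm_num) (by positivity)
    _ ≤ 1728 * (m : ℝ) ^ (1 - δ / 3) := by
        gcongr
        exact (Real.rpow_le_rpow_of_exponent_le (by norm_num) (by linarith)).trans
          (Real.rpow_one _).le

theorem numbers_le {V : ℕ} (hV : 2 ≤ V) (hm : m ≤ V) (hlen : 2 ^ P.len ≤ 2 ^ 12 * V ^ 3) :
    P.grammar.size + P.grammar.tm + P.word.length + 16 * P.price + 2 ≤ V ^ 31 ∧
      30 * P.side ^ 6 * (P.len + 1) ≤ V ^ 31 := by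
  have h1 : P.len + 1 ≤ 2 ^ 12 * V ^ 3 := (Nat.succ_le_of_lt Nat.lt_two_pow_self).trans hlen
  have h6 : P.side ^ 6 ≤ 64 * V ^ 2 :=
    (side_pow_six_le hq).trans (Nat.mul_le_mul_left _ (Nat.pow_le_pow_left hm 2))
  have h2 : P.side ^ 6 * (P.len + 1) ≤ 2 ^ 18 * V ^ 5 :=
    (Nat.mul_le_mul h6 h1).trans (le_of_eq (by ring))
  have hsize := P.size_le
  have htm : P.grammar.tm = P.letters + 1 := rfl
  have hword := MinPlus.word_length (P := P)
  have hprice := P.price_eq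
  have hlet := P.letters_le
  have hside : P.side ≤ 8 * V := (Nat.le_self_pow (n := 3) (by norm_num) P.side).trans (by omega)
  have hV1 : V ≤ V ^ 5 := Nat.le_self_pow (by norm_num) V
  have hV3 : V ^ 3 ≤ V ^ 5 := Nat.pow_le_pow_right (by omega) (by norm_num)
  -- All quantities are at most a constant times `V ^ 5`; since `V ≥ 2`, the constant is absorbed
  -- into the exponent.
  have hV31 : 2 ^ 26 * V ^ 5 ≤ V ^ 31 := by
    rw [show V ^ 31 = V ^ 26 * V ^ 5 by rw [← pow_add]]
    exact Nat.mul_le_mul_right _ (Nat.pow_le_pow_left hV 26)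
  rw [mul_assoc] at hsize
  rw [mul_assoc 30]
  constructor <;> omega

end

/-- The saving is made here: grammar size `m ^ 2 * (len + 1)` times `m ^ (1 - δ / 3)` from the word
gives `m ^ (3 - δ / 3) * (len + 1)`. Writing the input and asking all queries cost `O(m ^ 2 * (len +
1))`, which is no more because `δ ≤ 3`. -/
theorem exists_affordable {p Q : RAM.Prog} {κ δ : ℝ} {K c : ℕ} (hδ : 0 ≤ δ) (hδ3 : δ ≤ 3)
    (hO : IsOracle p Q κ K c fun g n => (g : ℝ) * (n : ℝ) ^ (3 - δ)) :
    ∃ C : ℝ, 0 ≤ C ∧ ∀ (P : MinPlus) (m V T : ℕ), 1 ≤ m → P.side ^ 3 ≤ 8 * m → 2 ≤ V → m ≤ V →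
      2 ^ P.len ≤ 2 ^ 12 * V ^ 3 → C * ((m : ℝ) ^ (3 - δ / 3) * (P.len + 1)) ≤ T →
      Affordable P p Q K (V ^ (31 * (c + 1))) T := by
  -- The summands pay for the productions (`6 * 1920`), the word (`3 * 384`), the constant overhead,
  -- the oracle, and the queries. The absolute value of `κ` is taken because its sign is not known.
  refine ⟨11520 + 1152 + 34 + |κ| * (5760 * 1728) + 64 * (K + 6), by positivity,
    fun P m V T hm hq hV hmV hlen hT => ?_⟩
  obtain ⟨hB, hM⟩ := numbers_le hq hV hmV hlen
  have hle : V ^ 31 ≤ V ^ (31 * (c + 1)) := Nat.pow_le_pow_right (by omega) (by omega)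
  have hword : P.word ≠ [] := List.ne_nil_of_length_pos (by
    rw [MinPlus.word_length, MinPlus.letters]; omega)
  obtain ⟨B, σ₀, T', rfl, hex, hT', hans⟩ := hO P.grammar P.word (16 * P.price) P.admissible hword
    MinPlus.exists_short
  refine ⟨P.nonterminals_le.trans (hM.trans hle), P.productions_length_le.trans (hM.trans hle),
    _, T', σ₀, ?_, hex, hans, ?_⟩
  · calc _ ≤ (V ^ 31) ^ c := Nat.pow_le_pow_left hB c
      _ = V ^ (31 * c) := by rw [← pow_mul]
      _ ≤ _ := Nat.pow_le_pow_right (by omega) (by omega)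
  set X := (m : ℝ) ^ (3 - δ / 3) with hX
  have hm1 : (1 : ℝ) ≤ m := by exact_mod_cast hm
  have hX2 : (m : ℝ) ^ 2 ≤ X := by
    rw [← Real.rpow_natCast]
    exact Real.rpow_le_rpow_of_exponent_le hm1 (by push_cast; linarith)
  have hX1 : (1 : ℝ) ≤ X := (one_le_pow₀ hm1).trans hX2
  have h6 : (P.side : ℝ) ^ 6 ≤ 64 * X := by
    have : (P.side : ℝ) ^ 6 ≤ 64 * (m : ℝ) ^ 2 := by exact_mod_cast side_pow_six_le hq
    linarith
  set Y : ℝ := P.len + 1 with hY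
  have hY1 : 1 ≤ Y := by rw [hY]; have : (0 : ℝ) ≤ P.len := by positivity
                         linarith
  have hXY : X ≤ X * Y := le_mul_of_one_le_right (by linarith) hY1
  have hprod : (P.productions.length : ℝ) ≤ 1920 * (X * Y) := by
    have h1 : (P.productions.length : ℝ) ≤ 30 * (P.side : ℝ) ^ 6 * Y := by
      rw [hY]; exact_mod_cast P.productions_length_le
    calc _ ≤ _ := h1
      _ ≤ 30 * (64 * X) * Y := by gcongr
      _ = _ := by ring
  have hsize : (P.grammar.size : ℝ) ≤ 5760 * (m : ℝ) ^ 2 * Y := by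
    have h1 : (P.grammar.size : ℝ) ≤ 90 * (P.side : ℝ) ^ 6 * Y := by
      rw [hY]; exact_mod_cast P.size_le
    have h2 : (P.side : ℝ) ^ 6 ≤ 64 * (m : ℝ) ^ 2 := by exact_mod_cast side_pow_six_le hq
    calc _ ≤ _ := h1
      _ ≤ 90 * (64 * (m : ℝ) ^ 2) * Y := by gcongr
      _ = _ := by ring
  have hlet : (P.letters : ℝ) ≤ 384 * X := by
    have h1 : P.letters ≤ 6 * P.side ^ 6 := P.letters_le.trans
      (Nat.mul_le_mul_left _ (Nat.le_self_pow (by norm_num) _))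
    have h2 : (P.letters : ℝ) ≤ 6 * (P.side : ℝ) ^ 6 := by exact_mod_cast h1
    linarith
  have hdim : (P.dim2 : ℝ) ≤ 64 * X := by
    have h1 : P.dim2 = P.side ^ 6 := by rw [MinPlus.dim2, MinPlus.dim]; ring
    rw [h1]; push_cast; exact h6
  have hTX : (T' : ℝ) ≤ |κ| * (5760 * 1728) * (X * Y) := by
    rw [MinPlus.word_length] at hT'
    have hmX : (m : ℝ) ^ 2 * (m : ℝ) ^ (1 - δ / 3) = X := by
      rw [← Real.rpow_natCast, ← Real.rpow_add (by linarith), hX]; congr 1; push_cast; ring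
    calc (T' : ℝ) ≤ κ * ((P.grammar.size : ℝ) * (P.letters : ℝ) ^ (3 - δ)) := hT'
      _ ≤ |κ| * ((P.grammar.size : ℝ) * (P.letters : ℝ) ^ (3 - δ)) := by
          gcongr; exact le_abs_self κ
      _ ≤ |κ| * ((5760 * (m : ℝ) ^ 2 * Y) * (1728 * (m : ℝ) ^ (1 - δ / 3))) := by
          gcongr; exact letters_rpow_le hq hδ hδ3
      _ = |κ| * (5760 * 1728) * (((m : ℝ) ^ 2 * (m : ℝ) ^ (1 - δ / 3)) * Y) := by ring
      _ = _ := by rw [hmX]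
  have hK : (P.dim2 : ℝ) * (K + 6) ≤ 64 * (K + 6) * (X * Y) := by
    calc (P.dim2 : ℝ) * (K + 6) ≤ (64 * (X * Y)) * (K + 6) := by gcongr; linarith
      _ = _ := by ring
  have hsum : ((P.productions.length * 6 + P.letters * 3 + 34 + T' + P.dim2 * (K + 6) : ℕ) : ℝ) ≤
      T := by
    push_cast
    linarith
  exact_mod_cast hsum

/-- The logarithmic factors. -/
theorem bits_add_one_le {N m x W : ℕ} (hN : 1 ≤ N) (hm : N ≤ 8 * m) (hx : x ≤ W) :
    (bits N x : ℝ) + 1 ≤ 36 * (Real.log (m + 2) * Real.log (W + 2)) ∧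
      (Nat.clog 2 N : ℝ) ≤ 6 * Real.log (m + 2) := by
  have hlog2 : (1 / 2 : ℝ) ≤ Real.log 2 := by have := Real.log_two_gt_d9; linarith
  have hm1 : 1 ≤ m := by omega
  have hA : 1 ≤ Real.log (m + 2) := by
    rw [Real.le_log_iff_exp_le (by positivity)]
    have h1 := Real.exp_one_lt_d9
    have h2 : (1 : ℝ) ≤ m := by exact_mod_cast hm1
    linarith
  have hB : 1 / 2 ≤ Real.log (W + 2) :=
    hlog2.trans (Real.log_le_log (by norm_num) (by have : (0 : ℝ) ≤ W := by positivity
                                                   linarith))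
  have hlog : ∀ {k n : ℕ}, 2 ^ k ≤ n → (k : ℝ) * Real.log 2 ≤ Real.log n := fun {k n} h => by
    rw [← Real.log_pow]
    exact Real.log_le_log (by positivity) (by exact_mod_cast h)
  constructor
  · have h1 := hlog (two_pow_bits_le hN hm hx)
    push_cast at h1
    rw [show (4096 : ℝ) = 2 ^ 12 by norm_num, Real.log_mul (by positivity) (by positivity),
      Real.log_mul (by positivity) (by positivity), Real.log_pow, Real.log_pow] at h1
    push_cast at h1
    have h2 : ((bits N x : ℝ) - 12) * (1 / 2) ≤
        2 * Real.log (m + 2) + Real.log (W + 2) := by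
      rcases le_total (bits N x : ℝ) 12 with h | h
      · nlinarith
      · nlinarith
    nlinarith [mul_nonneg (sub_nonneg.2 hA) (sub_nonneg.2 hB)]
  · have h1 := hlog (two_pow_clog_le hN (hm.trans (Nat.mul_le_mul_left 8 (Nat.le_add_right m 2))))
    push_cast at h1
    rw [show 2 * (8 * ((m : ℝ) + 2)) = 2 ^ 4 * (m + 2) by ring,
      Real.log_mul (by positivity) (by positivity), Real.log_pow] at h1
    push_cast at h1
    have h2 : ((Nat.clog 2 N : ℝ) - 4) * (1 / 2) ≤ Real.log (m + 2) := by
      rcases le_total (Nat.clog 2 N : ℝ) 4 with h | h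
      · nlinarith
      · nlinarith
    linarith

end Imp

/-! ### The total running time -/

namespace Imp

open LanEd APSP

theorem succ_cube_le {j m : ℕ} (h : j ^ 3 < m) : (j + 1) ^ 3 ≤ 8 * m := by
  rcases Nat.eq_zero_or_pos j with rfl | hj
  · omega
  · calc (j + 1) ^ 3 ≤ (2 * j) ^ 3 := Nat.pow_le_pow_left (by omega) 3
      _ = 8 * j ^ 3 := by ring
      _ ≤ 8 * m := by omega

/-- One factor `log (m + 2)` comes from the number of rounds. The other one and `log (W + 2)` come
from the number of bits of the entries. -/
theorem exists_runs_shortestPaths {p Q : RAM.Prog} {κ δ : ℝ} {K c : ℕ} (hδ : 0 ≤ δ) (hδ3 : δ ≤ 3)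
    (hO : IsOracle p Q κ K c fun g n => (g : ℝ) * (n : ℝ) ^ (3 - δ)) :
    ∃ C : ℝ, ∀ (m W : ℕ) (w : WDigraph m), 1 ≤ m →
      (∀ (u v : Fin m) (x : ℤ), w u v = some x → |x| ≤ W) → NoNegativeCycle w →
      ∃ T : ℕ, (T : ℝ) ≤
          C * ((m : ℝ) ^ (3 - δ / 3) * Real.log (W + 2)) * Real.log (m + 2) ^ 2 ∧
        Runs ((m + W + 2) ^ (31 * (c + 1))) (shortestPaths p Q) (inputMem w) T fun σ =>
          ∀ u v : Fin m, ((∃ d : ℤ, IsWalk w u v d) → σ.arr 1 ((u : ℤ) * m + v) = 1 ∧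
              IsLeast {d : ℤ | IsWalk w u v d} (σ.arr 0 ((u : ℤ) * m + v))) ∧
            ((¬ ∃ d : ℤ, IsWalk w u v d) → σ.arr 1 ((u : ℤ) * m + v) = 0) := by
  obtain ⟨C, hC, hA⟩ := exists_affordable hδ hδ3 hO
  -- Here `648 = 3 * 6 * 36`: `T'` enters three times, the number of rounds is at most `6 * a` and
  -- the number of bits plus one at most `36 * (a * b)`. The remaining terms are covered by 1200.
  refine ⟨1200 + 648 * C, fun m W w hm hw hc => ?_⟩
  obtain ⟨V, hV⟩ : ∃ V, V = m + W + 2 := ⟨_, rfl⟩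
  rw [← hV]
  set a := Real.log (m + 2)
  set b := Real.log (W + 2)
  set X := (m : ℝ) ^ (3 - δ / 3) with hX
  have hm1 : (1 : ℝ) ≤ m := by exact_mod_cast hm
  have hX2 : (m : ℝ) ^ 2 ≤ X := by
    rw [← Real.rpow_natCast]
    exact Real.rpow_le_rpow_of_exponent_le hm1 (by push_cast; linarith)
  have ha : 1 ≤ a := by
    rw [Real.le_log_iff_exp_le (by positivity)]
    have := Real.exp_one_lt_d9
    linarith
  have hb : 1 / 2 ≤ b := by
    have h2 := Real.log_two_gt_d9
    have h3 : Real.log 2 ≤ b := Real.log_le_log (by norm_num)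
      (by have : (0 : ℝ) ≤ W := by positivity
          linarith)
    linarith
  obtain ⟨T, hT₁, hT₂⟩ : ∃ T : ℕ, C * (X * (36 * (a * b))) ≤ T ∧
      (T : ℝ) ≤ C * (X * (36 * (a * b))) + 1 :=
    ⟨_, Nat.le_ceil _, (Nat.ceil_lt_add_one (by positivity)).le⟩
  obtain ⟨T', hT₁', hT₂'⟩ : ∃ T' : ℕ, 64 * X + 6 * a * (T + 5) + 144 * (a * b) ≤ T' ∧
      (T' : ℝ) ≤ 64 * X + 6 * a * (T + 5) + 144 * (a * b) + 1 :=
    ⟨_, Nat.le_ceil _, (Nat.ceil_lt_add_one (by positivity)).le⟩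
  have hVM : ∀ {k}, k ≤ 31 → V ^ k ≤ V ^ (31 * (c + 1)) := fun h =>
    Nat.pow_le_pow_right (by omega) (by omega)
  have hV1 := hVM (k := 1) (by norm_num)
  have hV2 := hVM (k := 2) (by norm_num)
  have hV8 := hVM (k := 8) (by norm_num)
  have hV15 := hVM (k := 15) (by norm_num)
  rw [pow_one] at hV1
  refine ⟨_, ?_, shortestPaths_runs (K := K) (T := T) (T' := T') hm hw hc (by omega)
    (le_trans (by rw [← sq]; exact Nat.pow_le_pow_left (by omega) 2) hV2) (by omega)
    fun j x hj _ hx => ?_⟩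
  · push_cast
    have hXab : X ≤ 2 * (X * b * a ^ 2) := by
      have h1 : 1 ≤ a ^ 2 := one_le_pow₀ ha
      have h2 : 1 ≤ 2 * b * a ^ 2 := by nlinarith
      nlinarith
    have hX1 : 1 ≤ X := (one_le_pow₀ hm1).trans hX2
    have habX : a * b ≤ X * b * a ^ 2 := by
      have h1 : a * b ≤ a * b * a := le_mul_of_one_le_right (by positivity) ha
      have h2 : a * b * a ≤ a * b * a * X := le_mul_of_one_le_right (by positivity) hX1
      linarith
    have haX : a ≤ 2 * (X * b * a ^ 2) := by
      have : a ≤ 2 * (a * b) := by nlinarith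
      linarith
    have haT : a * T ≤ 36 * C * (X * b * a ^ 2) + a := by
      calc a * T ≤ a * (C * (X * (36 * (a * b))) + 1) := by gcongr
        _ = _ := by ring
    nlinarith
  · have hcube := succ_cube_le hj
    have hN : (j + 1) * (j + 1) * (j + 1) ≤ 8 * m := by rwa [← pow_three']
    have hNpos : 1 ≤ (j + 1) * (j + 1) * (j + 1) := Nat.succ_le_of_lt (by positivity)
    have hbits := two_pow_bits_le hNpos hN hx
    obtain ⟨hl₁, hl₂⟩ := bits_add_one_le hNpos hN hx
    intro N
    have hbits' : 2 ^ bits N x ≤ 2 ^ 12 * V ^ 3 := hbits.trans <| Nat.mul_le_mul_left _ <| by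
      calc (m + 2) ^ 2 * (W + 2) ≤ V ^ 2 * V :=
            Nat.mul_le_mul (Nat.pow_le_pow_left (by omega) 2) (by omega)
        _ = V ^ 3 := by ring
    have hNN : N * N ≤ 64 * m ^ 2 := (Nat.mul_le_mul hN hN).trans (le_of_eq (by ring))
    refine ⟨hNN.trans (le_trans ?_ hV8), (hbits'.trans ?_).trans hV15, fun P hs hlen => ?_, ?_⟩
    · calc 64 * m ^ 2 ≤ V ^ 6 * V ^ 2 := Nat.mul_le_mul
            (Nat.pow_le_pow_left (by omega : 2 ≤ V) 6) (Nat.pow_le_pow_left (by omega) 2)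
        _ = V ^ 8 := by ring
    · calc 2 ^ 12 * V ^ 3 ≤ V ^ 12 * V ^ 3 :=
            Nat.mul_le_mul_right _ (Nat.pow_le_pow_left (by omega : 2 ≤ V) 12)
        _ = V ^ 15 := by ring
    · refine hA P m V T hm (by rwa [hs]) (by omega) (by omega) (by rwa [hlen])
        (le_trans ?_ hT₁)
      rw [hlen]
      gcongr
    · have h1 : (N : ℝ) * N ≤ 64 * X := by
        have : (N : ℝ) * N ≤ 64 * (m : ℝ) ^ 2 := by exact_mod_cast hNN
        linarith
      have h2 : (Nat.clog 2 N : ℝ) * (T + 5) ≤ 6 * a * (T + 5) := by gcongr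
      have h3 : ((N * N + (Nat.clog 2 N * (T + 5) + bits N x * 4) : ℕ) : ℝ) ≤ T' := by
        push_cast
        linarith
      exact_mod_cast h3

end Imp

theorem mainTheorem3 (δ : ℝ) (hδ : 0 < δ)
    (h : LanEd.SolvableInO fun g n => (g : ℝ) * (n : ℝ) ^ (3 - δ)) :
    APSP.SolvableInSoftO fun m W => (m : ℝ) ^ (3 - δ / 3) * Real.log (W + 2) := by
  have hpos : ∀ S : ℕ, (0 : ℝ) ≤ 2 * S + 5 := fun S => by positivity
  have hδ3 := h.exponent_nonneg
  obtain ⟨p, Q, κ, K, c, hO⟩ := h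
  obtain ⟨C, hC⟩ := Imp.exists_runs_shortestPaths hδ.le hδ3 hO
  obtain ⟨S, hS⟩ : ∃ S, (Imp.shortestPaths p Q).size = S := ⟨_, rfl⟩
  -- The size `S` depends only on the two oracle programs, so compilation costs a constant factor in
  -- time and a constant factor in the exponent of the numbers.
  refine ⟨(Imp.shortestPaths p Q).compile, (2 * S + 5) * C, 2, 31 * (c + 1) * (S + 1),
    fun m W w hm hw hc => ?_⟩
  obtain ⟨T, hT, σ, t, hex, ht, hout⟩ := hC m W w hm hw hc
  have hM : m + W + 2 ≤ (m + W + 2) ^ (31 * (c + 1)) := Nat.le_self_pow (by omega) _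
  obtain ⟨τ, t', hex', ht', hrep⟩ := hex.compile (by omega) hS.le
    (Imp.inputMem_bdd (by omega) (by omega) fun u v x hx => (hw u v x hx).trans (by
      exact_mod_cast (by omega : W ≤ m + W + 2).trans hM)) _ (Imp.rep_inputMem w)
  refine ⟨τ, t', ?_, ?_, fun u v => ?_⟩
  · rwa [← pow_mul] at hex'
  · have h1 : (t' : ℝ) ≤ (2 * S + 5) * T := by
      exact_mod_cast ht'.trans (Nat.mul_le_mul_left _ ht)
    have h2 := mul_le_mul_of_nonneg_left hT (hpos S)
    rw [mul_assoc C, ← mul_assoc _ C, ← mul_assoc (_ * C)] at h2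
    exact h1.trans h2
  · rw [hrep.2]
    exact hout u v
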